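/- Let $d\in\{1,2,3\}$, let $T>0$, and let $b:\mathbb{R}\to\mathbb{R}$ be globally Lipschitz. Let $G_t(dx)$ be the fundamental solution of the wave equation in $\mathbb{R}^d$ for $t>0$: $G_t(dx)=\frac12\mathbf 1_{\{|x|<t\}}dx$ if $d=1$, $G_t(dx)=\frac1{2\pi}(t^2-|x|^2)^{-1/2}\mathbf 1_{\{|x|<t\}}dx$ if $d=2$, and $G_t(dx)=\frac1{4\pi t}\sigma_t(dx)$ if $d=3$, where $\sigma_t$ is the surface measure of the sphere of radius $t$ centred at $0$; put $G_0=0$. For a function $f$ on $\mathbb{R}^d$ write $(f*G_t)(x)=\int f(x-y)\,G_t(dy)$. Equip $\mathcal C([0,T]\times\mathbb{R}^d)$ with the topology of uniform convergence on compact sets. (1) Let $(\Omega,\mathcal A,\mathbb P)$ be a complete probability space and $\mu$ a non-negative tempered Borel measure on $\mathbb{R}^d$ such that, for some $q\in(0,2)$, $$\int_{\mathbb{R}^d}\frac{\mu(d\xi)}{1+|\xi|^q}<\infty .$$ Let $W=\{W(\varphi)\}$ be a centred Gaussian process indexed by $\varphi\in\mathcal C_0^\infty([0,\infty)\times\mathbb{R}^d)$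 with $$\mathbb E[W(\varphi)W(\psi)]=\int_0^\infty\int_{\mathbb{R}^d}\mathcal F\varphi(t,\cdot)(\xi)\,\overline{\mathcal F\psi(t,\cdot)(\xi)}\,\mu(d\xi)\,dt,\qquad \mathcal Ff(\xi)=\int_{\mathbb{R}^d}e^{-i\langle\xi,x\rangle}f(x)\,dx .$$ Extend $W$ by $L^2(\Omega)$-isometry to the completion of the test functions (Wiener integral), and let $\mathcal F_t$ be the $\sigma$-algebra generated by the variables $W(\mathbf 1_{[0,s]}\varphi)$, with $s\in[0,t]$ and $\varphi$ a test function, and by the $\mathbb P$-null sets. Let the initial data $u_0,v_0:\mathbb{R}^d\to\mathbb{R}$ satisfy the following. If $d=1$: $u_0$ is bounded and continuous, and $v_0$ is bounded and measurable. If $d=2$: $u_0\in C^1(\mathbb{R}^2)$, and $u_0,\nabla u_0,v_0\in L^p(\mathbb{R}^2)$ for some $p\in(2,\infty]$. If $d=3$: $u_0\in C^1(\mathbb{R}^3)$, $u_0$ and $\nabla u_0$ are bounded, and $v_0$ is bounded and continuous. Put $I_0(0,x)=u_0(x)$ and $I_0(t,x)=(v_0*G_t)(x)+\partial_t(u_0*G_t)(x)$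 for $t>0$. Let $u=\{u(t,x),\,(t,x)\in[0,T]\times\mathbb{R}^d\}$ be a mild solution of the stochastic wave equation $\partial_t^2u-\Delta u=b(u)+\dot W$ with initial data $u_0,v_0$; that is, $u$ is jointly measurable and adapted to $(\mathcal F_t)$, $\sup_{(t,x)\in[0,T]\times\mathbb{R}^d}\mathbb E|u(t,x)|^2<\infty$, and for every $(t,x)\in[0,T]\times\mathbb{R}^d$, $\mathbb P$-almost surely, $$u(t,x)=I_0(t,x)+\int_0^t\int_{\mathbb{R}^d}G_{t-s}(x-y)\,W(ds,dy)+\int_0^t\big(b(u(s,\cdot))*G_{t-s}\big)(x)\,ds .$$ Then $u$ has a modification with continuous sample paths on $[0,T]\times\mathbb{R}^d$. (2) For every $\eta\in\mathcal C([0,T]\times\mathbb{R}^d)$ the deterministic equation $$z(t,x)=\eta(t,x)+\int_0^t\big(b(z(s,\cdot))*G_{t-s}\big)(x)\,ds,\qquad (t,x)\in[0,T]\times\mathbb{R}^d,$$ has a unique solution $z\in\mathcal C([0,T]\times\mathbb{R}^d)$, and the solution map $\eta\mapsto z$ is continuous from $\mathcal C([0,T]\times\mathbb{R}^d)$ to itself.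 -/

import Mathlib

open MeasureTheory ProbabilityTheory Set Filter Topology
open scoped ENNReal NNReal Distributions

noncomputable section

/-- The space `ℝ^d` with its Euclidean norm. -/
abbrev Space (d : ℕ) : Type := EuclideanSpace ℝ (Fin d)

/-! ### The deterministic wave equation -/

/-- The surface measure of the sphere of radius `t` centred at the origin of `ℝ³`: the image of the
surface measure of the unit sphere under `ω ↦ t ω`, times `t²`; its total mass is `4 π t²`. -/
def sphereSurface (t : ℝ) : Measure (Space 3) :=
  ENNReal.ofReal (t ^ 2) •
    ((volume : Measure (Space 3)).toSphere.map fun ω : Metric.sphere (0 : Space 3) 1 =>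
      t • (ω : Space 3))

/-- The fundamental solution `G_t(dx)` of the wave equation in `ℝ^d`, `d ∈ {1, 2, 3}`, as a measure
(for `d = 1, 2` it is given by a density). It vanishes for `t ≤ 0`. The value for other `d` is a
placeholder that is never used. -/
def waveKernel : (d : ℕ) → ℝ → Measure (Space d)
  | 1, t => volume.withDensity
      ((Metric.ball 0 t).indicator fun _ => ENNReal.ofReal (1 / 2))
  | 2, t => volume.withDensity
      ((Metric.ball 0 t).indicator fun x =>
        ENNReal.ofReal (1 / (2 * Real.pi) * (1 / Real.sqrt (t ^ 2 - ‖x‖ ^ 2))))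
  | 3, t => ENNReal.ofReal (1 / (4 * Real.pi * t)) • sphereSurface t
  | _, _ => 0

/-- The convolution `(f * G_t)(x) = ∫ f(x - y) G_t(dy)`. -/
def waveConv (d : ℕ) (f : Space d → ℝ) (t : ℝ) (x : Space d) : ℝ :=
  ∫ y, f (x - y) ∂(waveKernel d t)

/-- The solution `I₀(t,x) = (v₀ * G_t)(x) + ∂_t (u₀ * G_t)(x)` of the linear homogeneous wave
equation with initial position `u₀` and initial velocity `v₀`; at time zero it equals `u₀`. -/
def linearWave (d : ℕ) (u₀ v₀ : Space d → ℝ) (t : ℝ) (x : Space d) : ℝ :=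
  if t = 0 then u₀ x
  else waveConv d v₀ t x + deriv (fun r => waveConv d u₀ r x) t

/-- The assumptions on the initial data, for `d ∈ {1, 2, 3}`. -/
def WaveInitialData : (d : ℕ) → (Space d → ℝ) → (Space d → ℝ) → Prop
  | 1, u₀, v₀ =>
      (Continuous u₀ ∧ ∃ C : ℝ, ∀ x, |u₀ x| ≤ C) ∧
      (Measurable v₀ ∧ ∃ C : ℝ, ∀ x, |v₀ x| ≤ C)
  | 2, u₀, v₀ =>
      ContDiff ℝ 1 u₀ ∧ ∃ p : ℝ≥0∞, 2 < p ∧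
        MemLp u₀ p volume ∧ MemLp (fun x => fderiv ℝ u₀ x) p volume ∧ MemLp v₀ p volume
  | 3, u₀, v₀ =>
      (ContDiff ℝ 1 u₀ ∧ (∃ C : ℝ, ∀ x, |u₀ x| ≤ C) ∧ ∃ C : ℝ, ∀ x, ‖fderiv ℝ u₀ x‖ ≤ C) ∧
      (Continuous v₀ ∧ ∃ C : ℝ, ∀ x, |v₀ x| ≤ C)
  | _, _, _ => False

/-- The drift term `∫_0^t (b(w(s)) * G_{t-s})(x) ds`. -/
def driftTerm (d : ℕ) (b : ℝ → ℝ) (w : ℝ → Space d → ℝ) (t : ℝ) (x : Space d) : ℝ :=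
  ∫ s in (0 : ℝ)..t, waveConv d (fun y => b (w s y)) (t - s) x

/-- The space `C([0,T] × ℝ^d)`; its topology is that of uniform convergence on compact sets. -/
abbrev PathSpace (d : ℕ) (T : ℝ) : Type := C(Icc (0 : ℝ) T × Space d, ℝ)

/-- `z ∈ C([0,T] × ℝ^d)` solves `z(t,x) = η(t,x) + ∫_0^t (b(z(s)) * G_{t-s})(x) ds` for all
`(t,x) ∈ [0,T] × ℝ^d`. (Only the values of `z` at times `s ∈ [0,t]` enter; `IccExtend` merely
makes `z` a function of a real time variable.) -/
def SolvesIntegralEq (d : ℕ) {T : ℝ} (hT : 0 ≤ T) (b : ℝ → ℝ) (η z : PathSpace d T) : Prop :=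
  ∀ (t : Icc (0 : ℝ) T) (x : Space d),
    z (t, x) = η (t, x)
      + driftTerm d b (fun s y => IccExtend hT (fun r => z (r, y)) s) (t : ℝ) x

/-! ### The noise, Wiener integrals, and mild solutions -/

/-- Real test functions. A smooth compactly supported function on `[0,∞) × ℝ^d` is the restriction
of one on `ℝ × ℝ^d`; only the values at times `t ≥ 0` enter below. -/
abbrev NoiseTest (d : ℕ) : Type := 𝓓((⊤ : TopologicalSpace.Opens (ℝ × Space d)), ℝ)

/-- The spatial Fourier transform `ℱ φ(t,·)(ξ) = ∫ e^{-i⟨ξ,x⟩} φ(t,x) dx`. -/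
def spaceFourier {d : ℕ} (φ : NoiseTest d) (t : ℝ) (ξ : Space d) : ℂ :=
  ∫ x : Space d, Complex.exp (-Complex.I * ((inner ℝ ξ x : ℝ) : ℂ)) * ((φ (t, x) : ℝ) : ℂ)

/-- The Fourier transform `ℱ ν(ξ) = ∫ e^{-i⟨ξ,y⟩} ν(dy)` of a finite measure. -/
def measureFourier {d : ℕ} (ν : Measure (Space d)) (ξ : Space d) : ℂ :=
  ∫ y, Complex.exp (-Complex.I * ((inner ℝ ξ y : ℝ) : ℂ)) ∂ν

/-- `W` is a spatially homogeneous Gaussian noise, white in time, with spectral measure `μ`: a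
centred Gaussian process indexed by test functions with
`E[W(φ) W(ψ)] = ∫_0^∞ ∫ ℱφ(t,·)(ξ) conj(ℱψ(t,·)(ξ)) μ(dξ) dt`, where `μ` is tempered. -/
structure IsHomogeneousNoise {d : ℕ} {Ω : Type*} [MeasurableSpace Ω] (P : Measure Ω)
    (μ : Measure (Space d)) (W : NoiseTest d → Ω → ℝ) : Prop where
  tempered : μ.HasTemperateGrowth
  measurable : ∀ φ, Measurable (W φ)
  gaussian : IsGaussianProcess W P
  centered : ∀ φ, ∫ ω, W φ ω ∂P = 0
  covariance : ∀ φ ψ,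
    (((∫ ω, W φ ω * W ψ ω ∂P : ℝ)) : ℂ) =
      ∫ t in Ioi (0 : ℝ), ∫ ξ,
        spaceFourier φ t ξ * (starRingEnd ℂ) (spaceFourier ψ t ξ) ∂μ

/-- The random variable `V` is (a version of) the Wiener integral `W(g)`, where `g` is the element
of the completion of the test functions with spatial Fourier transform `ghat`: there are test
functions `φ_k` that converge to `g` in that completion, that is,
`∫_0^∞ ∫ |ℱφ_k(s,·)(ξ) - ghat(s,ξ)|² μ(dξ) ds → 0`, and `W(φ_k) → V` in `L²(Ω)`. -/
def IsWienerIntegral {d : ℕ} {Ω : Type*} [MeasurableSpace Ω] (P : Measure Ω)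
    (μ : Measure (Space d)) (W : NoiseTest d → Ω → ℝ) (ghat : ℝ → Space d → ℂ)
    (V : Ω → ℝ) : Prop :=
  Measurable V ∧ ∃ φ : ℕ → NoiseTest d,
    Tendsto (fun k => ∫⁻ s in Ioi (0 : ℝ), ∫⁻ ξ, ‖spaceFourier (φ k) s ξ - ghat s ξ‖ₑ ^ 2 ∂μ)
      atTop (𝓝 0) ∧
    Tendsto (fun k => ∫⁻ ω, ‖W (φ k) ω - V ω‖ₑ ^ 2 ∂P) atTop (𝓝 0)

/-- The spatial Fourier transform of `1_{[0,r]} φ`. -/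
def cutoffFourier {d : ℕ} (r : ℝ) (φ : NoiseTest d) (s : ℝ) (ξ : Space d) : ℂ :=
  if s ≤ r then spaceFourier φ s ξ else 0

/-- The spatial Fourier transform of `(s,y) ↦ 1_{[0,t]}(s) G_{t-s}(x - y)`. -/
def kernelFourier (d : ℕ) (t : ℝ) (x : Space d) (s : ℝ) (ξ : Space d) : ℂ :=
  if s ≤ t then measureFourier ((waveKernel d (t - s)).map fun y => x - y) ξ else 0

/-- The σ-algebra `ℱ_t` generated by the Wiener integrals `W(1_{[0,r]} φ)`, `r ∈ [0,t]`, `φ` a test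
function, and by the `P`-null sets. -/
@[reducible]
def noiseFiltration {d : ℕ} {Ω : Type*} [MeasurableSpace Ω] (P : Measure Ω)
    (μ : Measure (Space d)) (W : NoiseTest d → Ω → ℝ) (t : ℝ) : MeasurableSpace Ω :=
  MeasurableSpace.generateFrom
    ({A | ∃ r ∈ Icc (0 : ℝ) t, ∃ φ : NoiseTest d, ∃ V : Ω → ℝ,
        IsWienerIntegral P μ W (cutoffFourier r φ) V ∧
        ∃ B : Set ℝ, MeasurableSet B ∧ A = V ⁻¹' B} ∪ {A | P A = 0})

/-- `u = {u(t,x), (t,x) ∈ [0,T] × ℝ^d}` is a mild solution on `[0,T]` of the stochastic wave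
equation with drift `b`, initial data `u₀, v₀` and noise `W`, with bounded second moments: it is
adapted and jointly measurable, `sup_{t,x} E|u(t,x)|² < ∞`, and, for all `(t,x)`, almost surely
`u(t,x) = I₀(t,x) + ∫_0^t ∫ G_{t-s}(x-y) W(ds,dy) + ∫_0^t (b(u(s)) * G_{t-s})(x) ds`.
Only the values of `u` at times in `[0,T]` matter. -/
structure IsMildSolution {d : ℕ} {Ω : Type*} [MeasurableSpace Ω] (P : Measure Ω)
    (μ : Measure (Space d)) (W : NoiseTest d → Ω → ℝ) (T : ℝ) (b : ℝ → ℝ)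
    (u₀ v₀ : Space d → ℝ) (u : ℝ → Space d → Ω → ℝ) : Prop where
  jointlyMeasurable :
    Measurable fun p : (Icc (0 : ℝ) T × Space d) × Ω => u (p.1.1 : ℝ) p.1.2 p.2
  adapted : ∀ t ∈ Icc (0 : ℝ) T, ∀ x, Measurable[noiseFiltration P μ W t] (u t x)
  moments : ∃ C : ℝ≥0, ∀ t ∈ Icc (0 : ℝ) T, ∀ x, ∫⁻ ω, ‖u t x ω‖ₑ ^ 2 ∂P ≤ C
  mild : ∀ t ∈ Icc (0 : ℝ) T, ∀ x, ∃ V : Ω → ℝ,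
    IsWienerIntegral P μ W (kernelFourier d t x) V ∧
    ∀ᵐ ω ∂P, u t x ω =
      linearWave d u₀ v₀ t x + V ω + driftTerm d b (fun s y => u s y ω) t x

end

noncomputable section

/-! ### Integrals in coordinates -/

/-! Everything rests on the unit kernel `waveKernel d 1`: a probability measure κ on the closed unit
ball, of which the kernel at time t is the dilation by t with mass t (`waveKernel_eq_map`). Hence
the drift at (t,x) is the integral of (t-s) b(w(s, x-(t-s)z)) against ds κ(dz), for measures with or
without a density alike, and it only sees w in the backward cone of (t,x).

Deterministic equation. On a cone ‖y‖ ≤ R - s the drift is Lipschitz in the sense of a Volterra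
inequality with rate K T (`abs_driftMap_sub_le`). Picard differences are therefore at most C (K T
s)^n / n!, the iterates converge locally uniformly, and a Gronwall bound on cones gives uniqueness
and continuity of the solution map.

Stochastic convolution. In each of the three dimensions κ projects onto every line as the uniform
law on (-1,1) (`map_inner_waveKernel_one`), so its Fourier transform is bounded by min(1, 1/‖ξ‖).
Interpolating between this decay and the Lipschitz dependence on (t,x), at the price of a power of
‖ξ‖, gives kernel increments of order δ^((2-q)/4) with weight (1+‖ξ‖)^(-q), which is μ-integrable.
The noise is Gaussian, so this controls increments in every moment (`exists_wiener_moment_bound`),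
and chaining over dyadic nets yields a continuous version Y.

Linear part. I₀ is continuous up to t = 0: by d'Alembert's formula in dimension one, by
differentiation under the integral for C¹ data, and by Hölder's inequality with approximation for
velocities in L^p, since the planar kernel lies in L^r exactly for r < 2.

Conclusion. Path by path, the integral equation with η = I₀ + Y has a continuous solution U. The
field u satisfies this equation only almost surely at each fixed point, so uniqueness cannot be
applied to its paths. Instead the Picard iterates are shown to converge to u(t,x) in L¹(Ω) at every
point, with the same factorial rate; they also converge to U(t,x), so U is a modification of u. -/

theorem lintegral_space_one {F : ℝ → ℝ≥0∞} (hF : Measurable F) :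
    ∫⁻ x : Space 1, F (x 0) = ∫⁻ a, F a := by
  have h := (volume_preserving_funUnique (Fin 1) ℝ).comp
    (EuclideanSpace.volume_preserving_symm_measurableEquiv_toLp (Fin 1))
  simpa using h.lintegral_comp hF

theorem lintegral_space_two {F : ℝ × ℝ → ℝ≥0∞} (hF : Measurable F) :
    ∫⁻ x : Space 2, F (x 0, x 1) = ∫⁻ a, ∫⁻ b, F (a, b) := by
  have h := (volume_preserving_finTwoArrow ℝ).comp
    (EuclideanSpace.volume_preserving_symm_measurableEquiv_toLp (Fin 2))
  rw [← lintegral_prod _ hF.aemeasurable, ← Measure.volume_eq_prod, ← h.lintegral_comp hF]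
  rfl

theorem lintegral_space_three {F : ℝ × ℝ × ℝ → ℝ≥0∞} (hF : Measurable F) :
    ∫⁻ x : Space 3, F (x 0, x 1, x 2) = ∫⁻ a, ∫⁻ p : ℝ × ℝ, F (a, p) := by
  have h := ((MeasurePreserving.id (volume : Measure ℝ)).prod
    (volume_preserving_finTwoArrow ℝ)).comp
    ((volume_preserving_piFinSuccAbove (fun _ : Fin 3 => ℝ) 0).comp
    (EuclideanSpace.volume_preserving_symm_measurableEquiv_toLp (Fin 3)))
  rw [← lintegral_prod _ hF.aemeasurable, ← h.lintegral_comp hF]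
  rfl

/-- Integration of a function of the distance to the origin in the plane. -/
theorem lintegral_radial_plane {F : ℝ → ℝ≥0∞} (hF : Measurable F) :
    ∫⁻ p : ℝ × ℝ, F (√(p.1 ^ 2 + p.2 ^ 2))
      = ENNReal.ofReal (2 * Real.pi) * ∫⁻ r in Ioi (0 : ℝ), ENNReal.ofReal r * F r := by
  rw [← lintegral_comp_polarCoord_symm, polarCoord_target, Measure.volume_eq_prod,
    setLIntegral_prod]
  · calc _ = ∫⁻ r in Ioi (0 : ℝ), ENNReal.ofReal (2 * Real.pi) * (ENNReal.ofReal r * F r) := by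
          refine setLIntegral_congr_fun measurableSet_Ioi fun r hr => ?_
          have hr' : 0 < r := hr
          have : ∀ θ : ℝ, √((polarCoord.symm (r, θ)).1 ^ 2 + (polarCoord.symm (r, θ)).2 ^ 2) = r := by
            intro θ
            simp only [polarCoord_symm_apply]
            rw [show (r * Real.cos θ) ^ 2 + (r * Real.sin θ) ^ 2 = r ^ 2 by
              linear_combination r ^ 2 * Real.sin_sq_add_cos_sq θ, Real.sqrt_sq hr'.le]
          simp only [this, smul_eq_mul, lintegral_const, Measure.restrict_apply MeasurableSet.univ,
            univ_inter, Real.volume_Ioo]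
          rw [mul_comm]; congr 2; ring
      _ = _ := by
          rw [lintegral_const_mul]
          exact ENNReal.measurable_ofReal.mul hF
  · have : Measurable fun p : ℝ × ℝ => polarCoord.symm p := continuous_polarCoord_symm.measurable
    fun_prop

/-- Polar coordinates in the upper half plane. -/
theorem lintegral_half_plane_polar {F : ℝ × ℝ → ℝ≥0∞} (hF : Measurable F) :
    ∫⁻ a, ∫⁻ r in Ioi (0 : ℝ), ENNReal.ofReal r * F (a, r)
      = ∫⁻ r in Ioi (0 : ℝ), ∫⁻ θ in Ioo (0 : ℝ) Real.pi,
        ENNReal.ofReal (r ^ 2) * (ENNReal.ofReal (Real.sin θ) *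
          F (r * Real.cos θ, r * Real.sin θ)) := by
  set H : ℝ × ℝ → ℝ≥0∞ := (univ ×ˢ Ioi (0 : ℝ)).indicator fun p => ENNReal.ofReal p.2 * F p with hH
  have hHm : Measurable H := Measurable.indicator (by fun_prop) (MeasurableSet.univ.prod measurableSet_Ioi)
  have h1 : ∫⁻ a, ∫⁻ r in Ioi (0 : ℝ), ENNReal.ofReal r * F (a, r) = ∫⁻ p, H p := by
    rw [Measure.volume_eq_prod, lintegral_prod _ hHm.aemeasurable]
    refine lintegral_congr fun a => ?_
    rw [← lintegral_indicator measurableSet_Ioi]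
    refine lintegral_congr fun r => ?_
    simp [hH, indicator]
  have hm : Measurable fun p : ℝ × ℝ => polarCoord.symm p := continuous_polarCoord_symm.measurable
  rw [h1, ← lintegral_comp_polarCoord_symm, polarCoord_target, Measure.volume_eq_prod,
    setLIntegral_prod _ (by fun_prop)]
  refine setLIntegral_congr_fun measurableSet_Ioi fun r hr => ?_
  have hr' : 0 < r := hr
  have hsub : Ioo 0 Real.pi ⊆ Ioo (-Real.pi) Real.pi := Ioo_subset_Ioo_left (by linarith [Real.pi_pos])
  dsimp only
  rw [← lintegral_indicator measurableSet_Ioo, ← lintegral_indicator measurableSet_Ioo]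
  refine lintegral_congr fun θ => ?_
  simp only [indicator_apply, hH, mem_prod, mem_univ, true_and, mem_Ioi, polarCoord_symm_apply]
  by_cases h : θ ∈ Ioo 0 Real.pi
  · have hs := Real.sin_pos_of_pos_of_lt_pi h.1 h.2
    rw [if_pos (hsub h), if_pos (by positivity), if_pos h, smul_eq_mul, ← mul_assoc, ← mul_assoc,
      ← ENNReal.ofReal_mul hr'.le, ← ENNReal.ofReal_mul (by positivity)]
    congr 2; ring
  · rw [if_neg h]
    by_cases h' : θ ∈ Ioo (-Real.pi) Real.pi
    · have : ¬ 0 < r * Real.sin θ := by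
        have hθ : θ ≤ 0 := by
          by_contra hc; exact h ⟨not_le.1 hc, h'.2⟩
        have := Real.sin_nonpos_of_nonpos_of_neg_pi_le hθ h'.1.le
        nlinarith
      rw [if_pos h', if_neg this, smul_zero]
    · rw [if_neg h']

/-- Integration of axially symmetric functions on `ℝ³` in spherical coordinates. -/
theorem lintegral_axial {F : ℝ × ℝ → ℝ≥0∞} (hF : Measurable F) :
    ∫⁻ x : Space 3, F (x 0, √(x 1 ^ 2 + x 2 ^ 2))
      = ENNReal.ofReal (2 * Real.pi) * ∫⁻ r in Ioi (0 : ℝ), ∫⁻ θ in Ioo (0 : ℝ) Real.pi,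
        ENNReal.ofReal (r ^ 2) * (ENNReal.ofReal (Real.sin θ) *
          F (r * Real.cos θ, r * Real.sin θ)) := by
  rw [lintegral_space_three (F := fun q => F (q.1, √(q.2.1 ^ 2 + q.2.2 ^ 2)))
    (hF.comp (by fun_prop)), ← lintegral_half_plane_polar hF, ← lintegral_const_mul]
  · refine lintegral_congr fun a => ?_
    exact lintegral_radial_plane (F := fun r => F (a, r)) (by fun_prop)
  · exact Measurable.lintegral_prod_right' (f := fun p : ℝ × ℝ => ENNReal.ofReal p.2 * F p)
      (by fun_prop)

/-- The change of variables `a = cos θ`. -/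
theorem lintegral_sin_mul_comp_cos (F : ℝ → ℝ≥0∞) :
    ∫⁻ θ in Ioo (0 : ℝ) Real.pi, ENNReal.ofReal (Real.sin θ) * F (Real.cos θ)
      = ∫⁻ a in Ioo (-1 : ℝ) 1, F a := by
  have himg : Real.cos '' Ioo 0 Real.pi = Ioo (-1) 1 := by
    apply Subset.antisymm
    · rintro _ ⟨θ, hθ, rfl⟩
      have h1 := Real.strictAntiOn_cos (left_mem_Icc.2 Real.pi_pos.le) (Ioo_subset_Icc_self hθ) hθ.1
      have h2 := Real.strictAntiOn_cos (Ioo_subset_Icc_self hθ) (right_mem_Icc.2 Real.pi_pos.le) hθ.2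
      rw [Real.cos_zero] at h1
      rw [Real.cos_pi] at h2
      exact ⟨h2, h1⟩
    · intro a ha
      refine ⟨Real.arccos a, ⟨Real.arccos_pos.2 ha.2, ?_⟩, Real.cos_arccos ha.1.le ha.2.le⟩
      exact lt_of_le_of_ne (Real.arccos_le_pi a) fun h => by
        rw [Real.arccos_eq_pi] at h; linarith [ha.1]
  rw [← himg, lintegral_image_eq_lintegral_abs_deriv_mul measurableSet_Ioo
    (fun x _ => (Real.hasDerivAt_cos x).hasDerivWithinAt)
    (Real.injOn_cos.mono Ioo_subset_Icc_self)]
  refine setLIntegral_congr_fun measurableSet_Ioo fun θ hθ => ?_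
  have hs := Real.sin_pos_of_pos_of_lt_pi hθ.1 hθ.2
  simp [abs_of_pos hs]

/-- The primitive `arcsin (b / c)` is continuous up to the endpoints and its derivative is
nonnegative, which gives integrability despite the singularities. The value does not depend on c:
this is why all chords of the disk carry the same mass of the planar kernel. -/
theorem lintegral_inv_sqrt {c : ℝ} (hc : 0 < c) :
    ∫⁻ b in Ioo (-c) c, ENNReal.ofReal (1 / √(c ^ 2 - b ^ 2)) = ENNReal.ofReal Real.pi := by
  have hd : ∀ b ∈ Ioo (-c) c,
      HasDerivAt (fun b => Real.arcsin (b / c)) (1 / √(c ^ 2 - b ^ 2)) b := by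
    intro b hb
    have h1 : b / c ≠ -1 := by
      intro h; rw [div_eq_iff hc.ne'] at h; linarith [hb.1]
    have h2 : b / c ≠ 1 := by
      intro h; rw [div_eq_iff hc.ne'] at h; linarith [hb.2]
    have := (Real.hasDerivAt_arcsin h1 h2).comp b ((hasDerivAt_id b).div_const c)
    convert! this using 1
    rw [show c ^ 2 - b ^ 2 = c ^ 2 * (1 - (b / c) ^ 2) by field_simp, Real.sqrt_mul (by positivity),
      Real.sqrt_sq hc.le]
    field_simp
  have hcont : ContinuousOn (fun b => Real.arcsin (b / c)) (Icc (-c) c) := by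
    exact (Real.continuous_arcsin.comp (by fun_prop)).continuousOn
  have hint := intervalIntegral.integrableOn_deriv_of_nonneg hcont hd
    (fun x _ => by positivity)
  have hle : -c ≤ c := by linarith
  have hval := intervalIntegral.integral_eq_sub_of_hasDerivAt_of_le hle hcont hd
    ((intervalIntegrable_iff_integrableOn_Ioc_of_le hle).2 hint)
  rw [intervalIntegral.integral_of_le hle] at hval
  rw [Measure.restrict_congr_set Ioo_ae_eq_Ioc, ← ofReal_integral_eq_lintegral_ofReal hint
    (ae_of_all _ fun x => by positivity), hval, neg_div, div_self hc.ne', Real.arcsin_neg,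
    Real.arcsin_one]
  congr 1; ring

/-! ### The unit wave kernel -/

/-- Change of variables with Jacobian t^d; the hypothesis `h` expresses that the density of the wave
kernel is homogeneous of degree 1 - d in (t,x). -/
theorem withDensity_scaling {d : ℕ} {t : ℝ} (ht : 0 < t) {F G : Space d → ℝ≥0∞}
    (hF : Measurable F) (hG : Measurable G)
    (h : ∀ x, ENNReal.ofReal (t ^ d) * F (t • x) = ENNReal.ofReal t * G x) :
    (volume : Measure (Space d)).withDensity F
      = ENNReal.ofReal t • ((volume.withDensity G).map fun x => t • x) := by
  have hm : Measurable fun x : Space d => t • x := measurable_const_smul t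
  ext s hs
  have hmap := Measure.map_addHaar_smul (volume : Measure (Space d)) ht.ne'
  have hvol : (volume : Measure (Space d))
      = ENNReal.ofReal (t ^ d) • Measure.map (fun x => t • x) volume := by
    rw [hmap, smul_smul, ← ENNReal.ofReal_mul (by positivity)]
    simp [abs_of_pos ht, ht.ne']
  rw [withDensity_apply _ hs, Measure.smul_apply, Measure.map_apply hm hs,
    withDensity_apply _ (hm hs), smul_eq_mul, ← lintegral_const_mul _ hG,
    ← lintegral_indicator hs, ← lintegral_indicator (hm hs)]
  conv_lhs => rw [hvol]
  rw [lintegral_smul_measure, lintegral_map (hF.indicator hs) hm, smul_eq_mul,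
    ← lintegral_const_mul _ (by exact (hF.indicator hs).comp hm)]
  refine lintegral_congr fun x => ?_
  by_cases hx : t • x ∈ s
  · simpa [indicator, hx] using h x
  · simp [indicator, hx]

theorem measurable_diskDensity (t : ℝ) :
    Measurable ((Metric.ball (0 : Space 2) t).indicator fun x =>
        ENNReal.ofReal (1 / (2 * Real.pi) * (1 / Real.sqrt (t ^ 2 - ‖x‖ ^ 2)))) :=
  Measurable.indicator (by fun_prop) measurableSet_ball

theorem waveKernel_of_nonpos {d : ℕ} (hd : d = 1 ∨ d = 2 ∨ d = 3) {t : ℝ} (ht : t ≤ 0) :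
    waveKernel d t = 0 := by
  rcases hd with rfl | rfl | rfl
  · simp [waveKernel, Metric.ball_eq_empty.2 ht]
  · simp [waveKernel, Metric.ball_eq_empty.2 ht]
  · have : ENNReal.ofReal (1 / (4 * Real.pi * t)) = 0 := by
      rw [ENNReal.ofReal_eq_zero]
      exact one_div_nonpos.2 (mul_nonpos_of_nonneg_of_nonpos (by positivity) ht)
    rw [waveKernel, this, zero_smul]

/-- Scale invariance of the wave equation. It moves the time dependence from the measure into the
integrand, so that continuity and differentiability in t become statements about a fixed measure. -/
theorem waveKernel_eq_map {d : ℕ} (hd : d = 1 ∨ d = 2 ∨ d = 3) {t : ℝ} (ht : 0 < t) :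
    waveKernel d t = ENNReal.ofReal t • ((waveKernel d 1).map fun x => t • x) := by
  rcases hd with rfl | rfl | rfl
  · refine withDensity_scaling ht (measurable_const.indicator measurableSet_ball)
      (measurable_const.indicator measurableSet_ball) fun x => ?_
    have : t • x ∈ Metric.ball (0 : Space 1) t ↔ x ∈ Metric.ball (0 : Space 1) 1 := by
      simp [norm_smul, abs_of_pos ht, ht]
    simp [indicator, this]
  · refine withDensity_scaling ht (measurable_diskDensity t) (measurable_diskDensity 1) fun x => ?_
    have : t • x ∈ Metric.ball (0 : Space 2) t ↔ x ∈ Metric.ball (0 : Space 2) 1 := by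
      simp [norm_smul, abs_of_pos ht, ht]
    by_cases hx : x ∈ Metric.ball (0 : Space 2) 1
    · rw [indicator_of_mem (this.2 hx), indicator_of_mem hx, ← ENNReal.ofReal_mul (by positivity), ← ENNReal.ofReal_mul (by positivity)]
      congr 1
      rw [norm_smul, Real.norm_of_nonneg ht.le,
        show t ^ 2 - (t * ‖x‖) ^ 2 = t ^ 2 * (1 ^ 2 - ‖x‖ ^ 2) by ring,
        Real.sqrt_mul (by positivity), Real.sqrt_sq ht.le]
      field_simp
    · rw [indicator_of_notMem (mt this.1 hx), indicator_of_notMem hx]; simp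
  · have hm : Measurable fun x : Space 3 => t • x := measurable_const_smul t
    have hm1 : Measurable fun ω : Metric.sphere (0 : Space 3) 1 => (1 : ℝ) • (ω : Space 3) := by
      fun_prop
    simp only [waveKernel, sphereSurface, Measure.map_smul, Measure.map_map hm hm1, smul_smul]
    congr 1
    · rw [← ENNReal.ofReal_mul (by positivity), ← ENNReal.ofReal_mul (by positivity),
        ← ENNReal.ofReal_mul (by positivity)]
      congr 1; field_simp
    · congr 1
      ext ω; simp

/-- A linear isometry of `ℝ^d` which turns the unit vector `e` into the first basis vector. -/
theorem exists_isometry_inner {n : ℕ} {e : Space (n + 1)} (he : ‖e‖ = 1) :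
    ∃ L : Space (n + 1) ≃ₗᵢ[ℝ] Space (n + 1), ∀ x, L x 0 = inner ℝ e x := by
  have hv : Orthonormal ℝ (({0} : Set (Fin (n + 1))).domRestrict fun _ => e) := by
    refine ⟨fun _ => he, fun i j hij => (hij (Subsingleton.elim i j)).elim⟩
  obtain ⟨b, hb⟩ := hv.exists_orthonormalBasis_extension_of_card_eq (by simp)
  refine ⟨b.repr, fun x => ?_⟩
  rw [b.repr_apply_apply, hb 0 rfl]

/-- Rotation invariance of Lebesgue measure. -/
theorem lintegral_inner_norm {n : ℕ} {e : Space (n + 1)} (he : ‖e‖ = 1)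
    {F : ℝ → ℝ → ℝ≥0∞} (hF : Measurable (Function.uncurry F)) :
    ∫⁻ x : Space (n + 1), F (inner ℝ e x) ‖x‖ = ∫⁻ x : Space (n + 1), F (x 0) ‖x‖ := by
  obtain ⟨L, hL⟩ := exists_isometry_inner he
  have hm : Measurable fun x : Space (n + 1) => F (x 0) ‖x‖ :=
    hF.comp (f := fun x : Space (n + 1) => (x 0, ‖x‖)) (by fun_prop)
  rw [← L.measurePreserving.lintegral_comp hm]
  simp [hL]

theorem lintegral_inner_waveKernel_one {e : Space 1} (he : ‖e‖ = 1) {g : ℝ → ℝ≥0∞}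
    (hg : Measurable g) :
    ∫⁻ x, g (inner ℝ e x) ∂(waveKernel 1 1)
      = ENNReal.ofReal (1 / 2) * ∫⁻ a in Ioo (-1 : ℝ) 1, g a := by
  have hmb : MeasurableSet {r : ℝ | r < 1} := measurableSet_Iio
  rw [waveKernel, lintegral_withDensity_eq_lintegral_mul _
    (measurable_const.indicator measurableSet_ball) (by fun_prop)]
  have h1 := lintegral_inner_norm (n := 0) he
    (F := fun a r => {r : ℝ | r < 1}.indicator (fun _ => ENNReal.ofReal (1 / 2)) r * g a)
    (((measurable_const.indicator hmb).comp measurable_snd).mul (hg.comp measurable_fst))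
  have h2 := lintegral_space_one (F := fun a =>
    {r : ℝ | r < 1}.indicator (fun _ => ENNReal.ofReal (1 / 2)) |a| * g a)
    (((measurable_const.indicator hmb).comp measurable_norm).mul hg)
  rw [← lintegral_const_mul _ hg, ← lintegral_indicator measurableSet_Ioo]
  calc _ = _ := lintegral_congr fun x => by
          simp [indicator]
    _ = _ := h1
    _ = _ := lintegral_congr fun x => by
          rw [EuclideanSpace.norm_eq]
          simp [Real.sqrt_sq_eq_abs]
    _ = _ := h2
    _ = _ := lintegral_congr fun x => by
          simp [indicator, abs_lt]

/-- The chord at abscissa a has half-length √(1 - a²), and by the arcsine integral the density has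
mass (1 / 2π) · π = 1/2 along it. -/
theorem lintegral_inner_waveKernel_two {e : Space 2} (he : ‖e‖ = 1) {g : ℝ → ℝ≥0∞}
    (hg : Measurable g) :
    ∫⁻ x, g (inner ℝ e x) ∂(waveKernel 2 1)
      = ENNReal.ofReal (1 / 2) * ∫⁻ a in Ioo (-1 : ℝ) 1, g a := by
  set k : ℝ → ℝ≥0∞ := {r : ℝ | r < 1}.indicator fun r =>
    ENNReal.ofReal (1 / (2 * Real.pi) * (1 / √(1 ^ 2 - r ^ 2))) with hk
  have hkm : Measurable k := Measurable.indicator (by fun_prop) measurableSet_Iio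
  rw [waveKernel, lintegral_withDensity_eq_lintegral_mul _ (measurable_diskDensity 1)
    (by fun_prop)]
  have h1 := lintegral_inner_norm (n := 1) he (F := fun a r => k r * g a)
    ((hkm.comp measurable_snd).mul (hg.comp measurable_fst))
  have h2 := lintegral_space_two (F := fun p => k (√(p.1 ^ 2 + p.2 ^ 2)) * g p.1)
    ((hkm.comp (by fun_prop)).mul (hg.comp measurable_fst))
  rw [← lintegral_const_mul _ hg, ← lintegral_indicator measurableSet_Ioo]
  calc _ = _ := lintegral_congr fun x => by
          simp [indicator, hk]
    _ = _ := h1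
    _ = _ := lintegral_congr fun x => by
          rw [EuclideanSpace.norm_eq]
          simp [Fin.sum_univ_two]
    _ = _ := h2
    _ = _ := lintegral_congr fun a => by
      dsimp only
      rw [lintegral_mul_const _ (by exact hkm.comp (by fun_prop))]
      simp only [indicator]
      split_ifs with ha
      · congr 1
        have ha2 : 0 < 1 - a ^ 2 := by nlinarith [ha.1, ha.2]
        have hc : 0 < √(1 - a ^ 2) := Real.sqrt_pos.2 ha2
        -- With c = √(1 - a²) one has 1 - (a² + b²) = c² - b², the form of `lintegral_inv_sqrt`.
        have key : ∀ b : ℝ, k (√(a ^ 2 + b ^ 2)) = ENNReal.ofReal (1 / (2 * Real.pi)) *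
            (Ioo (-√(1 - a ^ 2)) (√(1 - a ^ 2))).indicator
              (fun b => ENNReal.ofReal (1 / √(√(1 - a ^ 2) ^ 2 - b ^ 2))) b := by
          intro b
          have hiff : √(a ^ 2 + b ^ 2) < 1 ↔ b ∈ Ioo (-√(1 - a ^ 2)) (√(1 - a ^ 2)) := by
            rw [mem_Ioo, ← abs_lt, ← Real.sqrt_sq_eq_abs, Real.sqrt_lt_sqrt_iff (sq_nonneg b),
              Real.sqrt_lt' one_pos]
            constructor <;> intro h <;> linarith
          simp only [hk, indicator_apply, mem_ofPred_eq, hiff]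
          split_ifs
          · rw [← ENNReal.ofReal_mul (by positivity), Real.sq_sqrt ha2.le,
              Real.sq_sqrt (by positivity)]
            congr 4; ring
          · simp
        rw [lintegral_congr key, lintegral_const_mul _
          (Measurable.indicator (by fun_prop) measurableSet_Ioo),
          lintegral_indicator measurableSet_Ioo, lintegral_inv_sqrt hc,
          ← ENNReal.ofReal_mul (by positivity)]
        congr 1
        field_simp
      · have : ∀ b : ℝ, k (√(a ^ 2 + b ^ 2)) = 0 := by
          intro b
          refine indicator_of_notMem (fun h => ha ?_) _
          have h' : √(a ^ 2 + b ^ 2) < 1 := h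
          rw [Real.sqrt_lt' one_pos] at h'
          constructor <;> nlinarith [sq_nonneg b]
        simp [this]

open scoped Pointwise in
-- `Measure.toSphere` measures a set on the sphere by the volume of the solid sector over it; this
-- describes that sector by conditions on x, ready for spherical coordinates.
theorem Ioo_smul_sphere_image (A : Set (Metric.sphere (0 : Space 3) 1)) (B : Set (Space 3))
    (hAB : ∀ ω : Metric.sphere (0 : Space 3) 1, ω ∈ A ↔ (ω : Space 3) ∈ B) :
    Ioo (0 : ℝ) 1 • (Subtype.val '' A) = {x : Space 3 | 0 < ‖x‖ ∧ ‖x‖ < 1 ∧ ‖x‖⁻¹ • x ∈ B} := by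
  ext x
  constructor
  · rintro ⟨r, hr, _, ⟨ω, hω, rfl⟩, rfl⟩
    have h1 : ‖(ω : Space 3)‖ = 1 := by simp
    have h2 : ‖r • (ω : Space 3)‖ = r := by rw [norm_smul, h1, mul_one, Real.norm_of_nonneg hr.1.le]
    refine ⟨?_, ?_, ?_⟩
    · simpa only [h2] using hr.1
    · simpa only [h2] using hr.2
    · show ‖r • (ω : Space 3)‖⁻¹ • r • (ω : Space 3) ∈ B
      rw [h2, smul_smul, inv_mul_cancel₀ hr.1.ne', one_smul]
      exact (hAB ω).1 hω
  · rintro ⟨h0, h1, h2⟩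
    have h3 : ‖x‖⁻¹ • x ∈ Metric.sphere (0 : Space 3) 1 := by
      simp [norm_smul, h0.ne']
    refine ⟨‖x‖, ⟨h0, h1⟩, ‖x‖⁻¹ • x, ⟨⟨_, h3⟩, (hAB _).2 h2, rfl⟩, ?_⟩
    show ‖x‖ • ‖x‖⁻¹ • x = x
    rw [smul_smul, mul_inv_cancel₀ h0.ne', one_smul]

/-- The volume of the solid sector over a spherical zone. -/
theorem volume_sector {e : Space 3} (he : ‖e‖ = 1) {A : Set ℝ} (hA : MeasurableSet A) :
    volume {x : Space 3 | 0 < ‖x‖ ∧ ‖x‖ < 1 ∧ inner ℝ e (‖x‖⁻¹ • x) ∈ A}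
      = ENNReal.ofReal (2 * Real.pi / 3) * volume (A ∩ Ioo (-1 : ℝ) 1) := by
  set D : Set (ℝ × ℝ) := {p | 0 < p.2 ∧ p.2 < 1 ∧ p.2⁻¹ * p.1 ∈ A} with hD
  have hDm : MeasurableSet D :=
    (measurableSet_lt measurable_const measurable_snd).inter
      ((measurableSet_lt measurable_snd measurable_const).inter
        ((by fun_prop : Measurable fun p : ℝ × ℝ => p.2⁻¹ * p.1) hA))
  have hDi : Measurable (D.indicator (1 : ℝ × ℝ → ℝ≥0∞)) := measurable_one.indicator hDm
  have hset : {x : Space 3 | 0 < ‖x‖ ∧ ‖x‖ < 1 ∧ inner ℝ e (‖x‖⁻¹ • x) ∈ A}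
      = (fun x : Space 3 => (inner ℝ e x, ‖x‖)) ⁻¹' D := by
    ext x; simp [hD, inner_smul_right]
  have hm : Measurable fun x : Space 3 => ((inner ℝ e x : ℝ), ‖x‖) := by fun_prop
  rw [hset, ← lintegral_indicator_one (hm hDm)]
  calc _ = ∫⁻ x : Space 3, D.indicator 1 (inner ℝ e x, ‖x‖) := rfl
    _ = ∫⁻ x : Space 3, D.indicator 1 (x 0, ‖x‖) :=
        lintegral_inner_norm (n := 2) he (F := fun a r => D.indicator 1 (a, r)) hDi
    -- The integrand becomes a function of the first coordinate and of the distance to the axis.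
    _ = ∫⁻ x : Space 3, D.indicator 1 (x 0, √(x 0 ^ 2 + √(x 1 ^ 2 + x 2 ^ 2) ^ 2)) := by
        refine lintegral_congr fun x => ?_
        rw [EuclideanSpace.norm_eq, Real.sq_sqrt (by positivity)]
        simp [Fin.sum_univ_three, add_assoc]
    _ = ENNReal.ofReal (2 * Real.pi) * ∫⁻ r in Ioi (0 : ℝ), ∫⁻ θ in Ioo (0 : ℝ) Real.pi,
        ENNReal.ofReal (r ^ 2) * (ENNReal.ofReal (Real.sin θ) * D.indicator 1
          (r * Real.cos θ, √((r * Real.cos θ) ^ 2 + (r * Real.sin θ) ^ 2))) :=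
        lintegral_axial (F := fun p => D.indicator 1 (p.1, √(p.1 ^ 2 + p.2 ^ 2)))
          (hDi.comp (by fun_prop))
    _ = ENNReal.ofReal (2 * Real.pi) * ∫⁻ r in Ioi (0 : ℝ),
          (Iio (1 : ℝ)).indicator (fun r => ENNReal.ofReal (r ^ 2)) r *
            volume (A ∩ Ioo (-1 : ℝ) 1) := by
        congr 1
        refine setLIntegral_congr_fun measurableSet_Ioi fun r hr => ?_
        have hr' : 0 < r := hr
        have h1 : ∀ θ : ℝ, √((r * Real.cos θ) ^ 2 + (r * Real.sin θ) ^ 2) = r := by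
          intro θ
          rw [show (r * Real.cos θ) ^ 2 + (r * Real.sin θ) ^ 2 = r ^ 2 by
            linear_combination r ^ 2 * Real.sin_sq_add_cos_sq θ, Real.sqrt_sq hr'.le]
        have h2 : ∀ θ : ℝ, D.indicator (1 : ℝ × ℝ → ℝ≥0∞) (r * Real.cos θ, r)
            = (Iio (1 : ℝ)).indicator 1 r * A.indicator 1 (Real.cos θ) := by
          intro θ
          have h5 : (r * Real.cos θ, r) ∈ D ↔ r < 1 ∧ Real.cos θ ∈ A := by
            simp only [hD, mem_ofPred_eq, hr', true_and, inv_mul_cancel_left₀ hr'.ne']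
          by_cases h3 : r < 1 <;> by_cases h4 : Real.cos θ ∈ A <;> simp [indicator, h5, h3, h4]
        dsimp only
        simp only [h1, h2]
        rw [lintegral_const_mul _ (by
            have := (measurable_one (α := ℝ≥0∞)).indicator hA
            have h5 : Measurable fun θ => A.indicator (1 : ℝ → ℝ≥0∞) (Real.cos θ) :=
              this.comp Real.measurable_cos
            fun_prop)]
        have h6 : ∀ θ, ENNReal.ofReal (Real.sin θ) * ((Iio (1 : ℝ)).indicator 1 r *
            A.indicator 1 (Real.cos θ)) = (Iio (1 : ℝ)).indicator 1 r *
            (ENNReal.ofReal (Real.sin θ) * A.indicator 1 (Real.cos θ)) := fun θ => by ring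
        simp only [h6]
        rw [lintegral_const_mul' _ _ (by simp only [indicator]; split_ifs <;> simp),
          lintegral_sin_mul_comp_cos, lintegral_indicator_one hA, Measure.restrict_apply hA,
          ← mul_assoc]
        congr 1
        simp only [indicator]; split_ifs <;> simp
    _ = _ := by
        -- The remaining radial integral of r² over (0,1) is 1/3.
        rw [lintegral_mul_const _ (Measurable.indicator (by fun_prop) measurableSet_Iio),
          ← mul_assoc, setLIntegral_indicator measurableSet_Iio, Iio_inter_Ioi,
          Measure.restrict_congr_set Ioo_ae_eq_Ioc,
          ← ofReal_integral_eq_lintegral_ofReal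
            (((continuous_pow 2).integrableOn_Icc).mono_set Ioc_subset_Icc_self)
            (ae_of_all _ fun x => by positivity),
          ← intervalIntegral.integral_of_le zero_le_one, integral_pow,
          ← ENNReal.ofReal_mul (by positivity)]
        congr 2; norm_num; ring

/-- Integrating out the directions orthogonal to e must give the one-dimensional kernel, because
plane waves solve the one-dimensional equation. For d = 3 it is Archimedes' theorem on spherical
zones. Both the total mass and the Fourier decay are read off from here. -/
theorem map_inner_waveKernel_one {d : ℕ} (hd : d = 1 ∨ d = 2 ∨ d = 3) {e : Space d}
    (he : ‖e‖ = 1) :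
    (waveKernel d 1).map (fun x => inner ℝ e x)
      = ENNReal.ofReal (1 / 2) • volume.restrict (Ioo (-1 : ℝ) 1) := by
  have hm : Measurable fun x : Space d => (inner ℝ e x : ℝ) := by fun_prop
  ext A hA
  rw [Measure.map_apply hm hA, Measure.smul_apply, Measure.restrict_apply hA, smul_eq_mul]
  have hred : ∫⁻ a in Ioo (-1 : ℝ) 1, A.indicator 1 a = volume (A ∩ Ioo (-1 : ℝ) 1) := by
    rw [lintegral_indicator_one hA, Measure.restrict_apply hA]
  rw [← hred, ← lintegral_indicator_one (hm hA)]
  rcases hd with rfl | rfl | rfl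
  · exact lintegral_inner_waveKernel_one he (measurable_one.indicator hA)
  · exact lintegral_inner_waveKernel_two he (measurable_one.indicator hA)
  · rw [hred, lintegral_indicator_one (hm hA), waveKernel, sphereSurface]
    have hm1 : Measurable fun ω : Metric.sphere (0 : Space 3) 1 => (1 : ℝ) • (ω : Space 3) := by
      fun_prop
    rw [Measure.smul_apply, Measure.smul_apply, Measure.map_apply hm1 (hm hA),
      Measure.toSphere_apply' _ (hm1 (hm hA)),
      Ioo_smul_sphere_image _ ((fun x : Space 3 => (inner ℝ e x : ℝ)) ⁻¹' A) (by simp)]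
    have := volume_sector he hA
    simp only [mem_preimage] at this ⊢
    rw [this]
    simp only [finrank_euclideanSpace_fin, smul_eq_mul, ← mul_assoc]
    congr 1
    -- The 3 is the dimension factor between sector volume and surface measure: (1 / 4π) · 3 · (2π /
    -- 3) = 1/2.
    rw [show ((3 : ℕ) : ℝ≥0∞) = ENNReal.ofReal 3 by simp, ← ENNReal.ofReal_mul (by positivity),
      ← ENNReal.ofReal_mul (by positivity), ← ENNReal.ofReal_mul (by positivity)]
    congr 1; field_simp; norm_num

theorem isProbabilityMeasure_waveKernel_one {d : ℕ} (hd : d = 1 ∨ d = 2 ∨ d = 3) :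
    IsProbabilityMeasure (waveKernel d 1) := by
  obtain ⟨e, he⟩ : ∃ e : Space d, ‖e‖ = 1 := by
    have : NeZero d := ⟨by omega⟩
    exact ⟨EuclideanSpace.single 0 1, by simp⟩
  constructor
  have hm : Measurable fun x : Space d => (inner ℝ e x : ℝ) := by fun_prop
  rw [show (univ : Set (Space d)) = (fun x => (inner ℝ e x : ℝ)) ⁻¹' univ from rfl,
    ← Measure.map_apply hm MeasurableSet.univ, map_inner_waveKernel_one hd he]
  simp only [Measure.smul_apply, Measure.restrict_apply MeasurableSet.univ, univ_inter,
    Real.volume_Ioo, smul_eq_mul]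
  rw [← ENNReal.ofReal_mul (by positivity)]
  norm_num

theorem ae_norm_le_waveKernel_one {d : ℕ} (hd : d = 1 ∨ d = 2 ∨ d = 3) :
    ∀ᵐ z ∂(waveKernel d 1), ‖z‖ ≤ 1 := by
  have hm : MeasurableSet {z : Space d | ¬ ‖z‖ ≤ 1} :=
    (measurableSet_le measurable_norm measurable_const).compl
  rw [ae_iff]
  rcases hd with rfl | rfl | rfl
  · rw [waveKernel, withDensity_apply _ hm]
    refine (setLIntegral_congr_fun (g := 0) hm fun z hz => ?_).trans (by simp)
    refine indicator_of_notMem (fun h => hz ?_) _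
    simpa using (mem_ball_zero_iff.1 h).le
  · rw [waveKernel, withDensity_apply _ hm]
    refine (setLIntegral_congr_fun (g := 0) hm fun z hz => ?_).trans (by simp)
    refine indicator_of_notMem (fun h => hz ?_) _
    simpa using (mem_ball_zero_iff.1 h).le
  · have hm1 : Measurable fun ω : Metric.sphere (0 : Space 3) 1 => (1 : ℝ) • (ω : Space 3) := by
      fun_prop
    rw [waveKernel, sphereSurface, Measure.smul_apply, Measure.smul_apply,
      Measure.map_apply hm1 hm]
    have : (fun ω : Metric.sphere (0 : Space 3) 1 => (1 : ℝ) • (ω : Space 3)) ⁻¹'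
        {z : Space 3 | ¬ ‖z‖ ≤ 1} = ∅ := by
      ext ω; simp
    simp

theorem norm_measureFourier_le {d : ℕ} (ν : Measure (Space d)) [IsProbabilityMeasure ν]
    (ξ : Space d) : ‖measureFourier ν ξ‖ ≤ 1 := by
  refine (norm_integral_le_of_norm_le_const (C := 1) (ae_of_all _ fun y => ?_)).trans (by simp)
  rw [Complex.norm_exp]
  simp

/-- Projecting onto the direction of ξ turns the transform into half the integral of e^{-i‖ξ‖a} over
(-1,1), that is sin‖ξ‖ / ‖ξ‖; bounding the two boundary terms by 1 is enough. -/
theorem norm_measureFourier_waveKernel_one_mul_le {d : ℕ} (hd : d = 1 ∨ d = 2 ∨ d = 3)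
    (ξ : Space d) : ‖measureFourier (waveKernel d 1) ξ‖ * ‖ξ‖ ≤ 1 := by
  rcases eq_or_ne ξ 0 with rfl | hξ
  · simp
  have hξ' : 0 < ‖ξ‖ := norm_pos_iff.2 hξ
  have he : ‖(‖ξ‖⁻¹ • ξ : Space d)‖ = 1 := by simp [norm_smul, hξ'.ne']
  have hm : Measurable fun x : Space d => (inner ℝ (‖ξ‖⁻¹ • ξ : Space d) x : ℝ) := by fun_prop
  have h1 : measureFourier (waveKernel d 1) ξ
      = ∫ a, Complex.exp ((-Complex.I * (‖ξ‖ : ℂ)) * (a : ℂ))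
        ∂((waveKernel d 1).map fun x => (inner ℝ (‖ξ‖⁻¹ • ξ : Space d) x : ℝ)) := by
    rw [integral_map hm.aemeasurable (by fun_prop)]
    refine integral_congr_ae (ae_of_all _ fun y => ?_)
    simp only [inner_smul_left, mul_assoc, ← Complex.ofReal_mul]
    simp [mul_inv_cancel_left₀ hξ'.ne']
  have hc : (-Complex.I * (‖ξ‖ : ℂ)) ≠ 0 := by simp [hξ]
  have hI : (∫ (x : ℝ) in Ioo (-1) 1, Complex.exp (-Complex.I * (‖ξ‖ : ℂ) * (x : ℂ)))
      = (Complex.exp (-Complex.I * (‖ξ‖ : ℂ) * ((1 : ℝ) : ℂ)) -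
          Complex.exp (-Complex.I * (‖ξ‖ : ℂ) * ((-1 : ℝ) : ℂ))) / (-Complex.I * (‖ξ‖ : ℂ)) := by
    rw [Measure.restrict_congr_set Ioo_ae_eq_Ioc,
      ← intervalIntegral.integral_of_le (by norm_num : (-1 : ℝ) ≤ 1), integral_exp_mul_complex hc]
  have hb : ∀ r : ℝ, ‖Complex.exp (-Complex.I * (‖ξ‖ : ℂ) * (r : ℂ))‖ = 1 := by
    intro r; rw [Complex.norm_exp]; simp
  rw [h1, map_inner_waveKernel_one hd he, integral_smul_measure, hI]
  rw [norm_smul, norm_div, norm_mul, norm_neg, Complex.norm_I, one_mul, Complex.norm_real, norm_norm]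
  rw [ENNReal.toReal_ofReal (by norm_num)]
  have := norm_sub_le (Complex.exp (-Complex.I * (‖ξ‖ : ℂ) * ((1 : ℝ) : ℂ)))
    (Complex.exp (-Complex.I * (‖ξ‖ : ℂ) * ((-1 : ℝ) : ℂ)))
  rw [hb, hb] at this
  rw [mul_assoc, div_mul_cancel₀ _ hξ'.ne']
  rw [Real.norm_of_nonneg (by norm_num)]
  linarith

/-- The wave kernel in terms of the unit kernel, for the convolution with any function. -/
theorem waveConv_eq {d : ℕ} (hd : d = 1 ∨ d = 2 ∨ d = 3) (f : Space d → ℝ) {t : ℝ} (ht : 0 ≤ t)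
    (x : Space d) : waveConv d f t x = t * ∫ z, f (x - t • z) ∂(waveKernel d 1) := by
  rcases ht.eq_or_lt with rfl | ht
  · simp [waveConv, waveKernel_of_nonpos hd le_rfl]
  · rw [waveConv, waveKernel_eq_map hd ht, integral_smul_measure,
      (measurableEmbedding_const_smul₀ ht.ne').integral_map, ENNReal.toReal_ofReal ht.le, smul_eq_mul]

/-! ### The deterministic integral equation -/

theorem driftTerm_eq {d : ℕ} (hd : d = 1 ∨ d = 2 ∨ d = 3) (b : ℝ → ℝ) (w : ℝ → Space d → ℝ)
    {t : ℝ} (ht : 0 ≤ t) (x : Space d) :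
    driftTerm d b w t x
      = ∫ s in (0 : ℝ)..t, (t - s) * ∫ z, b (w s (x - (t - s) • z)) ∂(waveKernel d 1) := by
  refine intervalIntegral.integral_congr fun s hs => ?_
  rw [uIcc_of_le ht] at hs
  exact waveConv_eq hd _ (by linarith [hs.2]) x

/-- The kernel is carried by a compact ball, so continuity of the integrand suffices, with no growth
condition. -/
theorem continuous_integral_waveKernel_one {d : ℕ} (hd : d = 1 ∨ d = 2 ∨ d = 3)
    {X : Type*} [TopologicalSpace X] [FirstCountableTopology X] [LocallyCompactSpace X]
    {F : Type*} [NormedAddCommGroup F] [NormedSpace ℝ F]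
    {f : X → Space d → F} (hf : Continuous (Function.uncurry f)) :
    Continuous fun p => ∫ z, f p z ∂(waveKernel d 1) := by
  have := isProbabilityMeasure_waveKernel_one hd
  have h : (waveKernel d 1).restrict (Metric.closedBall 0 1) = waveKernel d 1 :=
    Measure.restrict_eq_self_of_ae_mem (by
      filter_upwards [ae_norm_le_waveKernel_one hd] with z hz
      simpa using hz)
  have := continuous_parametric_integral_of_continuous (μ := waveKernel d 1) hf
    (isCompact_closedBall (0 : Space d) 1)
  simpa only [h] using this

theorem integrable_waveKernel_one {d : ℕ} (hd : d = 1 ∨ d = 2 ∨ d = 3) {F : Type*}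
    [NormedAddCommGroup F] {f : Space d → F} (hf : Continuous f) :
    Integrable f (waveKernel d 1) := by
  have := isProbabilityMeasure_waveKernel_one hd
  obtain ⟨C, hC⟩ := (isCompact_closedBall (0 : Space d) 1).exists_bound_of_continuousOn
    hf.continuousOn
  refine Integrable.of_bound hf.aestronglyMeasurable C ?_
  filter_upwards [ae_norm_le_waveKernel_one hd] with z hz
  exact hC z (by simpa using hz)

theorem continuous_drift_integrand {d : ℕ} (hd : d = 1 ∨ d = 2 ∨ d = 3) {b : ℝ → ℝ}
    (hb : Continuous b) {w : ℝ → Space d → ℝ} (hw : Continuous (Function.uncurry w)) :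
    Continuous fun q : (ℝ × Space d) × ℝ =>
      (q.1.1 - q.2) * ∫ z, b (w q.2 (q.1.2 - (q.1.1 - q.2) • z)) ∂(waveKernel d 1) := by
  refine Continuous.mul (by fun_prop) (continuous_integral_waveKernel_one hd ?_)
  have : Continuous fun r : ((ℝ × Space d) × ℝ) × Space d =>
      (r.1.2, r.1.1.2 - (r.1.1.1 - r.1.2) • r.2) := by fun_prop
  exact hb.comp (hw.comp this)

theorem continuous_drift {d : ℕ} (hd : d = 1 ∨ d = 2 ∨ d = 3) {b : ℝ → ℝ}
    (hb : Continuous b) {w : ℝ → Space d → ℝ} (hw : Continuous (Function.uncurry w)) :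
    Continuous fun p : ℝ × Space d =>
      ∫ s in (0 : ℝ)..p.1, (p.1 - s) * ∫ z, b (w s (p.2 - (p.1 - s) • z)) ∂(waveKernel d 1) :=
  intervalIntegral.continuous_parametric_intervalIntegral_of_continuous
    (f := fun (p : ℝ × Space d) s =>
      (p.1 - s) * ∫ z, b (w s (p.2 - (p.1 - s) • z)) ∂(waveKernel d 1))
    (continuous_drift_integrand hd hb hw) continuous_fst

/-- The extension of a path to all times, constant before time `0` and after time `T`. -/
def pathExtend {d : ℕ} {T : ℝ} (hT : 0 ≤ T) (w : PathSpace d T) (s : ℝ) (y : Space d) : ℝ :=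
  IccExtend hT (fun r => w (r, y)) s

theorem continuous_pathExtend {d : ℕ} {T : ℝ} (hT : 0 ≤ T) (w : PathSpace d T) :
    Continuous (Function.uncurry (pathExtend hT w)) := by
  show Continuous fun p : ℝ × Space d => w (projIcc 0 T hT p.1, p.2)
  have : Continuous (projIcc 0 T hT) := continuous_projIcc
  fun_prop

theorem pathExtend_of_mem {d : ℕ} {T : ℝ} (hT : 0 ≤ T) (w : PathSpace d T) {s : ℝ}
    (hs : s ∈ Icc 0 T) (y : Space d) : pathExtend hT w s y = w (⟨s, hs⟩, y) :=
  IccExtend_of_mem hT _ hs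

/-- The drift term as a map of the path space to itself. -/
def driftMap {d : ℕ} (hd : d = 1 ∨ d = 2 ∨ d = 3) {T : ℝ} (hT : 0 ≤ T) {b : ℝ → ℝ}
    (hb : Continuous b) (w : PathSpace d T) : PathSpace d T where
  toFun p := ∫ s in (0 : ℝ)..(p.1 : ℝ), ((p.1 : ℝ) - s) *
    ∫ z, b (pathExtend hT w s (p.2 - ((p.1 : ℝ) - s) • z)) ∂(waveKernel d 1)
  continuous_toFun := (continuous_drift hd hb (continuous_pathExtend hT w)).comp
    (f := fun p : Icc (0 : ℝ) T × Space d => ((p.1 : ℝ), p.2)) (by fun_prop)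

theorem driftMap_apply {d : ℕ} (hd : d = 1 ∨ d = 2 ∨ d = 3) {T : ℝ} (hT : 0 ≤ T) {b : ℝ → ℝ}
    (hb : Continuous b) (w : PathSpace d T) (t : Icc (0 : ℝ) T) (x : Space d) :
    driftMap hd hT hb w (t, x) = driftTerm d b (pathExtend hT w) t x :=
  (driftTerm_eq hd b _ t.2.1 x).symm

theorem solvesIntegralEq_iff {d : ℕ} (hd : d = 1 ∨ d = 2 ∨ d = 3) {T : ℝ} (hT : 0 ≤ T)
    {b : ℝ → ℝ} (hb : Continuous b) (η z : PathSpace d T) :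
    SolvesIntegralEq d hT b η z ↔ z = η + driftMap hd hT hb z := by
  constructor
  · intro h
    ext ⟨t, x⟩
    rw [ContinuousMap.add_apply, driftMap_apply]
    exact h t x
  · intro h t x
    have := congrArg (fun f : PathSpace d T => f (t, x)) h
    rwa [ContinuousMap.add_apply, driftMap_apply] at this

/-- Finite speed of propagation: the drift terms of two paths in a backward cone are compared
through the values of the paths in the same cone. -/
theorem abs_driftMap_sub_le {d : ℕ} (hd : d = 1 ∨ d = 2 ∨ d = 3) {T : ℝ} (hT : 0 ≤ T)
    {b : ℝ → ℝ} {K : ℝ≥0} (hb : LipschitzWith K b) (w w' : PathSpace d T) (R : ℝ)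
    {φ Φ : ℝ → ℝ} (hφ : Continuous φ) (hΦ : ∀ s, HasDerivAt Φ (K * T * φ s) s)
    (h : ∀ (s : Icc (0 : ℝ) T) (y : Space d), ‖y‖ ≤ R - s → |w (s, y) - w' (s, y)| ≤ φ s)
    (t : Icc (0 : ℝ) T) (x : Space d) (hx : ‖x‖ ≤ R - t) :
    |driftMap hd hT hb.continuous w (t, x) - driftMap hd hT hb.continuous w' (t, x)|
      ≤ Φ t - Φ 0 := by
  have := isProbabilityMeasure_waveKernel_one hd
  obtain ⟨t, ht⟩ := t
  have hc : ∀ v : PathSpace d T, Continuous fun s : ℝ =>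
      (t - s) * ∫ z, b (pathExtend hT v s (x - (t - s) • z)) ∂(waveKernel d 1) := fun v =>
    (continuous_drift_integrand hd hb.continuous (continuous_pathExtend hT v)).comp
      (f := fun s : ℝ => ((t, x), s)) (by fun_prop)
  have hi : ∀ (v : PathSpace d T) (s : ℝ), Integrable
      (fun z => b (pathExtend hT v s (x - (t - s) • z))) (waveKernel d 1) := fun v s =>
    integrable_waveKernel_one hd (hb.continuous.comp ((continuous_pathExtend hT v).comp
      (f := fun z : Space d => (s, x - (t - s) • z)) (by fun_prop)))
  -- Stating the bound through a primitive Φ lets the estimate be iterated by differentiation alone.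
  have hint : ∫ s in (0 : ℝ)..t, (K * T * φ s) = Φ t - Φ 0 :=
    intervalIntegral.integral_eq_sub_of_hasDerivAt (fun s _ => hΦ s)
      (by apply Continuous.intervalIntegrable; fun_prop)
  rw [← hint]
  show |(∫ s in (0 : ℝ)..t, _) - ∫ s in (0 : ℝ)..t, _| ≤ _
  rw [← intervalIntegral.integral_sub ((hc w).intervalIntegrable _ _)
    ((hc w').intervalIntegrable _ _), ← Real.norm_eq_abs]
  refine intervalIntegral.norm_integral_le_of_norm_le ht.1 (ae_of_all _ fun s hs => ?_)
    (by apply Continuous.intervalIntegrable; fun_prop)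
  have hsT : s ∈ Icc 0 T := ⟨hs.1.le, hs.2.trans ht.2⟩
  rw [← mul_sub, ← integral_sub (hi w s) (hi w' s), norm_mul, Real.norm_of_nonneg (by linarith [hs.2])]
  have hbd : ∀ᵐ z ∂(waveKernel d 1), ‖b (pathExtend hT w s (x - (t - s) • z)) -
      b (pathExtend hT w' s (x - (t - s) • z))‖ ≤ K * φ s := by
    filter_upwards [ae_norm_le_waveKernel_one hd] with z hz
    rw [← dist_eq_norm]
    refine (hb.dist_le_mul _ _).trans ?_
    gcongr
    rw [pathExtend_of_mem hT _ hsT, pathExtend_of_mem hT _ hsT, Real.dist_eq]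
    refine h ⟨s, hsT⟩ _ ?_
    -- The cone is stable: ‖x - (t-s)z‖ ≤ (R - t) + (t - s) = R - s when ‖z‖ ≤ 1.
    have h1 := norm_sub_le x ((t - s) • z)
    rw [norm_smul, Real.norm_of_nonneg (by linarith [hs.2] : 0 ≤ t - s)] at h1
    have h2 : (t - s) * ‖z‖ ≤ (t - s) * 1 := by
      gcongr; linarith [hs.2]
    simp only at hx ⊢
    linarith
  have h3 := norm_integral_le_of_norm_le_const hbd
  rw [probReal_univ, mul_one] at h3
  -- The factor t - s, the mass of the kernel, is bounded crudely by T; hence the rate K T.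
  calc (t - s) * _ ≤ T * (K * φ s) := by
        gcongr
        linarith [hs.1, ht.2]
    _ = _ := by ring

theorem exists_cone_bound {d : ℕ} {T : ℝ} (w : PathSpace d T) (R : ℝ) :
    ∃ C, 0 ≤ C ∧ ∀ (s : Icc (0 : ℝ) T) (y : Space d), ‖y‖ ≤ R → |w (s, y)| ≤ C := by
  obtain ⟨C, hC⟩ := (isCompact_univ.prod (isCompact_closedBall (0 : Space d) R)
    : IsCompact ((univ : Set (Icc (0 : ℝ) T)) ×ˢ _)).exists_bound_of_continuousOn
      w.continuous.continuousOn
  refine ⟨max C 0, le_max_right _ _, fun s y hy => (hC (s, y) ?_).trans (le_max_left _ _)⟩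
  simpa using hy

/-- Supplies the pair φ, Φ for `abs_driftMap_sub_le`: each application raises the power and the
factorial by one. -/
theorem hasDerivAt_pow_div_factorial (C L : ℝ) (n : ℕ) (s : ℝ) :
    HasDerivAt (fun s => C * ((L * s) ^ (n + 1) / (n + 1).factorial))
      (L * (C * ((L * s) ^ n / n.factorial))) s := by
  have h := ((((hasDerivAt_id s).const_mul L).pow (n + 1)).div_const
    ((n + 1).factorial : ℝ)).const_mul C
  convert! h using 1
  rw [Nat.factorial_succ]
  push_cast
  have : (n.factorial : ℝ) ≠ 0 := by positivity
  have : (n + 1 : ℝ) ≠ 0 := by positivity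
  simp only [id]
  field_simp

/-- Picard iterates for the integral equation. -/
def picard {d : ℕ} (hd : d = 1 ∨ d = 2 ∨ d = 3) {T : ℝ} (hT : 0 ≤ T) {b : ℝ → ℝ}
    (hb : Continuous b) (η : PathSpace d T) : ℕ → PathSpace d T
  | 0 => η
  | n + 1 => η + driftMap hd hT hb (picard hd hT hb η n)

theorem abs_picard_sub_le {d : ℕ} (hd : d = 1 ∨ d = 2 ∨ d = 3) {T : ℝ} (hT : 0 ≤ T)
    {b : ℝ → ℝ} {K : ℝ≥0} (hb : LipschitzWith K b) (η : PathSpace d T) (R : ℝ) :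
    ∃ C, 0 ≤ C ∧ ∀ (n : ℕ) (s : Icc (0 : ℝ) T) (y : Space d), ‖y‖ ≤ R - s →
      |picard hd hT hb.continuous η (n + 1) (s, y) - picard hd hT hb.continuous η n (s, y)|
        ≤ C * ((K * T * s) ^ n / n.factorial) := by
  obtain ⟨C, hC0, hC⟩ := exists_cone_bound (driftMap hd hT hb.continuous η) R
  refine ⟨C, hC0, fun n => ?_⟩
  induction n with
  | zero =>
    intro s y hy
    simpa [picard] using hC s y (by linarith [s.2.1])
  | succ n ih =>
    intro s y hy
    have h := abs_driftMap_sub_le hd hT hb _ _ R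
      (φ := fun s => C * ((K * T * s) ^ n / n.factorial)) (by fun_prop)
      (hasDerivAt_pow_div_factorial C (K * T) n) ih s y hy
    rw [show picard hd hT hb.continuous η (n + 1 + 1)
        = η + driftMap hd hT hb.continuous (picard hd hT hb.continuous η (n + 1)) from rfl,
      show picard hd hT hb.continuous η (n + 1)
        = η + driftMap hd hT hb.continuous (picard hd hT hb.continuous η n) from rfl,
      ContinuousMap.add_apply, ContinuousMap.add_apply, add_sub_add_left_eq_sub]
    simpa [picard] using h

/-- The iterates telescope, and on each compact set the differences are dominated by the terms of an
exponential series. -/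
theorem tendsto_picard {d : ℕ} (hd : d = 1 ∨ d = 2 ∨ d = 3) {T : ℝ} (hT : 0 ≤ T)
    {b : ℝ → ℝ} {K : ℝ≥0} (hb : LipschitzWith K b) (η : PathSpace d T) :
    ∃ z : PathSpace d T, Tendsto (picard hd hT hb.continuous η) atTop (𝓝 z) := by
  set F : ℕ → PathSpace d T := fun n =>
    picard hd hT hb.continuous η (n + 1) - picard hd hT hb.continuous η n with hF
  have hsum : Summable F := by
    refine ContinuousMap.summable_of_locally_summable_norm fun Q => ?_
    obtain ⟨R, hR⟩ := (Q.isCompact.image continuous_snd).isBounded.exists_norm_le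
    -- A cone of base radius R + T contains the ball of radius R at every time up to T.
    obtain ⟨C, hC0, hC⟩ := abs_picard_sub_le hd hT hb η (R + T)
    refine Summable.of_norm_bounded
      ((Real.summable_pow_div_factorial (K * T * T)).mul_left C) fun n => ?_
    rw [norm_norm]
    refine (ContinuousMap.norm_le _ (by positivity)).2 fun q => ?_
    obtain ⟨⟨s, y⟩, hq⟩ := q
    have hs := s.2
    refine (hC n s y ?_).trans ?_
    · have := hR y ⟨(s, y), hq, rfl⟩
      linarith [s.2.2]
    · gcongr
      · have := s.2.1; positivity
      · exact s.2.2
  refine ⟨η + ∑' n, F n, ?_⟩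
  have h := hsum.hasSum.tendsto_sum_nat.const_add η
  refine h.congr fun n => ?_
  rw [hF, Finset.sum_range_sub (picard hd hT hb.continuous η)]
  simp [picard]

theorem exists_forall_abs_sub_lt {d : ℕ} {T : ℝ} {ι : Type*} {l : Filter ι}
    {w : ι → PathSpace d T} {z : PathSpace d T} (h : Tendsto w l (𝓝 z)) (R : ℝ) {ε : ℝ}
    (hε : 0 < ε) :
    ∀ᶠ i in l, ∀ (s : Icc (0 : ℝ) T) (y : Space d), ‖y‖ ≤ R → |w i (s, y) - z (s, y)| < ε := by
  have hc : IsCompact ((univ : Set (Icc (0 : ℝ) T)) ×ˢ Metric.closedBall (0 : Space d) R) :=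
    isCompact_univ.prod (isCompact_closedBall (0 : Space d) R)
  have h1 := ContinuousMap.tendsto_iff_forall_isCompact_tendstoUniformlyOn.1 h _ hc
  filter_upwards [Metric.tendstoUniformlyOn_iff.1 h1 ε hε] with i hi s y hy
  have := hi (s, y) (by simpa using hy)
  rwa [dist_comm, Real.dist_eq] at this

theorem solves_of_tendsto_picard {d : ℕ} (hd : d = 1 ∨ d = 2 ∨ d = 3) {T : ℝ} (hT : 0 ≤ T)
    {b : ℝ → ℝ} {K : ℝ≥0} (hb : LipschitzWith K b) {η z : PathSpace d T}
    (h : Tendsto (picard hd hT hb.continuous η) atTop (𝓝 z)) :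
    SolvesIntegralEq d hT b η z := by
  rw [solvesIntegralEq_iff hd hT hb.continuous]
  ext ⟨t, x⟩
  have h1 : Tendsto (fun n => picard hd hT hb.continuous η (n + 1) (t, x)) atTop (𝓝 (z (t, x))) :=
    ((continuous_eval_const (t, x)).tendsto z).comp ((tendsto_add_atTop_iff_nat 1).2 h)
  refine tendsto_nhds_unique h1 ?_
  rw [ContinuousMap.add_apply]
  refine Tendsto.const_add _ ?_
  rw [Metric.tendsto_nhds]
  intro ε hε
  -- The drift changes by at most K T² δ; the added 1 makes the final inequality strict and covers K
  -- T = 0.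
  set δ : ℝ := ε / (K * T * T + 1) with hδ
  have hδ0 : 0 < δ := by positivity
  filter_upwards [exists_forall_abs_sub_lt h (‖x‖ + t) hδ0] with n hn
  rw [Real.dist_eq]
  have h2 := abs_driftMap_sub_le hd hT hb (picard hd hT hb.continuous η n) z (‖x‖ + t)
    (φ := fun _ => δ) (Φ := fun s => K * T * δ * s) continuous_const
    (fun s => by simpa using (hasDerivAt_id s).const_mul (K * T * δ))
    (fun s y hy => (hn s y (by linarith [s.2.1])).le) t x (by simp)
  refine h2.trans_lt ?_
  have h3 : (K : ℝ) * T * δ * t ≤ K * T * T * δ := by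
    have := t.2.2
    calc (K : ℝ) * T * δ * t ≤ K * T * δ * T := by gcongr
      _ = _ := by ring
  have h4 : (K * T * T + 1) * δ = ε := by rw [hδ]; field_simp
  simp only [mul_zero, sub_zero]
  linarith

/-- Gronwall estimate on backward cones for two solutions of the integral equation. -/
theorem abs_sub_le_of_solves {d : ℕ} (hd : d = 1 ∨ d = 2 ∨ d = 3) {T : ℝ} (hT : 0 ≤ T)
    {b : ℝ → ℝ} {K : ℝ≥0} (hb : LipschitzWith K b) {η η' z z' : PathSpace d T}
    (hz : SolvesIntegralEq d hT b η z) (hz' : SolvesIntegralEq d hT b η' z') {R m : ℝ}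
    (hη : ∀ (s : Icc (0 : ℝ) T) (y : Space d), ‖y‖ ≤ R - s → |η (s, y) - η' (s, y)| ≤ m)
    (t : Icc (0 : ℝ) T) (x : Space d) (hx : ‖x‖ ≤ R - t) :
    |z (t, x) - z' (t, x)| ≤ m * Real.exp (K * T * t) := by
  rw [solvesIntegralEq_iff hd hT hb.continuous] at hz hz'
  obtain ⟨C, hC0, hC⟩ := exists_cone_bound (z - z') R
  -- Gronwall by iteration: start from a crude bound C on the cone and feed it back n times. The
  -- term m e^{K T s} is reproduced at each turn, the integral giving m e^{K T s} - m and η the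
  -- missing m, while the contribution of C acquires a factorial.
  have key : ∀ (n : ℕ) (s : Icc (0 : ℝ) T) (y : Space d), ‖y‖ ≤ R - s →
      |z (s, y) - z' (s, y)| ≤ m * Real.exp (K * T * s) +
        C * ((K * T * s) ^ n / n.factorial) := by
    intro n
    induction n with
    | zero =>
      intro s y hy
      have hm : 0 ≤ m := (abs_nonneg _).trans (hη s y hy)
      have h1 := hC s y (by linarith [s.2.1])
      rw [ContinuousMap.sub_apply] at h1
      have : 0 ≤ m * Real.exp (K * T * s) := by positivity
      simp only [pow_zero, Nat.factorial_zero, Nat.cast_one, div_one, mul_one]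
      linarith
    | succ n ih =>
      intro s y hy
      have hd' : ∀ s : ℝ, HasDerivAt (fun s => m * Real.exp (K * T * s) +
          C * ((K * T * s) ^ (n + 1) / (n + 1).factorial))
          (K * T * (m * Real.exp (K * T * s) + C * ((K * T * s) ^ n / n.factorial))) s := by
        intro s
        have h1 := (((hasDerivAt_id s).const_mul (K * T : ℝ)).exp).const_mul m
        convert! h1.add (hasDerivAt_pow_div_factorial C (K * T) n s) using 1
        simp only [id]; ring
      have h1 := abs_driftMap_sub_le hd hT hb z z' R
        (φ := fun s => m * Real.exp (K * T * s) + C * ((K * T * s) ^ n / n.factorial))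
        (by fun_prop) hd' ih s y hy
      have h2 := hη s y hy
      have e1 : z (s, y) = η (s, y) + driftMap hd hT hb.continuous z (s, y) :=
        congrArg (fun f : PathSpace d T => f (s, y)) hz
      have e2 : z' (s, y) = η' (s, y) + driftMap hd hT hb.continuous z' (s, y) :=
        congrArg (fun f : PathSpace d T => f (s, y)) hz'
      rw [e1, e2, add_sub_add_comm]
      refine (abs_add_le _ _).trans ?_
      simp only [mul_zero, Real.exp_zero, mul_one, ne_eq, Nat.add_eq_zero_iff, one_ne_zero,
        and_false, not_false_eq_true, zero_pow, zero_div, add_zero] at h1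
      linarith
  have hlim : Tendsto (fun n : ℕ => m * Real.exp (K * T * t) +
      C * ((K * T * t) ^ n / n.factorial)) atTop (𝓝 (m * Real.exp (K * T * t) + C * 0)) :=
    ((FloorSemiring.tendsto_pow_div_factorial_atTop (K * T * t : ℝ)).const_mul C).const_add _
  have := ge_of_tendsto' hlim fun n => key n t x hx
  simpa using this

theorem existsUnique_solution {d : ℕ} (hd : d = 1 ∨ d = 2 ∨ d = 3) {T : ℝ} (hT : 0 ≤ T)
    {b : ℝ → ℝ} {K : ℝ≥0} (hb : LipschitzWith K b) (η : PathSpace d T) :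
    ∃! z : PathSpace d T, SolvesIntegralEq d hT b η z := by
  obtain ⟨z, hz⟩ := tendsto_picard hd hT hb η
  refine ⟨z, solves_of_tendsto_picard hd hT hb hz, fun z' hz' => ?_⟩
  ext ⟨t, x⟩
  -- The cone with apex (t,x), with vanishing difference of the inhomogeneities.
  have := abs_sub_le_of_solves hd hT hb hz' (solves_of_tendsto_picard hd hT hb hz)
    (R := ‖x‖ + t) (m := 0) (by simp) t x (by simp)
  rw [zero_mul] at this
  exact sub_eq_zero.1 (abs_eq_zero.1 (le_antisymm this (abs_nonneg _)))

theorem continuous_solutionMap {d : ℕ} (hd : d = 1 ∨ d = 2 ∨ d = 3) {T : ℝ} (hT : 0 ≤ T)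
    {b : ℝ → ℝ} {K : ℝ≥0} (hb : LipschitzWith K b) {F : PathSpace d T → PathSpace d T}
    (hF : ∀ η, SolvesIntegralEq d hT b η (F η)) : Continuous F := by
  rw [continuous_iff_continuousAt]
  intro η
  refine ContinuousMap.tendsto_iff_forall_isCompact_tendstoUniformlyOn.2 fun Q hQ => ?_
  obtain ⟨R, hR⟩ := (hQ.image continuous_snd).isBounded.exists_norm_le
  refine Metric.tendstoUniformlyOn_iff.2 fun ε hε => ?_
  -- This tolerance on η cancels the Gronwall factor at time T.
  have hδ : 0 < ε / 2 * Real.exp (-(K * T * T)) := by positivity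
  filter_upwards [exists_forall_abs_sub_lt (tendsto_id (x := 𝓝 η)) (R + T) hδ] with η' h
  rintro ⟨t, x⟩ hq
  have h1 := abs_sub_le_of_solves hd hT hb (hF η') (hF η) (R := R + T)
    (fun s y hy => (h s y (by linarith [s.2.1])).le) t x
    (by have := hR x ⟨_, hq, rfl⟩; linarith [t.2.2])
  rw [dist_comm, Real.dist_eq]
  refine h1.trans_lt ?_
  have h2 : Real.exp (K * T * t) ≤ Real.exp (K * T * T) := by
    apply Real.exp_le_exp.2
    have := t.2.2
    gcongr
  calc _ ≤ ε / 2 * Real.exp (-(K * T * T)) * Real.exp (K * T * T) := by gcongr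
    _ = ε / 2 := by rw [mul_assoc, ← Real.exp_add]; simp
    _ < ε := by linarith

/-! ### Continuous modifications of processes with all moments of the increments controlled -/

section Chaining

variable {E : Type*} [PseudoMetricSpace E]

/-- If `f` varies little between neighbouring points of successive nets, then its values at the
net points next to `x` converge, and the limit is a continuous function of `x`. -/
theorem exists_continuous_limit_of_nets {x₀ : E} {π : ℕ → E → E} {S : ℕ → Finset E} {D ρ : ℝ}
    (hρ0 : 0 < ρ) (hρ1 : ρ < 1)
    (hS : ∀ (n : ℕ) (x : E), dist x x₀ ≤ n → π n x ∈ S n)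
    (hπ : ∀ n x, dist x (π n x) ≤ D * (1 / 2) ^ n) {f : E → ℝ} {N : ℕ}
    (hf : ∀ n ≥ N, ∀ p ∈ S n, ∀ q, q ∈ S n ∨ q ∈ S (n + 1) →
      dist p q ≤ (2 * D + 1) * (1 / 2) ^ n → |f p - f q| ≤ ρ ^ n) :
    ∃ g : C(E, ℝ), ∀ x, Tendsto (fun n => f (π n x)) atTop (𝓝 (g x)) := by
  have hstep : ∀ (x : E) (n : ℕ), N ≤ n → dist x x₀ ≤ n →
      dist (f (π n x)) (f (π (n + 1) x)) ≤ ρ ^ n := by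
    intro x n hn hx
    have hD : 0 ≤ D * (1 / 2) ^ n := dist_nonneg.trans (hπ n x)
    rw [Real.dist_eq]
    refine hf n hn _ (hS n x hx) _ (Or.inr (hS (n + 1) x (by push_cast; linarith))) ?_
    have h1 := dist_triangle_left (π n x) (π (n + 1) x) x
    have h2 := hπ n x
    have h3 := hπ (n + 1) x
    have h4 : (0 : ℝ) < (1 / 2) ^ n := by positivity
    -- Consecutive approximants of x are at distance at most (D + D/2) 2^(-n).
    rw [pow_succ] at h3
    nlinarith
  have hlim : ∀ x, ∃ y, Tendsto (fun n => f (π n x)) atTop (𝓝 y) ∧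
      ∀ n, N ≤ n → dist x x₀ ≤ n → dist (f (π n x)) y ≤ ρ ^ n / (1 - ρ) := by
    intro x
    obtain ⟨n₀, hn₀⟩ := exists_nat_ge (dist x x₀)
    have hs : ∀ m : ℕ, N ≤ m → dist x x₀ ≤ m → ∀ n, dist (f (π (n + m) x)) (f (π (n + 1 + m) x))
        ≤ ρ ^ m * ρ ^ n := by
      intro m hm hx n
      have := hstep x (n + m) (by omega) (by push_cast; linarith [(Nat.cast_nonneg n : (0 : ℝ) ≤ n)])
      rw [show n + 1 + m = n + m + 1 by ring, ← pow_add, add_comm m n]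
      exact this
    have hc := cauchySeq_of_le_geometric (f := fun n => f (π (n + max N n₀) x)) ρ _ hρ1
      (hs (max N n₀) (le_max_left _ _) (hn₀.trans (by exact_mod_cast le_max_right _ _)))
    obtain ⟨y, hy⟩ := cauchySeq_tendsto_of_complete hc
    have hy' := (tendsto_add_atTop_iff_nat (f := fun n => f (π n x)) (max N n₀)).1 hy
    refine ⟨y, hy', fun n hn hx => ?_⟩
    have := dist_le_of_le_geometric_of_tendsto₀ (f := fun m => f (π (m + n) x)) ρ _ hρ1 (hs n hn hx)
      ((tendsto_add_atTop_iff_nat (f := fun n => f (π n x)) n).2 hy')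
    simpa using this
  choose g hg hgd using hlim
  refine ⟨⟨g, ?_⟩, hg⟩
  rw [Metric.continuous_iff]
  intro x ε hε
  have hρ2 : 0 < 1 - ρ := by linarith
  -- Two geometric tails, one for each of x and y, and one step between their approximants at level
  -- n.
  have htend : Tendsto (fun n : ℕ => (2 / (1 - ρ) + 1) * ρ ^ n) atTop (𝓝 ((2 / (1 - ρ) + 1) * 0)) :=
    (tendsto_pow_atTop_nhds_zero_of_lt_one hρ0.le hρ1).const_mul _
  rw [mul_zero] at htend
  obtain ⟨n₁, hn₁⟩ := exists_nat_ge (dist x x₀ + 1)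
  obtain ⟨n, hnε, hn⟩ := ((htend.eventually (gt_mem_nhds hε)).and
    (eventually_ge_atTop (max N n₁))).exists
  have hnN : N ≤ n := (le_max_left _ _).trans hn
  have hxn : dist x x₀ + 1 ≤ n := hn₁.trans (by exact_mod_cast (le_max_right _ _).trans hn)
  have hpow : (0 : ℝ) < (1 / 2) ^ n := by positivity
  refine ⟨(1 / 2) ^ n, hpow, fun y hy => ?_⟩
  have hp1 : ((1 : ℝ) / 2) ^ n ≤ 1 := pow_le_one₀ (by norm_num) (by norm_num)
  have hyn : dist y x₀ ≤ n := (dist_triangle y x x₀).trans (by linarith)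
  have h1 : dist (f (π n x)) (f (π n y)) ≤ ρ ^ n := by
    rw [Real.dist_eq]
    refine hf n hnN _ (hS n x (by linarith)) _ (Or.inl (hS n y hyn)) ?_
    -- The constant 2D + 1 of the hypothesis comes from here: two roundings, plus dist x y < 2^(-n).
    have e1 := dist_triangle_left (π n x) (π n y) x
    have e2 := dist_triangle x y (π n y)
    have e3 := hπ n x
    have e4 := hπ n y
    rw [dist_comm] at hy
    linarith
  have h2 := hgd x n hnN (by linarith)
  have h3 := hgd y n hnN hyn
  have h4 := dist_triangle4 (g y) (f (π n y)) (f (π n x)) (g x)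
  rw [dist_comm] at h3
  rw [dist_comm] at h1
  have h5 : (2 / (1 - ρ) + 1) * ρ ^ n = ρ ^ n / (1 - ρ) + ρ ^ n + ρ ^ n / (1 - ρ) := by ring
  exact h4.trans_lt (by linarith)

variable {Ω : Type*} [MeasurableSpace Ω] {P : Measure Ω}

/-- Markov's inequality for the k-th power. Increments at scale 2^(-n) have size 2^(-nθ) = ρ^(2n);
testing against the larger threshold ρ^n leaves a gain ρ^(nk), which beats any exponential once k is
large. -/
theorem meas_increment_le {X : E → Ω → ℝ} (hX : ∀ p, Measurable (X p)) {θ : ℝ} {k : ℕ} {C : ℝ≥0}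
    (hθ : 0 < θ) (hC : ∀ p q, ∫⁻ ω, ‖X p ω - X q ω‖ₑ ^ k ∂P
      ≤ C * ENNReal.ofReal (dist p q ^ θ) ^ k) {c : ℝ} (hc : 0 ≤ c) (n : ℕ) {p q : E}
    (hpq : dist p q ≤ c * (1 / 2) ^ n) :
    P {ω | ((1 / 2 : ℝ) ^ (θ / 2)) ^ n < |X p ω - X q ω|}
      ≤ ENNReal.ofReal (C * (c ^ θ) ^ k * (((1 / 2 : ℝ) ^ (θ / 2)) ^ k) ^ n) := by
  set ρ : ℝ := (1 / 2 : ℝ) ^ (θ / 2) with hρ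
  have hρ0 : 0 < ρ := by positivity
  have hρθ : ((1 / 2 : ℝ) ^ n) ^ θ = ρ ^ n * ρ ^ n := by
    rw [hρ, ← Real.rpow_natCast, ← Real.rpow_natCast, ← Real.rpow_mul (by norm_num),
      ← Real.rpow_mul (by norm_num), ← Real.rpow_add (by norm_num)]
    congr 1; ring
  have hm : AEMeasurable (fun ω => ‖X p ω - X q ω‖ₑ ^ k) P :=
    (((hX p).sub (hX q)).enorm.pow_const k).aemeasurable
  have hpos : (0 : ℝ) < (ρ ^ n) ^ k := by positivity
  calc P {ω | ρ ^ n < |X p ω - X q ω|}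
      ≤ P {ω | ENNReal.ofReal ((ρ ^ n) ^ k) ≤ ‖X p ω - X q ω‖ₑ ^ k} := by
        refine measure_mono fun ω hω => ?_
        have hω' : ρ ^ n < |X p ω - X q ω| := hω
        show ENNReal.ofReal ((ρ ^ n) ^ k) ≤ ‖X p ω - X q ω‖ₑ ^ k
        rw [Real.enorm_eq_ofReal_abs, ← ENNReal.ofReal_pow (abs_nonneg _)]
        gcongr
    _ ≤ (∫⁻ ω, ‖X p ω - X q ω‖ₑ ^ k ∂P) / ENNReal.ofReal ((ρ ^ n) ^ k) :=
        meas_ge_le_lintegral_div hm (by simpa using hpos) ENNReal.ofReal_ne_top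
    _ ≤ (C * ENNReal.ofReal (dist p q ^ θ) ^ k) / ENNReal.ofReal ((ρ ^ n) ^ k) := by
        gcongr; exact hC p q
    _ ≤ ENNReal.ofReal (C * ((c ^ θ) * (ρ ^ n * ρ ^ n)) ^ k) / ENNReal.ofReal ((ρ ^ n) ^ k) := by
        gcongr
        rw [ENNReal.ofReal_mul C.coe_nonneg, ← ENNReal.ofReal_pow (by positivity), ENNReal.ofReal_coe_nnreal]
        gcongr
        calc dist p q ^ θ ≤ (c * (1 / 2) ^ n) ^ θ := by gcongr
          _ = _ := by rw [Real.mul_rpow hc (by positivity), hρθ]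
    _ = _ := by
        rw [← ENNReal.ofReal_div_of_pos hpos]
        congr 1
        rw [mul_pow, mul_pow, ← pow_mul, ← pow_mul, mul_comm k n]
        field_simp

/-- A form of the Kolmogorov continuity theorem. -/
theorem exists_continuous_modification [IsProbabilityMeasure P] {X : E → Ω → ℝ}
    (hX : ∀ p, Measurable (X p)) {θ : ℝ} (hθ : 0 < θ)
    (hmom : ∀ k : ℕ, ∃ C : ℝ≥0, ∀ p q, ∫⁻ ω, ‖X p ω - X q ω‖ₑ ^ k ∂P
      ≤ C * ENNReal.ofReal (dist p q ^ θ) ^ k)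
    {x₀ : E} {π : ℕ → E → E} {S : ℕ → Finset E} {A : ℕ} {D : ℝ} (hD : 0 ≤ D)
    (hS : ∀ (n : ℕ) (x : E), dist x x₀ ≤ n → π n x ∈ S n) (hcard : ∀ n, (S n).card ≤ A ^ (n + 1))
    (hπ : ∀ n x, dist x (π n x) ≤ D * (1 / 2) ^ n) :
    ∃ U : Ω → C(E, ℝ), (∀ p, Measurable fun ω => U ω p) ∧ ∀ p, ∀ᵐ ω ∂P, U ω p = X p ω := by
  classical
  set ρ : ℝ := (1 / 2 : ℝ) ^ (θ / 2) with hρ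
  have hρ0 : 0 < ρ := by positivity
  have hρ1 : ρ < 1 := Real.rpow_lt_one (by norm_num) (by norm_num) (by positivity)
  -- Level n involves of the order of A^(2n) pairs of net points, so this k makes the union bound
  -- summable.
  obtain ⟨k, hk⟩ : ∃ k : ℕ, (A : ℝ) ^ 2 * ρ ^ k < 1 := by
    have h : Tendsto (fun k : ℕ => (A : ℝ) ^ 2 * ρ ^ k) atTop (𝓝 ((A : ℝ) ^ 2 * 0)) :=
      (tendsto_pow_atTop_nhds_zero_of_lt_one hρ0.le hρ1).const_mul _
    rw [mul_zero] at h
    exact (h.eventually (gt_mem_nhds one_pos)).exists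
  obtain ⟨C, hC⟩ := hmom k
  set c : ℝ := 2 * D + 1 with hc
  have hc0 : 0 ≤ c := by positivity
  set Q : ℕ → Finset (E × E) := fun n =>
    ((S n) ×ˢ (S n ∪ S (n + 1))).filter fun r => dist r.1 r.2 ≤ c * (1 / 2) ^ n with hQ
  set B : ℕ → Set Ω := fun n => ⋃ r ∈ Q n, {ω | ρ ^ n < |X r.1 ω - X r.2 ω|} with hB
  have hBm : ∀ n, MeasurableSet (B n) := fun n => Finset.measurableSet_biUnion _ fun r _ =>
    measurableSet_lt measurable_const ((hX r.1).sub (hX r.2)).abs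
  set M : ℝ := C * (c ^ θ) ^ k with hM
  have hBle : ∀ n, P (B n) ≤ ENNReal.ofReal
      ((A * (A + A ^ 2) * M) * ((A : ℝ) ^ 2 * ρ ^ k) ^ n) := by
    intro n
    have hcardQ : ((Q n).card : ℝ) ≤ A ^ (n + 1) * (A ^ (n + 1) + A ^ (n + 2)) := by
      have h1 : (Q n).card ≤ A ^ (n + 1) * (A ^ (n + 1) + A ^ (n + 2)) := by
        refine (Finset.card_filter_le _ _).trans ?_
        rw [Finset.card_product]
        gcongr
        · exact hcard n
        · exact (Finset.card_union_le _ _).trans (add_le_add (hcard n) (hcard (n + 1)))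
      exact_mod_cast h1
    calc P (B n) ≤ ∑ r ∈ Q n, P {ω | ρ ^ n < |X r.1 ω - X r.2 ω|} := measure_biUnion_finset_le _ _
      _ ≤ ∑ r ∈ Q n, ENNReal.ofReal (M * (ρ ^ k) ^ n) := Finset.sum_le_sum fun r hr =>
          meas_increment_le hX hθ hC hc0 n (Finset.mem_filter.1 hr).2
      _ = ENNReal.ofReal ((Q n).card * (M * (ρ ^ k) ^ n)) := by
          rw [Finset.sum_const, nsmul_eq_mul, ENNReal.ofReal_mul (Nat.cast_nonneg _),
            ENNReal.ofReal_natCast]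
      _ ≤ _ := by
          apply ENNReal.ofReal_le_ofReal
          calc ((Q n).card : ℝ) * (M * (ρ ^ k) ^ n)
              ≤ (A ^ (n + 1) * (A ^ (n + 1) + A ^ (n + 2))) * (M * (ρ ^ k) ^ n) := by gcongr
            _ = _ := by ring
  have hsum : ∑' n, P (B n) ≠ ∞ := by
    have h1 : Summable fun n : ℕ => (A * (A + A ^ 2) * M) * ((A : ℝ) ^ 2 * ρ ^ k) ^ n :=
      (summable_geometric_of_lt_one (by positivity) hk).mul_left _
    exact ne_top_of_le_ne_top h1.tsum_ofReal_ne_top (ENNReal.tsum_le_tsum hBle)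
  -- The event of full probability given by the Borel–Cantelli lemma. Off it the path is set to 0,
  -- so that every path is continuous.
  set G : Set Ω := {ω | ∃ N, ∀ n ≥ N, ω ∉ B n} with hG
  have hGm : MeasurableSet G := by
    have : G = ⋃ N, ⋂ n, ⋂ (_ : n ≥ N), (B n)ᶜ := by ext ω; simp [hG]
    rw [this]
    exact MeasurableSet.iUnion fun N => MeasurableSet.iInter fun n => MeasurableSet.iInter fun _ =>
      (hBm n).compl
  have hGae : ∀ᵐ ω ∂P, ω ∈ G := by
    filter_upwards [ae_eventually_notMem hsum] with ω hω
    exact eventually_atTop.1 hω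
  have hlim : ∀ ω ∈ G, ∃ g : C(E, ℝ), ∀ x, Tendsto (fun n => X (π n x) ω) atTop (𝓝 (g x)) := by
    rintro ω ⟨N, hN⟩
    refine exists_continuous_limit_of_nets (f := fun p => X p ω) hρ0 hρ1 hS hπ (N := N)
      fun n hn p hp q hq hpq => ?_
    have h := hN n hn
    simp only [hB, mem_iUnion, not_exists] at h
    have := h (p, q) (Finset.mem_filter.2 ⟨Finset.mem_product.2 ⟨hp, by
      rw [Finset.mem_union]; exact hq⟩, hpq⟩)
    simpa using this
  choose! g hg using hlim
  refine ⟨fun ω => if ω ∈ G then g ω else 0, ?_, ?_⟩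
  · intro p
    refine measurable_of_tendsto_metrizable (f := fun n ω => G.indicator (X (π n p)) ω)
      (fun n => (hX _).indicator hGm) ?_
    rw [tendsto_pi_nhds]
    intro ω
    by_cases hω : ω ∈ G
    · simpa [hω] using hg ω hω p
    · simp [hω]
  · intro p
    obtain ⟨C₁, hC₁⟩ := hmom 1
    -- The values at the net points tend to X p in L¹ and, on G, pointwise to the constructed path;
    -- Fatou's lemma identifies the two limits.
    have hz : Tendsto (fun n => ∫⁻ ω, ‖X (π n p) ω - X p ω‖ₑ ∂P) atTop (𝓝 0) := by
      have h1 : Tendsto (fun n : ℕ => (C₁ : ℝ≥0∞) * ENNReal.ofReal ((D * (1 / 2) ^ n) ^ θ))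
          atTop (𝓝 ((C₁ : ℝ≥0∞) * ENNReal.ofReal ((D * 0) ^ θ))) := by
        refine ENNReal.Tendsto.const_mul ?_ (Or.inr ENNReal.coe_ne_top)
        refine ENNReal.tendsto_ofReal ?_
        exact ((tendsto_pow_atTop_nhds_zero_of_lt_one (by norm_num) (by norm_num)).const_mul D).rpow_const
          (Or.inr hθ.le)
      rw [mul_zero, Real.zero_rpow hθ.ne', ENNReal.ofReal_zero, mul_zero] at h1
      refine tendsto_of_tendsto_of_tendsto_of_le_of_le tendsto_const_nhds h1 (fun _ => zero_le)
        fun n => ?_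
      have := hC₁ (π n p) p
      simp only [pow_one] at this
      refine this.trans ?_
      gcongr
      rw [dist_comm]
      exact hπ n p
    have hle : ∫⁻ ω, liminf (fun n => ‖X (π n p) ω - X p ω‖ₑ) atTop ∂P = 0 := by
      refine le_antisymm ?_ zero_le
      refine (lintegral_liminf_le fun n => ((hX _).sub (hX p)).enorm).trans ?_
      exact hz.liminf_eq.le
    have hae := (lintegral_eq_zero_iff (Measurable.liminf fun n =>
      ((hX (π n p)).sub (hX p)).enorm)).1 hle
    filter_upwards [hae, hGae] with ω h0 hω
    have h2 : Tendsto (fun n => ‖X (π n p) ω - X p ω‖ₑ) atTop (𝓝 ‖g ω p - X p ω‖ₑ) :=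
      ((hg ω hω p).sub_const _).enorm
    have h3 : ‖g ω p - X p ω‖ₑ = 0 := h2.liminf_eq.symm.trans h0
    rw [if_pos hω]
    exact sub_eq_zero.1 (enorm_eq_zero.1 h3)

end Chaining

/-! ### Dyadic nets -/

theorem abs_sub_floor_div_le (n : ℕ) (a : ℝ) :
    |a - (⌊a * 2 ^ n⌋ : ℝ) / 2 ^ n| ≤ (1 / 2) ^ n := by
  have hp : (0 : ℝ) < 2 ^ n := by positivity
  have h : a - (⌊a * 2 ^ n⌋ : ℝ) / 2 ^ n = Int.fract (a * 2 ^ n) / 2 ^ n := by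
    rw [← Int.self_sub_floor]; field_simp
  rw [h, abs_of_nonneg (by have := Int.fract_nonneg (a * 2 ^ n); positivity), one_div, inv_pow,
    ← one_div]
  gcongr
  exact (Int.fract_lt_one _).le

theorem floor_mem_Icc {n m : ℕ} {a : ℝ} (ha : |a| ≤ m) :
    ⌊a * 2 ^ n⌋ ∈ Finset.Icc (-(m * 2 ^ n : ℕ) : ℤ) (m * 2 ^ n : ℕ) := by
  have hp : (0 : ℝ) < 2 ^ n := by positivity
  obtain ⟨h1, h2⟩ := abs_le.1 ha
  rw [Finset.mem_Icc]
  constructor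
  · rw [Int.le_floor]; push_cast; nlinarith
  · have : a * 2 ^ n ≤ ((m * 2 ^ n : ℕ) : ℤ) := by push_cast; gcongr
    exact_mod_cast (Int.floor_le _).trans this

/-- Coordinates are rounded down to multiples of 2^(-n). The nets cover balls of growing radius n,
which costs only a polynomial factor, so cardinalities stay exponential in n. -/
theorem exists_nets (d : ℕ) {T : ℝ} (hT : 0 ≤ T) :
    ∃ (x₀ : Icc (0 : ℝ) T × Space d) (π : ℕ → Icc (0 : ℝ) T × Space d → Icc (0 : ℝ) T × Space d)
      (S : ℕ → Finset (Icc (0 : ℝ) T × Space d)) (A : ℕ) (D : ℝ), 0 ≤ D ∧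
      (∀ (n : ℕ) (x : Icc (0 : ℝ) T × Space d), dist x x₀ ≤ n → π n x ∈ S n) ∧ (∀ n, (S n).card ≤ A ^ (n + 1)) ∧
      ∀ n x, dist x (π n x) ≤ D * (1 / 2) ^ n := by
  classical
  set e : ℕ → ℤ × (Fin d → ℤ) → Icc (0 : ℝ) T × Space d := fun n k =>
    (projIcc 0 T hT (k.1 / 2 ^ n), WithLp.toLp 2 fun i => (k.2 i : ℝ) / 2 ^ n) with he
  set r : ℕ → Icc (0 : ℝ) T × Space d → ℤ × (Fin d → ℤ) := fun n x =>
    (⌊(x.1 : ℝ) * 2 ^ n⌋, fun i => ⌊x.2 i * 2 ^ n⌋) with hr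
  obtain ⟨m, hm⟩ := exists_nat_ge T
  set I : ℕ → ℕ → Finset ℤ := fun m n => Finset.Icc (-(m * 2 ^ n : ℕ) : ℤ) (m * 2 ^ n : ℕ) with hI
  have hIcard : ∀ m n : ℕ, (I m n).card ≤ (2 * m + 1) * 2 ^ n := by
    intro m n
    have h1 : 1 ≤ 2 ^ n := Nat.one_le_two_pow
    rw [hI, Int.card_Icc]
    have : ((m * 2 ^ n : ℕ) : ℤ) + 1 - -((m * 2 ^ n : ℕ) : ℤ) = ((2 * (m * 2 ^ n) + 1 : ℕ) : ℤ) := by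
      push_cast; ring
    rw [this, Int.toNat_natCast]
    nlinarith
  -- There are at most (2m+1) 2^n times, and (2n+1) 2^n ≤ 3 · 4^n values for each spatial
  -- coordinate; this is the origin of A. In D = 1 + d, the 1 covers time, and d covers √d in space.
  refine ⟨(⟨0, le_rfl, hT⟩, 0), fun n x => e n (r n x),
    fun n => ((I m n) ×ˢ (Fintype.piFinset fun _ : Fin d => I n n)).image (e n),
    ((2 * m + 1) * 2) * (3 * 4) ^ d, 1 + d, by positivity, ?_, ?_, ?_⟩
  · intro n x hx
    refine Finset.mem_image_of_mem _ (Finset.mem_product.2 ⟨?_, Fintype.mem_piFinset.2 fun i => ?_⟩)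
    · exact floor_mem_Icc ((abs_of_nonneg x.1.2.1).le.trans (x.1.2.2.trans hm))
    · refine floor_mem_Icc ?_
      have h1 : dist x.2 0 ≤ n := (le_max_right _ _).trans hx
      rw [dist_zero_right] at h1
      exact (PiLp.norm_apply_le x.2 i).trans h1
  · intro n
    refine Finset.card_image_le.trans ?_
    rw [Finset.card_product, Fintype.card_piFinset, Finset.prod_const, Finset.card_univ,
      Fintype.card_fin, mul_pow]
    have h2 : n + 1 ≤ 2 ^ n := Nat.lt_two_pow_self
    have h1 : 1 ≤ 2 ^ n := Nat.one_le_two_pow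
    have h3 : (I m n).card ≤ ((2 * m + 1) * 2) ^ (n + 1) := by
      refine (hIcard m n).trans ?_
      rw [mul_pow]
      refine Nat.mul_le_mul (Nat.le_self_pow (by omega) _) ?_
      rw [pow_succ]; omega
    have h4 : (I n n).card ≤ (3 * 4) ^ (n + 1) := by
      refine (hIcard n n).trans ?_
      rw [mul_pow]
      have h5 : 2 * n + 1 ≤ 3 * 2 ^ n := by omega
      calc (2 * n + 1) * 2 ^ n ≤ 3 * 2 ^ n * 2 ^ n := by gcongr
        _ = 3 * 4 ^ n := by rw [mul_assoc, ← mul_pow]; norm_num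
        _ ≤ 3 ^ (n + 1) * 4 ^ (n + 1) := by
            refine Nat.mul_le_mul (Nat.le_self_pow (by omega) _) ?_
            exact Nat.pow_le_pow_right (by norm_num) (by omega)
    calc _ ≤ ((2 * m + 1) * 2) ^ (n + 1) * ((3 * 4) ^ (n + 1)) ^ d := by gcongr
      _ = _ := by rw [← pow_mul, ← pow_mul, mul_comm d]
  · intro n x
    have hp : (0 : ℝ) < (1 / 2) ^ n := by positivity
    refine max_le ?_ ?_
    · have h1 : ((⌊(x.1 : ℝ) * 2 ^ n⌋ : ℝ) / 2 ^ n) ∈ Icc 0 T := by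
        have h0 : 0 ≤ (x.1 : ℝ) * 2 ^ n := by have := x.1.2.1; positivity
        constructor
        · have : (0 : ℝ) ≤ ⌊(x.1 : ℝ) * 2 ^ n⌋ := by exact_mod_cast Int.floor_nonneg.2 h0
          positivity
        · rw [div_le_iff₀ (by positivity)]
          refine (Int.floor_le _).trans ?_
          have := x.1.2.2
          gcongr
      show dist x.1 (projIcc 0 T hT ((⌊(x.1 : ℝ) * 2 ^ n⌋ : ℝ) / 2 ^ n)) ≤ _
      rw [projIcc_of_mem hT h1, Subtype.dist_eq, Real.dist_eq]
      refine (abs_sub_floor_div_le n _).trans ?_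
      have : (0 : ℝ) ≤ d * (1 / 2) ^ n := by positivity
      linarith
    · show dist x.2 (WithLp.toLp 2 fun i => (⌊x.2 i * 2 ^ n⌋ : ℝ) / 2 ^ n) ≤ _
      rw [EuclideanSpace.dist_eq]
      have h1 : ∑ i, dist (x.2 i) ((⌊x.2 i * 2 ^ n⌋ : ℝ) / 2 ^ n) ^ 2
          ≤ (d * (1 / 2) ^ n) ^ 2 := by
        calc _ ≤ ∑ _i : Fin d, ((1 / 2 : ℝ) ^ n) ^ 2 := by
              gcongr with i
              rw [Real.dist_eq]; exact abs_sub_floor_div_le n _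
          _ = d * ((1 / 2 : ℝ) ^ n) ^ 2 := by simp
          _ ≤ d ^ 2 * ((1 / 2 : ℝ) ^ n) ^ 2 := by
              gcongr
              exact_mod_cast Nat.le_self_pow (by norm_num) d
          _ = _ := by ring
      refine (Real.sqrt_le_left (by positivity)).2 (h1.trans ?_)
      gcongr
      linarith

/-! ### Fourier transforms of test functions -/

theorem norm_exp_neg_I_mul_ofReal (a : ℝ) : ‖Complex.exp (-Complex.I * (a : ℂ))‖ = 1 := by
  rw [Complex.norm_exp]; simp

theorem norm_exp_neg_I_mul_sub_le (a b : ℝ) :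
    ‖Complex.exp (-Complex.I * (a : ℂ)) - Complex.exp (-Complex.I * (b : ℂ))‖ ≤ |a - b| := by
  have h : Complex.exp (-Complex.I * (a : ℂ)) - Complex.exp (-Complex.I * (b : ℂ))
      = Complex.exp (-Complex.I * (b : ℂ)) * (Complex.exp (Complex.I * ((b - a : ℝ) : ℂ)) - 1) := by
    rw [mul_sub, ← Complex.exp_add, mul_one]
    congr 2; push_cast; ring
  rw [h, norm_mul, norm_exp_neg_I_mul_ofReal, one_mul, abs_sub_comm]
  exact Real.norm_exp_I_mul_ofReal_sub_one_le

section TestFunctions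

variable {d : ℕ} (φ : NoiseTest d)

theorem apply_eq_zero_of_notMem_image {t : ℝ} {x : Space d} (hx : x ∉ Prod.snd '' tsupport φ) :
    φ (t, x) = 0 :=
  image_eq_zero_of_notMem_tsupport fun h => hx ⟨(t, x), h, rfl⟩

theorem isCompact_image_snd_tsupport : IsCompact (Prod.snd '' tsupport φ) :=
  φ.hasCompactSupport.isCompact.image continuous_snd

theorem spaceFourier_eq_setIntegral (t : ℝ) (ξ : Space d) :
    spaceFourier φ t ξ = ∫ x in Prod.snd '' tsupport φ,
      Complex.exp (-Complex.I * ((inner ℝ ξ x : ℝ) : ℂ)) * ((φ (t, x) : ℝ) : ℂ) :=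
  (setIntegral_eq_integral_of_forall_compl_eq_zero fun x hx => by
    simp [apply_eq_zero_of_notMem_image φ hx]).symm

theorem continuous_spaceFourier :
    Continuous fun p : ℝ × Space d => spaceFourier φ p.1 p.2 := by
  simp only [spaceFourier_eq_setIntegral]
  refine continuous_parametric_integral_of_continuous ?_ (isCompact_image_snd_tsupport φ)
  have := φ.continuous
  fun_prop

theorem exists_spaceFourier_eq_zero : ∃ A : ℝ, 0 ≤ A ∧ ∀ t, A < t → ∀ ξ, spaceFourier φ t ξ = 0 := by
  obtain ⟨A, hA⟩ := (φ.hasCompactSupport.isCompact.image continuous_fst).isBounded.exists_norm_le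
  refine ⟨max A 0, le_max_right _ _, fun t ht ξ => ?_⟩
  have : ∀ x, φ (t, x) = 0 := fun x => image_eq_zero_of_notMem_tsupport fun h => by
    have h1 := (le_abs_self t).trans (hA t ⟨(t, x), h, rfl⟩)
    exact absurd ht (not_lt.2 (h1.trans (le_max_left _ _)))
  simp [spaceFourier, this]

/-- One integration by parts. A single power of decay suffices, because products of two transforms
then decay like (1+‖ξ‖)^(-2) and q < 2. -/
theorem exists_norm_spaceFourier_le : ∃ C, 0 ≤ C ∧ ∀ t ξ, ‖spaceFourier φ t ξ‖ * (1 + ‖ξ‖) ≤ C := by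
  set Q := Prod.snd '' tsupport φ with hQ
  have hQc : IsCompact Q := isCompact_image_snd_tsupport φ
  obtain ⟨C₀, hC₀⟩ := φ.hasCompactSupport.exists_bound_of_continuous φ.continuous
  have hD : Continuous (fderiv ℝ φ) := φ.contDiff.continuous_fderiv (by simp)
  obtain ⟨C₁, hC₁⟩ := (φ.hasCompactSupport.fderiv (𝕜 := ℝ)).exists_bound_of_continuous hD
  have hC₀0 : 0 ≤ C₀ := (norm_nonneg _).trans (hC₀ 0)
  have hC₁0 : 0 ≤ C₁ := (norm_nonneg _).trans (hC₁ 0)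
  set m := (volume : Measure (Space d)).real Q with hm
  have hm0 : 0 ≤ m := measureReal_nonneg
  have h0 : ∀ t ξ, ‖spaceFourier φ t ξ‖ ≤ C₀ * m := by
    intro t ξ
    rw [spaceFourier_eq_setIntegral]
    refine norm_setIntegral_le_of_norm_le_const hQc.measure_lt_top fun x _ => ?_
    rw [norm_mul, norm_exp_neg_I_mul_ofReal, one_mul, Complex.norm_real]
    exact hC₀ _
  have h1 : ∀ t ξ, ‖spaceFourier φ t ξ‖ * ‖ξ‖ ≤ C₁ * m := by
    intro t ξ
    rcases eq_or_ne ξ 0 with rfl | hξ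
    · simp; positivity
    have hξ0 : 0 < ‖ξ‖ := norm_pos_iff.2 hξ
    set f : Space d → ℂ := fun x => Complex.exp (-Complex.I * ((inner ℝ ξ x : ℝ) : ℂ)) with hf
    set g : Space d → ℂ := fun x => ((φ (t, x) : ℝ) : ℂ) with hg
    have hfd : ∀ x, HasFDerivAt f
        (f x • (-Complex.I) • (Complex.ofRealCLM ∘L (innerSL ℝ ξ))) x := by
      intro x
      exact ((Complex.ofRealCLM.hasFDerivAt.comp x (innerSL ℝ ξ).hasFDerivAt).const_mul
        (-Complex.I)).cexp
    have hgd : ∀ x, HasFDerivAt g (Complex.ofRealCLM ∘L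
        ((fderiv ℝ φ (t, x)) ∘L (ContinuousLinearMap.inr ℝ ℝ (Space d)))) x := by
      intro x
      have e1 : HasFDerivAt (fun y : Space d => (t, y)) (ContinuousLinearMap.inr ℝ ℝ (Space d)) x :=
        hasFDerivAt_prodMk_right t x
      have e2 := (φ.contDiff.differentiable (by simp) (t, x)).hasFDerivAt
      exact Complex.ofRealCLM.hasFDerivAt.comp x (e2.comp x e1)
    have hfξ : ∀ x, fderiv ℝ f x ξ = (-Complex.I * (‖ξ‖ : ℂ) ^ 2) * f x := by
      intro x
      rw [(hfd x).fderiv]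
      simp [mul_comm, mul_left_comm]
    have hgξ : ∀ x, fderiv ℝ g x ξ = ((fderiv ℝ φ (t, x) (0, ξ) : ℝ) : ℂ) := by
      intro x
      rw [(hgd x).fderiv]
      simp
    have hfc : Continuous f := by fun_prop
    have hgc : Continuous g := by have := φ.continuous; fun_prop
    have hgs : HasCompactSupport g := HasCompactSupport.intro hQc fun x hx => by
      simp [hg, apply_eq_zero_of_notMem_image φ hx]
    have hg'c : Continuous fun x => fderiv ℝ g x ξ := by
      simp only [hgξ]; fun_prop
    have hg's : HasCompactSupport fun x => fderiv ℝ g x ξ := hgs.fderiv_apply (𝕜 := ℝ) ξ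
    -- Differentiating along ξ itself multiplies the exponential by -i‖ξ‖² and costs at most C₁‖ξ‖
    -- on the test function, a net gain of one power of ‖ξ‖.
    have hparts := integral_mul_fderiv_eq_neg_fderiv_mul_of_integrable (μ := volume) (f := f) (g := g)
      (v := ξ)
      (by
        simp only [hfξ]
        exact Continuous.integrable_of_hasCompactSupport (by fun_prop) hgs.mul_left)
      (Continuous.integrable_of_hasCompactSupport (by fun_prop) hg's.mul_left)
      (Continuous.integrable_of_hasCompactSupport (by fun_prop) hgs.mul_left)
      (fun x _ => (hfd x).differentiableAt) (fun x _ => (hgd x).differentiableAt)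
    have hrhs : ∫ x, fderiv ℝ f x ξ * g x = (-Complex.I * (‖ξ‖ : ℂ) ^ 2) * spaceFourier φ t ξ := by
      rw [spaceFourier, ← integral_const_mul]
      refine integral_congr_ae (ae_of_all _ fun x => ?_)
      show fderiv ℝ f x ξ * g x = (-Complex.I * (‖ξ‖ : ℂ) ^ 2) * (f x * g x)
      rw [hfξ, mul_assoc]
    have hlhs : ‖∫ x, f x * fderiv ℝ g x ξ‖ ≤ C₁ * ‖ξ‖ * m := by
      rw [← setIntegral_eq_integral_of_forall_compl_eq_zero (s := Q)]
      · refine norm_setIntegral_le_of_norm_le_const hQc.measure_lt_top fun x _ => ?_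
        rw [norm_mul, norm_exp_neg_I_mul_ofReal, one_mul, hgξ, Complex.norm_real]
        refine ((fderiv ℝ φ (t, x)).le_opNorm _).trans ?_
        have e3 : ‖((0 : ℝ), ξ)‖ = ‖ξ‖ := by simp [Prod.norm_def]
        rw [e3]
        gcongr
        exact hC₁ _
      · intro x hx
        have e4 : fderiv ℝ φ (t, x) = 0 := by
          have : (t, x) ∉ tsupport (fderiv ℝ φ) := fun h =>
            hx ⟨(t, x), tsupport_fderiv_subset ℝ h, rfl⟩
          exact image_eq_zero_of_notMem_tsupport this
        simp [hgξ, e4]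
    rw [hparts, hrhs, norm_neg, norm_mul, norm_mul, norm_neg, Complex.norm_I, one_mul, norm_pow,
      Complex.norm_real, norm_norm] at hlhs
    have e5 : ‖ξ‖ * (‖spaceFourier φ t ξ‖ * ‖ξ‖) ≤ ‖ξ‖ * (C₁ * m) := by nlinarith
    exact le_of_mul_le_mul_left e5 hξ0
  refine ⟨C₀ * m + C₁ * m, by positivity, fun t ξ => ?_⟩
  rw [mul_add, mul_one]
  exact add_le_add (h0 t ξ) (h1 t ξ)

end TestFunctions

/-! ### Second moments of the noise -/

section Noise

variable {d : ℕ} {μ : Measure (Space d)} {q : ℝ}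

theorem one_add_rpow_le {q r : ℝ} (hq : 0 < q) (hr : 0 ≤ r) : 1 + r ^ q ≤ 2 * (1 + r) ^ q := by
  have h1 : (1 : ℝ) ≤ (1 + r) ^ q := Real.one_le_rpow (by linarith) hq.le
  have h2 : r ^ q ≤ (1 + r) ^ q := by gcongr; linarith
  linarith

/-- Needed for σ-finiteness of μ, hence for Tonelli's theorem in (t,ξ). -/
theorem isLocallyFiniteMeasure_of_spectral (hq : 0 < q)
    (hμ : ∫⁻ ξ : Space d, ENNReal.ofReal (1 / (1 + ‖ξ‖ ^ q)) ∂μ < ⊤) :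
    IsLocallyFiniteMeasure μ := by
  refine ⟨fun x => ⟨Metric.ball 0 (‖x‖ + 1), Metric.isOpen_ball.mem_nhds (by simp), ?_⟩⟩
  set R := ‖x‖ + 1 with hR
  have hR0 : 0 < R := by positivity
  have hle : ENNReal.ofReal (1 / (1 + R ^ q)) * μ (Metric.ball 0 R)
      ≤ ∫⁻ ξ : Space d, ENNReal.ofReal (1 / (1 + ‖ξ‖ ^ q)) ∂μ := by
    rw [← setLIntegral_const]
    refine (setLIntegral_mono' measurableSet_ball fun ξ hξ => ?_).trans (setLIntegral_le_lintegral _ _)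
    have : ‖ξ‖ ≤ R := (mem_ball_zero_iff.1 hξ).le
    gcongr
  have hpos : ENNReal.ofReal (1 / (1 + R ^ q)) ≠ 0 := by
    simp only [ne_eq, ENNReal.ofReal_eq_zero, not_le]; positivity
  by_contra h
  rw [not_lt_top_iff.1 h, ENNReal.mul_top hpos, top_le_iff] at hle
  exact hμ.ne hle

theorem lintegral_one_add_norm_rpow_lt_top (hq : 0 < q)
    (hμ : ∫⁻ ξ : Space d, ENNReal.ofReal (1 / (1 + ‖ξ‖ ^ q)) ∂μ < ⊤) :
    ∫⁻ ξ : Space d, ENNReal.ofReal (((1 + ‖ξ‖) ^ q)⁻¹) ∂μ < ⊤ := by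
  refine lt_of_le_of_lt (b := ∫⁻ ξ : Space d, ENNReal.ofReal 2 * ENNReal.ofReal (1 / (1 + ‖ξ‖ ^ q)) ∂μ) ?_ ?_
  · refine lintegral_mono fun ξ => ?_
    rw [← ENNReal.ofReal_mul (by norm_num)]
    apply ENNReal.ofReal_le_ofReal
    have h := one_add_rpow_le hq (norm_nonneg ξ)
    have h1 : 0 < (1 + ‖ξ‖) ^ q := by positivity
    have h2 : 0 < 1 + ‖ξ‖ ^ q := by positivity
    rw [mul_one_div, inv_le_iff_one_le_mul₀ h1, div_mul_eq_mul_div, le_div_iff₀ h2]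
    linarith
  · rw [lintegral_const_mul' _ _ ENNReal.ofReal_ne_top]
    exact ENNReal.mul_lt_top ENNReal.ofReal_lt_top hμ

/-- Turns the iterated covariance integral into one over a product measure, where sums may be split.
-/
theorem integrable_spaceFourier_mul [SFinite μ] (hq : 0 < q) (hq2 : q < 2)
    (hμ : ∫⁻ ξ : Space d, ENNReal.ofReal (1 / (1 + ‖ξ‖ ^ q)) ∂μ < ⊤) (φ ψ : NoiseTest d) :
    Integrable (fun p : ℝ × Space d =>
      spaceFourier φ p.1 p.2 * (starRingEnd ℂ) (spaceFourier ψ p.1 p.2))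
      ((volume.restrict (Ioi 0)).prod μ) := by
  obtain ⟨C₁, hC₁0, hC₁⟩ := exists_norm_spaceFourier_le φ
  obtain ⟨C₂, hC₂0, hC₂⟩ := exists_norm_spaceFourier_le ψ
  obtain ⟨A, hA0, hA⟩ := exists_spaceFourier_eq_zero φ
  have hc1 := continuous_spaceFourier φ
  have hc2 := continuous_spaceFourier ψ
  have hi1 : Integrable (fun ξ : Space d => ((1 + ‖ξ‖) ^ q)⁻¹) μ := by
    refine ⟨Measurable.aestronglyMeasurable (by fun_prop), ?_⟩
    rw [hasFiniteIntegral_iff_ofReal (ae_of_all _ fun ξ => by positivity)]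
    exact lintegral_one_add_norm_rpow_lt_top hq hμ
  have hi2 : Integrable ((Icc (0 : ℝ) A).indicator fun _ => C₁ * C₂) (volume.restrict (Ioi 0)) :=
    ((integrableOn_const (by simp)).integrable_indicator measurableSet_Icc).restrict
  refine (hi2.mul_prod hi1).mono' (Continuous.aestronglyMeasurable (by fun_prop)) ?_
  have hmem : ∀ᵐ p ∂((volume.restrict (Ioi (0 : ℝ))).prod μ), p.1 ∈ Ioi (0 : ℝ) :=
    Measure.quasiMeasurePreserving_fst.ae (ae_restrict_mem measurableSet_Ioi)
  filter_upwards [hmem] with ⟨t, ξ⟩ ht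
  have ht0 : 0 < t := ht
  rw [norm_mul, RCLike.norm_conj]
  by_cases htA : t ≤ A
  · have hin : t ∈ Icc 0 A := ⟨ht0.le, htA⟩
    rw [indicator_of_mem hin]
    have h1 := hC₁ t ξ
    have h2 := hC₂ t ξ
    have hp : 0 < 1 + ‖ξ‖ := by positivity
    have hpq : (1 + ‖ξ‖) ^ q ≤ (1 + ‖ξ‖) ^ 2 := by
      rw [← Real.rpow_two]
      exact Real.rpow_le_rpow_of_exponent_le (by linarith [norm_nonneg ξ]) hq2.le
    have hpq0 : 0 < (1 + ‖ξ‖) ^ q := by positivity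
    rw [← div_eq_mul_inv, le_div_iff₀ hpq0]
    calc ‖spaceFourier φ t ξ‖ * ‖spaceFourier ψ t ξ‖ * (1 + ‖ξ‖) ^ q
        ≤ ‖spaceFourier φ t ξ‖ * ‖spaceFourier ψ t ξ‖ * (1 + ‖ξ‖) ^ 2 := by gcongr
      _ = (‖spaceFourier φ t ξ‖ * (1 + ‖ξ‖)) * (‖spaceFourier ψ t ξ‖ * (1 + ‖ξ‖)) := by ring
      _ ≤ C₁ * C₂ := by gcongr
  · rw [hA t (not_le.1 htA), norm_zero, zero_mul]
    apply mul_nonneg _ (by positivity)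
    apply indicator_nonneg
    intro _ _; positivity

variable {Ω : Type*} [MeasurableSpace Ω] {P : Measure Ω} {W : NoiseTest d → Ω → ℝ}

theorem integral_sub_sub_sub {α F : Type*} [MeasurableSpace α] {ν : Measure α}
    [NormedAddCommGroup F] [NormedSpace ℝ F] {f g h k : α → F} (hf : Integrable f ν)
    (hg : Integrable g ν) (hh : Integrable h ν) (hk : Integrable k ν) :
    ∫ x, ((f x - g x) - (h x - k x)) ∂ν
      = (∫ x, f x ∂ν - ∫ x, g x ∂ν) - (∫ x, h x ∂ν - ∫ x, k x ∂ν) :=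
  (integral_sub (hf.sub hg) (hh.sub hk)).trans (by rw [integral_sub' hf hg, integral_sub' hh hk])

/-- The isometry for differences. Linearity of W is not part of its definition, so the square is
expanded into four covariances on each side. -/
theorem lintegral_enorm_noise_sub_sq [SFinite μ]
    (hW : IsHomogeneousNoise P μ W) (hq : 0 < q) (hq2 : q < 2)
    (hμ : ∫⁻ ξ : Space d, ENNReal.ofReal (1 / (1 + ‖ξ‖ ^ q)) ∂μ < ⊤) (φ ψ : NoiseTest d) :
    ∫⁻ ω, ‖W φ ω - W ψ ω‖ₑ ^ 2 ∂P
      = ∫⁻ t in Ioi (0 : ℝ), ∫⁻ ξ, ‖spaceFourier φ t ξ - spaceFourier ψ t ξ‖ₑ ^ 2 ∂μ := by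
  have hL : ∀ φ, MemLp (W φ) 2 P := fun φ => (hW.gaussian.hasGaussianLaw_eval φ).memLp_two
  have hWi : ∀ φ ψ, Integrable (fun ω => W φ ω * W ψ ω) P := fun φ ψ => (hL φ).integrable_mul (hL ψ)
  set ν := (volume.restrict (Ioi (0 : ℝ))).prod μ with hν
  have hI := integrable_spaceFourier_mul (μ := μ) hq hq2 hμ
  have hcov : ∀ φ ψ, (((∫ ω, W φ ω * W ψ ω ∂P : ℝ)) : ℂ)
      = ∫ p, spaceFourier φ p.1 p.2 * (starRingEnd ℂ) (spaceFourier ψ p.1 p.2) ∂ν := fun φ ψ => by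
    rw [hW.covariance, integral_prod _ (hI φ ψ)]
  have hc1 := continuous_spaceFourier φ
  have hc2 := continuous_spaceFourier ψ
  have hsq : ∀ p : ℝ × Space d,
      ((‖spaceFourier φ p.1 p.2 - spaceFourier ψ p.1 p.2‖ ^ 2 : ℝ) : ℂ)
      = (spaceFourier φ p.1 p.2 * (starRingEnd ℂ) (spaceFourier φ p.1 p.2)
        - spaceFourier φ p.1 p.2 * (starRingEnd ℂ) (spaceFourier ψ p.1 p.2))
        - (spaceFourier ψ p.1 p.2 * (starRingEnd ℂ) (spaceFourier φ p.1 p.2)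
        - spaceFourier ψ p.1 p.2 * (starRingEnd ℂ) (spaceFourier ψ p.1 p.2)) := by
    intro p
    push_cast
    rw [← Complex.mul_conj', map_sub]
    ring
  have hint : Integrable (fun p : ℝ × Space d =>
      ((‖spaceFourier φ p.1 p.2 - spaceFourier ψ p.1 p.2‖ ^ 2 : ℝ) : ℂ)) ν := by
    simp only [hsq]
    exact ((hI φ φ).sub (hI φ ψ)).sub ((hI ψ φ).sub (hI ψ ψ))
  have hint' : Integrable (fun p : ℝ × Space d =>
      ‖spaceFourier φ p.1 p.2 - spaceFourier ψ p.1 p.2‖ ^ 2) ν := by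
    exact hint.re.congr (ae_of_all _ fun p => Complex.ofReal_re _)
  have hkey : ∫ ω, (W φ ω - W ψ ω) ^ 2 ∂P
      = ∫ p, ‖spaceFourier φ p.1 p.2 - spaceFourier ψ p.1 p.2‖ ^ 2 ∂ν := by
    have h1 : (((∫ ω, (W φ ω - W ψ ω) ^ 2 ∂P : ℝ)) : ℂ)
        = ((∫ p, ‖spaceFourier φ p.1 p.2 - spaceFourier ψ p.1 p.2‖ ^ 2 ∂ν : ℝ) : ℂ) := by
      rw [← integral_complex_ofReal
        (μ := ν) (f := fun p : ℝ × Space d => ‖spaceFourier φ p.1 p.2 - spaceFourier ψ p.1 p.2‖ ^ 2)]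
      simp only [hsq]
      rw [integral_sub_sub_sub (hI φ φ) (hI φ ψ) (hI ψ φ) (hI ψ ψ), ← hcov, ← hcov, ← hcov, ← hcov]
      have h2 : ∀ ω, (W φ ω - W ψ ω) ^ 2 = (W φ ω * W φ ω - W φ ω * W ψ ω)
          - (W ψ ω * W φ ω - W ψ ω * W ψ ω) := fun ω => by ring
      simp only [h2]
      rw [integral_sub_sub_sub (hWi φ φ) (hWi φ ψ) (hWi ψ φ) (hWi ψ ψ)]
      push_cast
      ring
    exact_mod_cast h1
  have e1 : ∀ ω, ‖W φ ω - W ψ ω‖ₑ ^ 2 = ENNReal.ofReal ((W φ ω - W ψ ω) ^ 2) := fun ω => by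
    rw [Real.enorm_eq_ofReal_abs, ← ENNReal.ofReal_pow (abs_nonneg _), sq_abs]
  have e2 : ∀ z : ℂ, ‖z‖ₑ ^ 2 = ENNReal.ofReal (‖z‖ ^ 2) := fun z => by
    rw [← ofReal_norm, ENNReal.ofReal_pow (norm_nonneg _)]
  simp only [e1, e2]
  have hWs : Integrable (fun ω => (W φ ω - W ψ ω) ^ 2) P := ((hL φ).sub (hL ψ)).integrable_sq
  rw [← ofReal_integral_eq_lintegral_ofReal hWs (ae_of_all _ fun ω => sq_nonneg _), hkey,
    ofReal_integral_eq_lintegral_ofReal hint' (ae_of_all _ fun p => by positivity),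
    lintegral_prod _ (by fun_prop)]

/-- A centred Gaussian variable is its standard deviation times a standard one in law, so c is the
k-th absolute moment of the standard normal law, the same for all X. -/
theorem exists_gaussian_moment_bound (k : ℕ) : ∃ c : ℝ≥0, ∀ (X : Ω → ℝ), HasGaussianLaw X P →
    ∫ ω, X ω ∂P = 0 → ∀ σ : ℝ, 0 ≤ σ → ∫⁻ ω, ‖X ω‖ₑ ^ 2 ∂P ≤ ENNReal.ofReal (σ ^ 2) →
    ∫⁻ ω, ‖X ω‖ₑ ^ k ∂P ≤ c * ENNReal.ofReal σ ^ k := by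
  have hfin : ∫⁻ x, ‖x‖ₑ ^ k ∂(gaussianReal 0 1) < ⊤ := by
    have := (memLp_id_gaussianReal (μ := 0) (v := 1) k).integrable_norm_pow'
    have h := this.2
    rw [hasFiniteIntegral_iff_enorm] at h
    simpa [enorm_pow] using h
  refine ⟨(∫⁻ x, ‖x‖ₑ ^ k ∂(gaussianReal 0 1)).toNNReal, fun X hX h0 σ hσ hle => ?_⟩
  rw [ENNReal.coe_toNNReal hfin.ne]
  have hm := hX.aemeasurable
  have hP := hX.isProbabilityMeasure
  set s : ℝ := √(Var[X; P]) with hs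
  have hvar : Var[X; P] ≤ σ ^ 2 := by
    rw [variance_of_integral_eq_zero hm h0]
    have h1 : ∫ ω, X ω ^ 2 ∂P = (∫⁻ ω, ENNReal.ofReal (X ω ^ 2) ∂P).toReal :=
      integral_eq_lintegral_of_nonneg_ae (ae_of_all _ fun ω => sq_nonneg _)
        (hm.pow_const 2).aestronglyMeasurable
    have h2 : ∀ ω, ENNReal.ofReal (X ω ^ 2) = ‖X ω‖ₑ ^ 2 := fun ω => by
      rw [Real.enorm_eq_ofReal_abs, ← ENNReal.ofReal_pow (abs_nonneg _), sq_abs]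
    simp only [h2] at h1
    rw [h1]
    exact ENNReal.toReal_le_of_le_ofReal (sq_nonneg _) hle
  have hsσ : s ≤ σ := (Real.sqrt_le_left hσ).2 hvar
  have hlaw : P.map X = (gaussianReal 0 1).map (fun x => s * x) := by
    rw [hX.map_eq_gaussianReal, h0, gaussianReal_map_const_mul]
    congr 1
    · simp
    · ext
      rw [mul_one]
      show ((Var[X; P]).toNNReal : ℝ) = s ^ 2
      rw [Real.coe_toNNReal _ (variance_nonneg _ _), hs, Real.sq_sqrt (variance_nonneg _ _)]
  have hmk : Measurable fun x : ℝ => ‖x‖ₑ ^ k := by fun_prop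
  calc ∫⁻ ω, ‖X ω‖ₑ ^ k ∂P = ∫⁻ x, ‖x‖ₑ ^ k ∂(P.map X) :=
        (lintegral_map' hmk.aemeasurable hm).symm
    _ = ∫⁻ x, ‖s * x‖ₑ ^ k ∂(gaussianReal 0 1) := by
        rw [hlaw, lintegral_map hmk (by fun_prop)]
    _ = ‖s‖ₑ ^ k * ∫⁻ x, ‖x‖ₑ ^ k ∂(gaussianReal 0 1) := by
        simp only [enorm_mul, mul_pow]
        rw [lintegral_const_mul _ hmk]
    _ ≤ _ := by
        rw [mul_comm]
        gcongr
        rw [Real.enorm_eq_ofReal_abs, abs_of_nonneg (Real.sqrt_nonneg _)]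
        exact ENNReal.ofReal_le_ofReal hsσ

end Noise

/-! ### Wiener integrals -/

theorem enorm_sub_sq_le_three {F : Type*} [NormedAddCommGroup F] (a b g g' : F) :
    ‖a - b‖ₑ ^ 2 ≤ 3 * (‖a - g‖ₑ ^ 2 + ‖g - g'‖ₑ ^ 2 + ‖b - g'‖ₑ ^ 2) := by
  have h1 : ‖a - b‖ ≤ ‖a - g‖ + ‖g - g'‖ + ‖b - g'‖ := by
    have h := norm_add₃_le (a := a - g) (b := g - g') (c := g' - b)
    rw [norm_sub_rev g' b] at h
    simpa using h
  have h2 : ‖a - b‖ ^ 2 ≤ 3 * (‖a - g‖ ^ 2 + ‖g - g'‖ ^ 2 + ‖b - g'‖ ^ 2) := by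
    have h0 := norm_nonneg (a - b)
    nlinarith [sq_nonneg (‖a - g‖ - ‖g - g'‖), sq_nonneg (‖a - g‖ - ‖b - g'‖),
      sq_nonneg (‖g - g'‖ - ‖b - g'‖)]
  have e : ∀ z : F, ‖z‖ₑ ^ 2 = ENNReal.ofReal (‖z‖ ^ 2) := fun z => by
    rw [← ofReal_norm, ENNReal.ofReal_pow (norm_nonneg _)]
  rw [e, e, e, e, ← ENNReal.ofReal_add (by positivity) (by positivity),
    ← ENNReal.ofReal_add (by positivity) (by positivity), show (3 : ℝ≥0∞) = ENNReal.ofReal 3 by simp,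
    ← ENNReal.ofReal_mul (by norm_num)]
  exact ENNReal.ofReal_le_ofReal h2

section Wiener

variable {d : ℕ} {μ : Measure (Space d)} {q : ℝ} {Ω : Type*} [MeasurableSpace Ω] {P : Measure Ω}
  {W : NoiseTest d → Ω → ℝ}

/-- All moments of the difference of two Wiener integrals are controlled by the distance of the
integrands. -/
theorem exists_wiener_moment_bound [SFinite μ]
    (hW : IsHomogeneousNoise P μ W) (hq : 0 < q) (hq2 : q < 2)
    (hμ : ∫⁻ ξ : Space d, ENNReal.ofReal (1 / (1 + ‖ξ‖ ^ q)) ∂μ < ⊤) (k : ℕ) :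
    ∃ c : ℝ≥0, ∀ (g g' : ℝ → Space d → ℂ) (V V' : Ω → ℝ),
      Measurable (Function.uncurry g) → Measurable (Function.uncurry g') →
      IsWienerIntegral P μ W g V → IsWienerIntegral P μ W g' V' → ∀ σ : ℝ, 0 < σ →
      ∫⁻ s in Ioi (0 : ℝ), ∫⁻ ξ, ‖g s ξ - g' s ξ‖ₑ ^ 2 ∂μ ≤ ENNReal.ofReal (σ ^ 2) →
      ∫⁻ ω, ‖V ω - V' ω‖ₑ ^ k ∂P ≤ c * ENNReal.ofReal (2 * σ) ^ k := by
  obtain ⟨c, hc⟩ := exists_gaussian_moment_bound (P := P) k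
  refine ⟨c, fun g g' V V' hg hg' hV hV' σ hσ hle => ?_⟩
  obtain ⟨hVm, φ, hφ, hφV⟩ := hV
  obtain ⟨hVm', ψ, hψ, hψV⟩ := hV'
  set ν := (volume.restrict (Ioi (0 : ℝ))).prod μ with hν
  have hprod : ∀ (f f' : ℝ → Space d → ℂ), Measurable (Function.uncurry f) →
      Measurable (Function.uncurry f') →
      ∫⁻ s in Ioi (0 : ℝ), ∫⁻ ξ, ‖f s ξ - f' s ξ‖ₑ ^ 2 ∂μ
        = ∫⁻ p, ‖f p.1 p.2 - f' p.1 p.2‖ₑ ^ 2 ∂ν := fun f f' hf hf' => by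
    have h1 : Measurable fun p : ℝ × Space d => f p.1 p.2 := hf
    have h2 : Measurable fun p : ℝ × Space d => f' p.1 p.2 := hf'
    exact (lintegral_prod (fun p : ℝ × Space d => ‖f p.1 p.2 - f' p.1 p.2‖ₑ ^ 2)
      (by fun_prop)).symm
  have hsm : ∀ χ : NoiseTest d, Measurable (Function.uncurry (spaceFourier χ)) := fun χ =>
    (continuous_spaceFourier χ).measurable
  have hX2 : ∀ n, ∫⁻ ω, ‖W (φ n) ω - W (ψ n) ω‖ₑ ^ 2 ∂P
      ≤ 3 * ((∫⁻ s in Ioi (0 : ℝ), ∫⁻ ξ, ‖spaceFourier (φ n) s ξ - g s ξ‖ₑ ^ 2 ∂μ)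
        + ENNReal.ofReal (σ ^ 2)
        + ∫⁻ s in Ioi (0 : ℝ), ∫⁻ ξ, ‖spaceFourier (ψ n) s ξ - g' s ξ‖ₑ ^ 2 ∂μ) := by
    intro n
    refine le_trans ?_ (mul_le_mul_right (add_le_add_left (add_le_add_right hle _) _) _)
    rw [lintegral_enorm_noise_sub_sq hW hq hq2 hμ, hprod _ _ (hsm _) (hsm _),
      hprod _ _ (hsm _) hg, hprod _ _ (hsm _) hg', hprod _ _ hg hg']
    have m1 : Measurable fun p : ℝ × Space d => spaceFourier (φ n) p.1 p.2 := hsm _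
    have m2 : Measurable fun p : ℝ × Space d => spaceFourier (ψ n) p.1 p.2 := hsm _
    have m3 : Measurable fun p : ℝ × Space d => g p.1 p.2 := hg
    have m4 : Measurable fun p : ℝ × Space d => g' p.1 p.2 := hg'
    rw [← lintegral_add_left (by fun_prop), ← lintegral_add_left (by fun_prop),
      ← lintegral_const_mul _ (by fun_prop)]
    exact lintegral_mono fun p => enorm_sub_sq_le_three _ _ _ _
  -- The limit of the bound is 3σ² < (2σ)², and σ > 0 leaves room for the approximation errors;
  -- hence the factor 2 in the statement.
  have hev : ∀ᶠ n in atTop, ∫⁻ ω, ‖W (φ n) ω - W (ψ n) ω‖ₑ ^ 2 ∂P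
      ≤ ENNReal.ofReal ((2 * σ) ^ 2) := by
    have h1 := (ENNReal.Tendsto.const_mul (a := 3) ((hφ.add_const (ENNReal.ofReal (σ ^ 2))).add hψ)
      (Or.inr (by norm_num)))
    rw [zero_add, add_zero] at h1
    have h2 : (3 : ℝ≥0∞) * ENNReal.ofReal (σ ^ 2) < ENNReal.ofReal ((2 * σ) ^ 2) := by
      rw [show (3 : ℝ≥0∞) = ENNReal.ofReal 3 by simp, ← ENNReal.ofReal_mul (by norm_num)]
      refine (ENNReal.ofReal_lt_ofReal_iff (by positivity)).2 ?_
      nlinarith [sq_pos_of_pos hσ]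
    filter_upwards [h1.eventually (gt_mem_nhds h2)] with n hn
    exact (hX2 n).trans hn.le
  have hL2 : Tendsto (fun n => ∫⁻ ω, ‖(W (φ n) ω - W (ψ n) ω) - (V ω - V' ω)‖ₑ ^ 2 ∂P)
      atTop (𝓝 0) := by
    have h1 := (ENNReal.Tendsto.const_mul (a := 3) ((hφV.add_const 0).add hψV)
      (Or.inr (by norm_num)))
    simp only [add_zero, mul_zero] at h1
    refine tendsto_of_tendsto_of_tendsto_of_le_of_le tendsto_const_nhds h1 (fun _ => zero_le)
      fun n => ?_
    have m1 := hW.measurable (φ n)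
    have m2 := hW.measurable (ψ n)
    dsimp only
    rw [← lintegral_add_left (by fun_prop), ← lintegral_const_mul _ (by fun_prop)]
    refine lintegral_mono fun ω => ?_
    have := enorm_sub_sq_le_three (W (φ n) ω - V ω) (W (ψ n) ω - V' ω) 0 0
    simp only [sub_zero, enorm_zero, ne_eq, OfNat.ofNat_ne_zero, not_false_eq_true, zero_pow,
      add_zero] at this
    convert this using 3
    ring
  have hXm : ∀ n, Measurable fun ω => W (φ n) ω - W (ψ n) ω := fun n =>
    (hW.measurable _).sub (hW.measurable _)
  have hmeas : TendstoInMeasure P (fun n ω => W (φ n) ω - W (ψ n) ω) atTop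
      (fun ω => V ω - V' ω) := by
    refine tendstoInMeasure_of_tendsto_eLpNorm (p := 2) (by norm_num)
      (fun n => (hXm n).aestronglyMeasurable) (hVm.sub hVm').aestronglyMeasurable ?_
    have h1 := (ENNReal.continuous_rpow_const (y := (1 / 2 : ℝ))).tendsto 0 |>.comp hL2
    rw [ENNReal.zero_rpow_of_pos (by norm_num)] at h1
    refine h1.congr fun n => ?_
    rw [eLpNorm_eq_lintegral_rpow_enorm_toReal (by norm_num) (by norm_num)]
    simp
  obtain ⟨ns, hns, hae⟩ := hmeas.exists_seq_tendsto_ae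
  -- Gaussianity is used for the approximants only; the moment bound passes to V - V' by Fatou's
  -- lemma along an almost surely convergent subsequence.
  calc ∫⁻ ω, ‖V ω - V' ω‖ₑ ^ k ∂P
      = ∫⁻ ω, liminf (fun i => ‖W (φ (ns i)) ω - W (ψ (ns i)) ω‖ₑ ^ k) atTop ∂P := by
        refine lintegral_congr_ae ?_
        filter_upwards [hae] with ω hω
        exact (((ENNReal.continuous_pow k).tendsto _).comp hω.enorm).liminf_eq.symm
    _ ≤ liminf (fun i => ∫⁻ ω, ‖W (φ (ns i)) ω - W (ψ (ns i)) ω‖ₑ ^ k ∂P) atTop :=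
        lintegral_liminf_le fun i => (hXm _).enorm.pow_const k
    _ ≤ c * ENNReal.ofReal (2 * σ) ^ k := by
        refine liminf_le_of_frequently_le' (Eventually.frequently ?_)
        filter_upwards [hns.tendsto_atTop.eventually hev] with i hi
        have hi1 : ∀ χ, Integrable (W χ) P := fun χ => (hW.gaussian.hasGaussianLaw_eval χ).integrable
        refine hc _ hW.gaussian.hasGaussianLaw_fun_sub ?_ (2 * σ) (by positivity) hi
        rw [integral_sub (hi1 _) (hi1 _), hW.centered, hW.centered, sub_zero]

end Wiener

/-! ### The stochastic convolution -/

/-- The Fourier transform of the wave kernel (up to reflection), expressed by the unit kernel. -/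
def waveFourier (d : ℕ) (τ : ℝ) (ξ : Space d) : ℂ :=
  τ * measureFourier (waveKernel d 1) (-(τ • ξ))

theorem norm_measureFourier_sub_le {d : ℕ} (ν : Measure (Space d)) [IsProbabilityMeasure ν]
    (hν : ∀ᵐ z ∂ν, ‖z‖ ≤ 1) (ξ ξ' : Space d) :
    ‖measureFourier ν ξ - measureFourier ν ξ'‖ ≤ ‖ξ - ξ'‖ := by
  have hi : ∀ ξ : Space d, Integrable
      (fun y => Complex.exp (-Complex.I * ((inner ℝ ξ y : ℝ) : ℂ))) ν := fun ξ =>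
    Integrable.of_bound (Continuous.aestronglyMeasurable (by fun_prop)) 1
      (ae_of_all _ fun y => (norm_exp_neg_I_mul_ofReal _).le)
  rw [measureFourier, measureFourier, ← integral_sub (hi ξ) (hi ξ')]
  have hb : ∀ᵐ y ∂ν, ‖Complex.exp (-Complex.I * ((inner ℝ ξ y : ℝ) : ℂ)) -
      Complex.exp (-Complex.I * ((inner ℝ ξ' y : ℝ) : ℂ))‖ ≤ ‖ξ - ξ'‖ := by
    filter_upwards [hν] with y hy
    refine (norm_exp_neg_I_mul_sub_le _ _).trans ?_
    rw [← inner_sub_left]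
    exact (abs_real_inner_le_norm _ _).trans (mul_le_of_le_one_right (norm_nonneg _) hy)
  simpa using norm_integral_le_of_norm_le_const hb

section WaveFourier

variable {d : ℕ}

theorem continuous_measureFourier_waveKernel_one (hd : d = 1 ∨ d = 2 ∨ d = 3) :
    Continuous (measureFourier (waveKernel d 1)) := by
  have := isProbabilityMeasure_waveKernel_one hd
  refine (LipschitzWith.of_dist_le_mul (K := 1) fun ξ ξ' => ?_).continuous
  rw [dist_eq_norm, dist_eq_norm, NNReal.coe_one, one_mul]
  exact norm_measureFourier_sub_le _ (ae_norm_le_waveKernel_one hd) ξ ξ'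

theorem continuous_waveFourier (hd : d = 1 ∨ d = 2 ∨ d = 3) : Continuous (Function.uncurry (waveFourier d)) := by
  have := continuous_measureFourier_waveKernel_one hd
  show Continuous fun p : ℝ × Space d => (p.1 : ℂ) * measureFourier (waveKernel d 1) (-(p.1 • p.2))
  fun_prop

/-- The kernel vanishes at time 0, so the cutoff s ≤ t can be replaced by the positive part of t -
s, which is Lipschitz in t. The reflection y ↦ x - y produces the phase and the sign in
`waveFourier`. -/
theorem kernelFourier_eq (hd : d = 1 ∨ d = 2 ∨ d = 3) (t : ℝ) (x : Space d) (s : ℝ) (ξ : Space d) :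
    kernelFourier d t x s ξ = Complex.exp (-Complex.I * ((inner ℝ ξ x : ℝ) : ℂ)) *
      waveFourier d (max (t - s) 0) ξ := by
  rw [kernelFourier]
  rcases le_or_gt t s with h | h
  · rw [max_eq_right (by linarith), waveKernel_of_nonpos hd (by linarith)]
    simp [waveFourier, measureFourier]
  · have h0 : 0 < t - s := by linarith
    rw [if_pos h.le, max_eq_left h0.le, waveKernel_eq_map hd h0, waveFourier, measureFourier,
      integral_map (Measurable.aemeasurable (by fun_prop))
        (Continuous.aestronglyMeasurable (by fun_prop)),
      integral_smul_measure, (measurableEmbedding_const_smul₀ h0.ne').integral_map,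
      ENNReal.toReal_ofReal h0.le, measureFourier, Complex.real_smul, ← integral_const_mul,
      ← integral_const_mul, ← integral_const_mul]
    refine integral_congr_ae (ae_of_all _ fun y => ?_)
    simp only
    rw [mul_left_comm, ← Complex.exp_add, inner_sub_right, inner_smul_right, inner_neg_left,
      inner_smul_left]
    congr 2
    simp only [conj_trivial]
    push_cast
    ring

theorem measurable_kernelFourier (hd : d = 1 ∨ d = 2 ∨ d = 3) (t : ℝ) (x : Space d) :
    Measurable (Function.uncurry (kernelFourier d t x)) := by
  have h := continuous_waveFourier hd
  have h' : Continuous fun p : ℝ × Space d => waveFourier d (max (t - p.1) 0) p.2 :=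
    h.comp (f := fun p : ℝ × Space d => (max (t - p.1) 0, p.2)) (by fun_prop)
  have : Function.uncurry (kernelFourier d t x) = fun p : ℝ × Space d =>
      Complex.exp (-Complex.I * ((inner ℝ p.2 x : ℝ) : ℂ)) *
        waveFourier d (max (t - p.1) 0) p.2 := by
    ext p; exact kernelFourier_eq hd t x p.1 p.2
  rw [this]
  exact Continuous.measurable (by fun_prop)

/-- The factor τ cancels the one in the decay of the unit kernel at τξ, so the bound is uniform down
to τ = 0. -/
theorem norm_waveFourier_mul_le (hd : d = 1 ∨ d = 2 ∨ d = 3) {T τ : ℝ} (hτ : τ ∈ Icc 0 T) (ξ : Space d) :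
    ‖waveFourier d τ ξ‖ * (1 + ‖ξ‖) ≤ T + 1 := by
  have := isProbabilityMeasure_waveKernel_one hd
  have h1 := norm_measureFourier_le (waveKernel d 1) (-(τ • ξ))
  have h2 := norm_measureFourier_waveKernel_one_mul_le hd (-(τ • ξ))
  rw [norm_neg, norm_smul, Real.norm_of_nonneg hτ.1] at h2
  rw [waveFourier, norm_mul, Complex.norm_real, Real.norm_of_nonneg hτ.1]
  nlinarith [hτ.1, hτ.2]

theorem norm_waveFourier_sub_le (hd : d = 1 ∨ d = 2 ∨ d = 3) {T τ τ' : ℝ} (hτ' : τ' ∈ Icc 0 T)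
    (ξ : Space d) : ‖waveFourier d τ ξ - waveFourier d τ' ξ‖ ≤ (1 + T * ‖ξ‖) * |τ - τ'| := by
  have := isProbabilityMeasure_waveKernel_one hd
  have h1 := norm_measureFourier_le (waveKernel d 1) (-(τ • ξ))
  have h2 := norm_measureFourier_sub_le _ (ae_norm_le_waveKernel_one hd) (-(τ • ξ)) (-(τ' • ξ))
  rw [show -(τ • ξ) - -(τ' • ξ) = (-(τ - τ')) • ξ by module, norm_smul, norm_neg,
    Real.norm_eq_abs] at h2
  have e : waveFourier d τ ξ - waveFourier d τ' ξ
      = ((τ - τ' : ℝ) : ℂ) * measureFourier (waveKernel d 1) (-(τ • ξ))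
      + (τ' : ℂ) * (measureFourier (waveKernel d 1) (-(τ • ξ)) -
        measureFourier (waveKernel d 1) (-(τ' • ξ))) := by
    simp only [waveFourier]; push_cast; ring
  rw [e]
  refine (norm_add_le _ _).trans ?_
  rw [norm_mul, norm_mul, Complex.norm_real, Complex.norm_real, Real.norm_eq_abs,
    Real.norm_of_nonneg hτ'.1]
  calc _ ≤ |τ - τ'| * 1 + T * (|τ - τ'| * ‖ξ‖) := by
        gcongr
        · exact hτ'.1.trans hτ'.2
        · exact hτ'.2
    _ = _ := by ring

/-- With r = 1 + ‖ξ‖, the increment D satisfies D ≤ M/r (decay) and D ≤ M r δ (Lipschitz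
dependence). The geometric mean with weights 1 - ε and ε trades decay in ξ for a power of δ. -/
theorem norm_kernelFourier_sub_sq_le (hd : d = 1 ∨ d = 2 ∨ d = 3) {T q : ℝ} (hq : 0 < q)
    (hq2 : q < 2)
    {t t' : ℝ} (ht : t ∈ Icc 0 T) (ht' : t' ∈ Icc 0 T) (x x' : Space d) {δ : ℝ} (hδ0 : 0 < δ)
    (hδ : |t - t'| ≤ δ) (hδ' : ‖x - x'‖ ≤ δ) {s : ℝ} (hs : 0 < s) (ξ : Space d) :
    ‖kernelFourier d t x s ξ - kernelFourier d t' x' s ξ‖ ^ 2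
      ≤ (2 * (T + 1)) ^ 2 * (δ ^ ((2 - q) / 4)) ^ 2 * ((1 + ‖ξ‖) ^ q)⁻¹ := by
  rw [kernelFourier_eq hd, kernelFourier_eq hd]
  set τ := max (t - s) 0 with hτ
  set τ' := max (t' - s) 0 with hτ'
  set r := 1 + ‖ξ‖ with hr
  have hr0 : 0 < r := by positivity
  have hT : 0 ≤ T := ht.1.trans ht.2
  have hm : τ ∈ Icc 0 T := ⟨le_max_right _ _, max_le (by linarith [ht.2]) hT⟩
  have hm' : τ' ∈ Icc 0 T := ⟨le_max_right _ _, max_le (by linarith [ht'.2]) hT⟩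
  have hττ : |τ - τ'| ≤ δ := by
    refine (abs_max_sub_max_le_abs _ _ _).trans ?_
    simpa using hδ
  set e := Complex.exp (-Complex.I * ((inner ℝ ξ x : ℝ) : ℂ)) with he
  set e' := Complex.exp (-Complex.I * ((inner ℝ ξ x' : ℝ) : ℂ)) with he'
  have hen : ‖e‖ = 1 := norm_exp_neg_I_mul_ofReal _
  have hen' : ‖e'‖ = 1 := norm_exp_neg_I_mul_ofReal _
  have hee : ‖e - e'‖ ≤ ‖ξ‖ * δ := by
    refine (norm_exp_neg_I_mul_sub_le _ _).trans ?_
    rw [← inner_sub_right]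
    exact (abs_real_inner_le_norm _ _).trans (by gcongr)
  set D := ‖e * waveFourier d τ ξ - e' * waveFourier d τ' ξ‖ with hD
  have hD0 : 0 ≤ D := norm_nonneg _
  have b1 := norm_waveFourier_mul_le hd hm ξ
  have b2 := norm_waveFourier_mul_le hd hm' ξ
  set M := 2 * (T + 1) with hM
  have hM0 : 0 ≤ M := by positivity
  have hA : D * r ≤ M := by
    have : D ≤ ‖waveFourier d τ ξ‖ + ‖waveFourier d τ' ξ‖ := by
      refine (norm_sub_le _ _).trans ?_
      rw [norm_mul, norm_mul, hen, hen', one_mul, one_mul]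
    calc D * r ≤ (‖waveFourier d τ ξ‖ + ‖waveFourier d τ' ξ‖) * r := by gcongr
      _ ≤ M := by rw [add_mul]; linarith
  have hB : D ≤ M * r * δ := by
    have h1 : D ≤ ‖e - e'‖ * ‖waveFourier d τ' ξ‖
        + ‖waveFourier d τ ξ - waveFourier d τ' ξ‖ := by
      rw [hD, show e * waveFourier d τ ξ - e' * waveFourier d τ' ξ
        = (e - e') * waveFourier d τ' ξ + e * (waveFourier d τ ξ - waveFourier d τ' ξ) by ring]
      refine (norm_add_le _ _).trans ?_
      rw [norm_mul, norm_mul, hen, one_mul]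
    have h2 : ‖waveFourier d τ' ξ‖ ≤ T + 1 := by
      refine le_trans ?_ b2
      exact le_mul_of_one_le_right (norm_nonneg _) (by linarith [norm_nonneg ξ])
    have h3 := norm_waveFourier_sub_le hd (τ := τ) hm' ξ
    calc D ≤ ‖ξ‖ * δ * (T + 1) + (1 + T * ‖ξ‖) * δ := by
          refine h1.trans ?_
          gcongr
          exact h3.trans (by gcongr)
      _ ≤ M * r * δ := by
          have := norm_nonneg ξ
          have : ‖ξ‖ * (T + 1) + (1 + T * ‖ξ‖) ≤ M * r := by rw [hM, hr]; nlinarith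
          nlinarith
  -- Chosen so that 2(-1 + 2ε) = -q.
  set ε := (2 - q) / 4 with hε
  have hε0 : 0 < ε := by rw [hε]; linarith
  have hε1 : ε ≤ 1 := by rw [hε]; linarith
  have hDle : D ≤ M * δ ^ ε * r ^ (-1 + 2 * ε) := by
    have h1 : D ≤ M * r⁻¹ := by rw [← div_eq_mul_inv, le_div_iff₀ hr0]; exact hA
    have hsplit : D = D ^ (1 - ε) * D ^ ε := by
      rcases hD0.eq_or_lt with h0 | h0
      · rw [← h0, Real.zero_rpow hε0.ne', mul_zero]
      · rw [← Real.rpow_add h0]; simp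
    calc D = D ^ (1 - ε) * D ^ ε := hsplit
      _ ≤ (M * r⁻¹) ^ (1 - ε) * (M * r * δ) ^ ε := by
          gcongr
      _ = M * δ ^ ε * r ^ (-1 + 2 * ε) := by
          rw [Real.mul_rpow hM0 (by positivity), Real.mul_rpow (by positivity) hδ0.le,
            Real.mul_rpow hM0 hr0.le, Real.inv_rpow hr0.le, ← Real.rpow_neg hr0.le]
          have e1 : M ^ (1 - ε) * M ^ ε = M := by
            rw [← Real.rpow_add (by positivity)]; simp
          have e2 : r ^ (-(1 - ε)) * r ^ ε = r ^ (-1 + 2 * ε) := by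
            rw [← Real.rpow_add hr0]; congr 1; ring
          calc _ = (M ^ (1 - ε) * M ^ ε) * δ ^ ε * (r ^ (-(1 - ε)) * r ^ ε) := by ring
            _ = _ := by rw [e1, e2]
  calc D ^ 2 ≤ (M * δ ^ ε * r ^ (-1 + 2 * ε)) ^ 2 := by gcongr
    _ = M ^ 2 * (δ ^ ε) ^ 2 * (r ^ q)⁻¹ := by
        rw [mul_pow, mul_pow, ← Real.rpow_natCast (r ^ (-1 + 2 * ε)), ← Real.rpow_mul hr0.le,
          ← Real.rpow_neg hr0.le]
        congr 2
        rw [hε]; push_cast; ring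


theorem lintegral_kernelFourier_sub_le (hd : d = 1 ∨ d = 2 ∨ d = 3) {μ : Measure (Space d)}
    {T q : ℝ} (hq : 0 < q) (hq2 : q < 2)
    {t t' : ℝ} (ht : t ∈ Icc 0 T) (ht' : t' ∈ Icc 0 T) (x x' : Space d) {δ : ℝ} (hδ0 : 0 < δ)
    (hδ : |t - t'| ≤ δ) (hδ' : ‖x - x'‖ ≤ δ) :
    ∫⁻ s in Ioi (0 : ℝ), ∫⁻ ξ, ‖kernelFourier d t x s ξ - kernelFourier d t' x' s ξ‖ₑ ^ 2 ∂μ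
      ≤ ENNReal.ofReal ((2 * (T + 1)) ^ 2 * (δ ^ ((2 - q) / 4)) ^ 2) *
        (∫⁻ ξ : Space d, ENNReal.ofReal (((1 + ‖ξ‖) ^ q)⁻¹) ∂μ) * ENNReal.ofReal T := by
  set M := ENNReal.ofReal ((2 * (T + 1)) ^ 2 * (δ ^ ((2 - q) / 4)) ^ 2) with hM
  set I := ∫⁻ ξ : Space d, ENNReal.ofReal (((1 + ‖ξ‖) ^ q)⁻¹) ∂μ with hI
  calc _ ≤ ∫⁻ s in Ioi (0 : ℝ), (Iic T).indicator (fun _ => M * I) s := by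
        refine setLIntegral_mono' measurableSet_Ioi fun s hs => ?_
        by_cases hsT : s ≤ T
        · rw [indicator_of_mem (mem_Iic.2 hsT), hI, ← lintegral_const_mul _ (by fun_prop)]
          refine lintegral_mono fun ξ => ?_
          rw [hM, ← ENNReal.ofReal_mul (by positivity), ← ofReal_norm,
            ← ENNReal.ofReal_pow (norm_nonneg _)]
          exact ENNReal.ofReal_le_ofReal
            (norm_kernelFourier_sub_sq_le hd hq hq2 ht ht' x x' hδ0 hδ hδ' hs ξ)
        · have h1 : ¬ s ≤ t := fun h => hsT (h.trans ht.2)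
          have h2 : ¬ s ≤ t' := fun h => hsT (h.trans ht'.2)
          simp [kernelFourier, h1, h2]
    _ = _ := by
        rw [setLIntegral_indicator measurableSet_Iic, setLIntegral_const, Iic_inter_Ioi,
          Real.volume_Ioc, sub_zero]

end WaveFourier

/-- The stochastic convolution of the noise with the wave kernel has a continuous version. -/
theorem exists_continuous_stochasticConvolution {d : ℕ} (hd : d = 1 ∨ d = 2 ∨ d = 3) {T : ℝ}
    (hT : 0 ≤ T) {μ : Measure (Space d)} {q : ℝ} {Ω : Type*} [MeasurableSpace Ω] {P : Measure Ω}
    {W : NoiseTest d → Ω → ℝ} (hW : IsHomogeneousNoise P μ W) (hq : 0 < q) (hq2 : q < 2)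
    (hμ : ∫⁻ ξ : Space d, ENNReal.ofReal (1 / (1 + ‖ξ‖ ^ q)) ∂μ < ⊤)
    {V : Icc (0 : ℝ) T × Space d → Ω → ℝ}
    (hV : ∀ p, IsWienerIntegral P μ W (kernelFourier d p.1 p.2) (V p)) :
    ∃ U : Ω → PathSpace d T, (∀ p, Measurable fun ω => U ω p) ∧
      ∀ p, ∀ᵐ ω ∂P, U ω p = V p ω := by
  have hP := hW.gaussian.isProbabilityMeasure
  have hloc := isLocallyFiniteMeasure_of_spectral hq hμ
  have hI := lintegral_one_add_norm_rpow_lt_top hq hμ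
  set I := ∫⁻ ξ : Space d, ENNReal.ofReal (((1 + ‖ξ‖) ^ q)⁻¹) ∂μ with hIdef
  obtain ⟨x₀, π, S, A, D, hD, hS, hcard, hπ⟩ := exists_nets d hT
  have hθ : 0 < (2 - q) / 4 := by linarith
  refine exists_continuous_modification (fun p => (hV p).1) hθ (fun k => ?_) hD hS hcard hπ
  obtain ⟨c, hc⟩ := exists_wiener_moment_bound hW hq hq2 hμ k
  -- The added 1 keeps B positive, as the moment bound requires σ > 0.
  set B : ℝ := √((2 * (T + 1)) ^ 2 * I.toReal * T + 1) with hB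
  have hB2 : B ^ 2 = (2 * (T + 1)) ^ 2 * I.toReal * T + 1 := Real.sq_sqrt (by positivity)
  have hB0 : 0 < B := Real.sqrt_pos.2 (by positivity)
  refine ⟨c * (2 * B).toNNReal ^ k + 1, fun p p' => ?_⟩
  -- On the diagonal σ would be 0. The case k = 0 there reads 0^0 = 1, which is why the constant
  -- includes + 1.
  rcases eq_or_ne p p' with rfl | hne
  · have h0 : (0 : ℝ≥0∞) ^ k ≤ ((c * (2 * B).toNNReal ^ k + 1 : ℝ≥0) : ℝ≥0∞) * 0 ^ k := by
      refine le_mul_of_one_le_left zero_le ?_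
      exact_mod_cast le_add_self
    simpa [Real.zero_rpow hθ.ne'] using h0
  · have hδ0 : 0 < dist p p' := dist_pos.2 hne
    set δ := dist p p' with hδ
    have h1 : |(p.1 : ℝ) - p'.1| ≤ δ := by
      rw [← Real.dist_eq, ← Subtype.dist_eq]; exact le_max_left _ _
    have h2 : ‖p.2 - p'.2‖ ≤ δ := by
      rw [← dist_eq_norm]; exact le_max_right _ _
    have h3 := hc _ _ (V p) (V p') (measurable_kernelFourier hd p.1 p.2)
      (measurable_kernelFourier hd p'.1 p'.2) (hV p) (hV p') (B * δ ^ ((2 - q) / 4))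
      (by positivity) (by
        refine (lintegral_kernelFourier_sub_le hd hq hq2 p.1.2 p'.1.2 p.2 p'.2 hδ0 h1 h2).trans ?_
        rw [← hIdef, ← ENNReal.ofReal_toReal hI.ne, ← ENNReal.ofReal_mul (by positivity),
          ← ENNReal.ofReal_mul (by positivity)]
        apply ENNReal.ofReal_le_ofReal
        rw [mul_pow B, hB2]
        have : 0 ≤ (δ ^ ((2 - q) / 4)) ^ 2 := by positivity
        nlinarith)
    refine h3.trans ?_
    rw [← mul_assoc 2 B, ENNReal.ofReal_mul (by positivity), mul_pow, ← mul_assoc]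
    gcongr
    push_cast
    exact le_self_add

/-! ### Continuity of the solution of the linear homogeneous equation -/

section LinearWave

variable {d : ℕ}

theorem continuousOn_waveConv (hd : d = 1 ∨ d = 2 ∨ d = 3) {f : Space d → ℝ} (hf : Continuous f) :
    ContinuousOn (fun p : ℝ × Space d => waveConv d f p.1 p.2) (Ici 0 ×ˢ univ) := by
  have h : Continuous fun p : ℝ × Space d =>
      p.1 * ∫ z, f (p.2 - p.1 • z) ∂(waveKernel d 1) := by
    refine continuous_fst.mul (continuous_integral_waveKernel_one hd ?_)
    exact hf.comp (by fun_prop)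
  exact h.continuousOn.congr fun p hp => waveConv_eq hd f hp.1 p.2

/-- The time derivative of `u₀ * G_t` for continuously differentiable `u₀`. -/
theorem deriv_waveConv_of_contDiff (hd : d = 1 ∨ d = 2 ∨ d = 3) {u₀ : Space d → ℝ}
    (hu : ContDiff ℝ 1 u₀) {t : ℝ} (ht : 0 < t) (x : Space d) :
    deriv (fun r => waveConv d u₀ r x) t
      = ∫ z, u₀ (x - t • z) ∂(waveKernel d 1)
        + t * ∫ z, fderiv ℝ u₀ (x - t • z) (-z) ∂(waveKernel d 1) := by
  have hc : Continuous (fderiv ℝ u₀) := hu.continuous_fderiv (by simp)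
  have hcF : Continuous fun q : ℝ × Space d => fderiv ℝ u₀ (x - q.1 • q.2) (-q.2) := by fun_prop
  have hP := isProbabilityMeasure_waveKernel_one hd
  obtain ⟨C, hC⟩ := ((isCompact_Icc (a := t - 1) (b := t + 1)).prod
    (isCompact_closedBall (0 : Space d) 1)).exists_bound_of_continuousOn hcF.continuousOn
  have hd1 : ∀ (z : Space d) (r : ℝ), HasDerivAt (fun r : ℝ => u₀ (x - r • z))
      (fderiv ℝ u₀ (x - r • z) (-z)) r := by
    intro z r
    have e1 : HasDerivAt (fun r : ℝ => x - r • z) (-z) r := by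
      simpa using ((hasDerivAt_id r).smul_const z).const_sub x
    exact ((hu.differentiable (by simp) _).hasFDerivAt.comp_hasDerivAt r e1)
  have hcu := hu.continuous
  have hder : HasDerivAt (fun r => ∫ z, u₀ (x - r • z) ∂(waveKernel d 1))
      (∫ z, fderiv ℝ u₀ (x - t • z) (-z) ∂(waveKernel d 1)) t := by
    refine (hasDerivAt_integral_of_dominated_loc_of_deriv_le (bound := fun _ => C)
      (s := Metric.ball t 1) (Metric.ball_mem_nhds t one_pos)
      (Eventually.of_forall fun r => Continuous.aestronglyMeasurable (by fun_prop))
      (integrable_waveKernel_one hd (by fun_prop))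
      (Continuous.aestronglyMeasurable (by fun_prop)) ?_ (integrable_const _)
      (ae_of_all _ fun z r _ => hd1 z r)).2
    filter_upwards [ae_norm_le_waveKernel_one hd] with z hz r hr
    refine hC (r, z) ⟨?_, by simpa using hz⟩
    have := abs_lt.1 (by simpa [Real.dist_eq] using hr : |r - t| < 1)
    constructor <;> linarith
  have hmul := (hasDerivAt_id t).mul hder
  have heq : (fun r => waveConv d u₀ r x) =ᶠ[𝓝 t]
      fun r => id r * ∫ z, u₀ (x - r • z) ∂(waveKernel d 1) := by
    filter_upwards [lt_mem_nhds ht] with r hr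
    exact waveConv_eq hd u₀ (le_of_lt hr) x
  rw [heq.deriv_eq]
  have := hmul.deriv
  simp only [id, one_mul] at this ⊢
  exact this

theorem exists_continuous_deriv_waveConv_of_contDiff (hd : d = 1 ∨ d = 2 ∨ d = 3)
    {u₀ : Space d → ℝ} (hu : ContDiff ℝ 1 u₀) :
    ∃ g : ℝ × Space d → ℝ, Continuous g ∧ (∀ x, g (0, x) = u₀ x) ∧
      ∀ t, 0 < t → ∀ x, g (t, x) = deriv (fun r => waveConv d u₀ r x) t := by
  have hc : Continuous (fderiv ℝ u₀) := hu.continuous_fderiv (by simp)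
  have hcu := hu.continuous
  have hP := isProbabilityMeasure_waveKernel_one hd
  refine ⟨fun p => ∫ z, u₀ (p.2 - p.1 • z) ∂(waveKernel d 1)
        + p.1 * ∫ z, fderiv ℝ u₀ (p.2 - p.1 • z) (-z) ∂(waveKernel d 1), ?_, ?_, ?_⟩
  · refine (continuous_integral_waveKernel_one hd ?_).add
      (continuous_fst.mul (continuous_integral_waveKernel_one hd ?_))
    · exact hcu.comp (by fun_prop)
    · have h1 : Continuous fun q : (ℝ × Space d) × Space d =>
        fderiv ℝ u₀ (q.1.2 - q.1.1 • q.2) (-q.2) := by fun_prop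
      exact h1
  · intro x; simp
  · intro t ht x
    exact (deriv_waveConv_of_contDiff hd hu ht x).symm

/-- D'Alembert's formula for the initial position. -/
theorem exists_continuous_deriv_waveConv_of_continuous {u₀ : Space 1 → ℝ} (hu : Continuous u₀) :
    ∃ g : ℝ × Space 1 → ℝ, Continuous g ∧ (∀ x, g (0, x) = u₀ x) ∧
      ∀ t, 0 < t → ∀ x, g (t, x) = deriv (fun r => waveConv 1 u₀ r x) t := by
  set e : Space 1 := EuclideanSpace.single 0 1 with he
  have hen : ‖e‖ = 1 := by simp [he]
  refine ⟨fun p => (1 / 2) * (u₀ (p.2 - p.1 • e) + u₀ (p.2 + p.1 • e)), by fun_prop,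
    fun x => by simp; ring, fun t ht x => ?_⟩
  have hz : ∀ z : Space 1, z = (inner ℝ e z : ℝ) • e := by
    intro z
    ext i
    fin_cases i
    simp [he, EuclideanSpace.inner_single_left]
  -- In one dimension the time derivative falls on the endpoints, so u₀ need only be continuous.
  have hw : ∀ r : ℝ, 0 < r → waveConv 1 u₀ r x = (1 / 2) * ∫ a in (-r)..r, u₀ (x - a • e) := by
    intro r hr
    have h1 : ∫ z, u₀ (x - r • z) ∂(waveKernel 1 1)
        = ∫ a, u₀ (x - (r * a) • e) ∂((waveKernel 1 1).map fun z => (inner ℝ e z : ℝ)) := by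
      rw [integral_map (Measurable.aemeasurable (by fun_prop))
        (Continuous.aestronglyMeasurable (by fun_prop))]
      refine integral_congr_ae (ae_of_all _ fun z => ?_)
      simp only
      conv_lhs => rw [hz z]
      rw [smul_smul]
    rw [waveConv_eq (Or.inl rfl) _ hr.le, h1, map_inner_waveKernel_one (Or.inl rfl) hen,
      integral_smul_measure, Measure.restrict_congr_set Ioo_ae_eq_Ioc,
      ← intervalIntegral.integral_of_le (by norm_num : (-1 : ℝ) ≤ 1),
      ENNReal.toReal_ofReal (by norm_num), smul_eq_mul]
    have h2 := intervalIntegral.smul_integral_comp_mul_left (fun a => u₀ (x - a • e)) r (a := -1) (b := 1)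
    rw [smul_eq_mul] at h2
    rw [mul_left_comm, h2]
    simp
  have hcont : Continuous fun a : ℝ => u₀ (x - a • e) := by fun_prop
  have hder : HasDerivAt (fun r => (1 / 2) * ∫ a in (-r)..r, u₀ (x - a • e))
      ((1 / 2) * (u₀ (x - t • e) + u₀ (x + t • e))) t := by
    have hsplit : (fun r : ℝ => (1 / 2) * ∫ a in (-r)..r, u₀ (x - a • e))
        = fun r => (1 / 2) * ((∫ a in (0 : ℝ)..r, u₀ (x - a • e))
          - ∫ a in (0 : ℝ)..(-r), u₀ (x - a • e)) := by
      ext r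
      rw [intervalIntegral.integral_interval_sub_left (hcont.intervalIntegrable _ _)
        (hcont.intervalIntegrable _ _)]
    rw [hsplit]
    have d1 := intervalIntegral.integral_hasDerivAt_right (hcont.intervalIntegrable 0 t)
      (hcont.stronglyMeasurableAtFilter _ _) hcont.continuousAt
    have d2 := intervalIntegral.integral_hasDerivAt_right (hcont.intervalIntegrable 0 (-t))
      (hcont.stronglyMeasurableAtFilter _ _) hcont.continuousAt
    have d3 := d2.comp t (hasDerivAt_neg t)
    convert! (d1.sub d3).const_mul (1 / 2 : ℝ) using 1
    simp
  have heq : (fun r => waveConv 1 u₀ r x) =ᶠ[𝓝 t]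
      fun r => (1 / 2) * ∫ a in (-r)..r, u₀ (x - a • e) := by
    filter_upwards [lt_mem_nhds ht] with r hr
    exact hw r hr
  rw [heq.deriv_eq, hder.deriv]

/-- In dimensions one and two the unit kernel has a density in `L^r` for all `r < 2`. -/
theorem exists_density_waveKernel_one (hd : d = 1 ∨ d = 2) :
    ∃ g : Space d → ℝ≥0∞, Measurable g ∧ waveKernel d 1 = volume.withDensity g ∧
      ∀ r : ℝ, 0 < r → r < 2 → ∫⁻ z, g z ^ r < ⊤ := by
  rcases hd with rfl | rfl
  · refine ⟨_, measurable_const.indicator measurableSet_ball, rfl, fun r hr _ => ?_⟩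
    have h : ∀ z : Space 1, (Metric.ball (0 : Space 1) 1).indicator
        (fun _ => ENNReal.ofReal (1 / 2)) z ^ r
        = (Metric.ball (0 : Space 1) 1).indicator (fun _ => ENNReal.ofReal (1 / 2) ^ r) z := by
      intro z
      by_cases hz : z ∈ Metric.ball (0 : Space 1) 1
      · rw [indicator_of_mem hz, indicator_of_mem hz]
      · rw [indicator_of_notMem hz, indicator_of_notMem hz, ENNReal.zero_rpow_of_pos hr]
    simp only [h]
    rw [lintegral_indicator measurableSet_ball, setLIntegral_const]
    exact ENNReal.mul_lt_top (ENNReal.rpow_lt_top_of_nonneg hr.le ENNReal.ofReal_ne_top)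
      measure_ball_lt_top
  · refine ⟨_, measurable_diskDensity 1, rfl, fun r hr hr2 => ?_⟩
    set f : ℝ → ℝ := fun y => (1 / (2 * Real.pi) * (1 / √(1 ^ 2 - y ^ 2))) ^ r with hf
    have hint : IntegrableOn (fun x : Space 2 => f ‖x‖) (Metric.ball 0 1) := by
      rw [integrableOn_fun_norm_addHaar]
      set c : ℝ := (1 / (2 * Real.pi)) ^ r with hc
      have h2r : 0 < 2 - r := by linarith
      -- A primitive of the radial integrand c y (1 - y²)^(-r/2). It is continuous at y = 1 because
      -- 1 - r/2 > 0.
      have hcont : ContinuousOn (fun y : ℝ => -(c / (2 - r)) * (1 - y ^ 2) ^ (1 - r / 2))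
          (Icc 0 1) :=
        (continuous_const.mul ((by fun_prop : Continuous fun y : ℝ => 1 - y ^ 2).rpow_const
          fun y => Or.inr (by linarith))).continuousOn
      have hder : ∀ y ∈ Ioo (0 : ℝ) 1, HasDerivAt
          (fun y : ℝ => -(c / (2 - r)) * (1 - y ^ 2) ^ (1 - r / 2))
          (y ^ (Module.finrank ℝ (Space 2) - 1) • f y) y := by
        intro y hy
        have hpos : 0 < 1 - y ^ 2 := by nlinarith [hy.1, hy.2]
        have h1 : HasDerivAt (fun y : ℝ => 1 - y ^ 2) (-(2 * y)) y := by
          simpa using (hasDerivAt_pow 2 y).const_sub 1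
        have h3 := (h1.rpow_const (p := 1 - r / 2) (Or.inl hpos.ne')).const_mul (-(c / (2 - r)))
        convert! h3 using 1
        have e1 : f y = c * (1 - y ^ 2) ^ (1 - r / 2 - 1) := by
          rw [hf, hc]
          simp only
          rw [Real.mul_rpow (by positivity) (by positivity), one_pow, one_div (√_), Real.sqrt_eq_rpow,
            ← Real.rpow_neg hpos.le, ← Real.rpow_mul hpos.le]
          congr 2; ring
        rw [e1, finrank_euclideanSpace_fin, smul_eq_mul]
        simp only [Nat.add_one_sub_one, pow_one]
        field_simp
      exact (intervalIntegral.integrableOn_deriv_of_nonneg hcont hder fun y hy => by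
        have := hy.1; positivity).mono_set Ioo_subset_Ioc_self
    have h : ∀ z : Space 2, (Metric.ball (0 : Space 2) 1).indicator (fun x =>
        ENNReal.ofReal (1 / (2 * Real.pi) * (1 / √(1 ^ 2 - ‖x‖ ^ 2)))) z ^ r
        = (Metric.ball (0 : Space 2) 1).indicator (fun x => ENNReal.ofReal (f ‖x‖)) z := by
      intro z
      by_cases hz : z ∈ Metric.ball (0 : Space 2) 1
      · rw [indicator_of_mem hz, indicator_of_mem hz,
          ENNReal.ofReal_rpow_of_nonneg (by positivity) hr.le]
      · rw [indicator_of_notMem hz, indicator_of_notMem hz, ENNReal.zero_rpow_of_pos hr]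
    simp only [h]
    rw [lintegral_indicator measurableSet_ball]
    exact hint.lintegral_lt_top

theorem map_const_sub_smul {t : ℝ} (ht : 0 < t) (x : Space d) :
    (volume : Measure (Space d)).map (fun z => x - t • z) = ENNReal.ofReal ((t ^ d)⁻¹) • volume := by
  have h1 := Measure.map_addHaar_smul (volume : Measure (Space d)) ht.ne'
  rw [finrank_euclideanSpace_fin, abs_of_pos (by positivity)] at h1
  have h2 : (fun z : Space d => x - t • z) = (fun y => x - y) ∘ fun z => t • z := rfl
  rw [h2, ← Measure.map_map (by fun_prop) (by fun_prop), h1, Measure.map_smul,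
    (Measure.measurePreserving_sub_left volume x).map_eq]

theorem quasiMeasurePreserving_const_sub_smul {t : ℝ} (ht : 0 < t) (x : Space d) :
    Measure.QuasiMeasurePreserving (fun z : Space d => x - t • z) volume volume :=
  ⟨by fun_prop, by rw [map_const_sub_smul ht]; exact Measure.smul_absolutelyContinuous⟩

/-- The convolution with the wave kernel is bounded by the `L^p` norm, locally uniformly in
time. -/
theorem exists_lintegral_waveKernel_le (hd : d = 1 ∨ d = 2) {p : ℝ} (hp : 2 < p) (T : ℝ) :
    ∃ C : ℝ≥0∞, C ≠ ⊤ ∧ ∀ v : Space d → ℝ, AEStronglyMeasurable v volume → ∀ t, 0 < t → t ≤ T →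
      ∀ x, ENNReal.ofReal t * ∫⁻ z, ‖v (x - t • z)‖ₑ ∂(waveKernel d 1)
        ≤ C * eLpNorm v (ENNReal.ofReal p) volume := by
  obtain ⟨g, hg, hκ, hgr⟩ := exists_density_waveKernel_one hd
  have hp0 : 0 < p := by linarith
  have hpq : p.HolderConjugate (p.conjExponent) := Real.HolderConjugate.conjExponent (by linarith)
  set r := p.conjExponent with hr
  -- The assumption p > 2 enters through its conjugate exponent, for which the kernel density lies
  -- in L^r.
  have hr2 : r < 2 := by
    rw [hr, Real.conjExponent, div_lt_iff₀ (by linarith)]; linarith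
  have hgf := hgr r hpq.symm.pos hr2
  refine ⟨ENNReal.ofReal (1 + |T|) * (∫⁻ z, g z ^ r) ^ (1 / r), ENNReal.mul_ne_top
    ENNReal.ofReal_ne_top (ENNReal.rpow_lt_top_of_nonneg (by have := hpq.symm.pos; positivity)
      hgf.ne).ne, fun v hv t ht htT x => ?_⟩
  have hvm : AEMeasurable (fun z => ‖v (x - t • z)‖ₑ) volume :=
    (hv.comp_quasiMeasurePreserving (quasiMeasurePreserving_const_sub_smul ht x)).enorm
  have hscale : ∫⁻ z, ‖v (x - t • z)‖ₑ ^ p = ENNReal.ofReal ((t ^ d)⁻¹) * ∫⁻ y, ‖v y‖ₑ ^ p := by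
    have h1 := lintegral_smul_measure (μ := volume) (ENNReal.ofReal ((t ^ d)⁻¹))
      (fun y => ‖v y‖ₑ ^ p)
    rw [smul_eq_mul] at h1
    rw [← h1, ← map_const_sub_smul ht x, lintegral_map' _ (by fun_prop)]
    rw [map_const_sub_smul ht x]
    exact (hv.enorm.pow_const p).mono_ac Measure.smul_absolutelyContinuous
  have hnorm : eLpNorm v (ENNReal.ofReal p) volume = (∫⁻ y, ‖v y‖ₑ ^ p) ^ (1 / p) := by
    rw [eLpNorm_eq_lintegral_rpow_enorm_toReal (by simpa using hp0) ENNReal.ofReal_ne_top,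
      ENNReal.toReal_ofReal hp0.le]
  have hH := ENNReal.lintegral_mul_le_Lp_mul_Lq volume hpq hvm hg.aemeasurable
  rw [hscale, ENNReal.mul_rpow_of_nonneg _ _ (by positivity), ← hnorm] at hH
  have hκi : ∫⁻ z, ‖v (x - t • z)‖ₑ ∂(waveKernel d 1)
      = ∫⁻ z, ((fun z => ‖v (x - t • z)‖ₑ) * g) z := by
    rw [hκ, lintegral_withDensity_eq_lintegral_mul₀ hg.aemeasurable hvm, mul_comm]
  -- Mass and dilation combine to t^(1 - d/p), whose exponent lies in [0,1] because d ≤ 2 < p; no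
  -- blow-up as t → 0.
  have ht1 : ENNReal.ofReal t * ENNReal.ofReal ((t ^ d)⁻¹) ^ (1 / p) ≤ ENNReal.ofReal (1 + |T|) := by
    rw [ENNReal.ofReal_rpow_of_nonneg (by positivity) (by positivity), ← ENNReal.ofReal_mul ht.le]
    apply ENNReal.ofReal_le_ofReal
    have e1 : t * ((t ^ d)⁻¹) ^ (1 / p) = t ^ (1 - d / p) := by
      rw [← Real.rpow_natCast, ← Real.rpow_neg ht.le, ← Real.rpow_mul ht.le]
      nth_rewrite 1 [← Real.rpow_one t]
      rw [← Real.rpow_add ht]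
      congr 1; ring
    have hd2 : (d : ℝ) ≤ 2 := by rcases hd with rfl | rfl <;> norm_num
    have h0 : 0 ≤ 1 - d / p := by
      rw [sub_nonneg, div_le_one hp0]; linarith
    have h1 : 1 - d / p ≤ 1 := by
      have : (0 : ℝ) ≤ d / p := by positivity
      linarith
    rw [e1]
    calc t ^ (1 - d / p) ≤ (1 + |T|) ^ (1 - d / p) := by
          gcongr
          linarith [le_abs_self T]
      _ ≤ (1 + |T|) ^ (1 : ℝ) := Real.rpow_le_rpow_of_exponent_le (by linarith [abs_nonneg T]) h1
      _ = _ := Real.rpow_one _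
  calc _ ≤ ENNReal.ofReal t * (ENNReal.ofReal ((t ^ d)⁻¹) ^ (1 / p) *
        eLpNorm v (ENNReal.ofReal p) volume * (∫⁻ z, g z ^ r) ^ (1 / r)) := by
        rw [hκi]; gcongr
    _ = (ENNReal.ofReal t * ENNReal.ofReal ((t ^ d)⁻¹) ^ (1 / p)) * (∫⁻ z, g z ^ r) ^ (1 / r) *
        eLpNorm v (ENNReal.ofReal p) volume := by ring
    _ ≤ _ := by gcongr

theorem integrable_comp_const_sub_smul (hd : d = 1 ∨ d = 2) {p : ℝ} (hp : 2 < p) {v : Space d → ℝ}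
    (hv : MemLp v (ENNReal.ofReal p) volume) {t : ℝ} (ht : 0 < t) (x : Space d) :
    Integrable (fun z => v (x - t • z)) (waveKernel d 1) := by
  obtain ⟨g, hg, hκ, -⟩ := exists_density_waveKernel_one hd
  obtain ⟨C, hC, hCv⟩ := exists_lintegral_waveKernel_le hd hp t
  refine ⟨?_, ?_⟩
  · refine (hv.1.comp_quasiMeasurePreserving
      (quasiMeasurePreserving_const_sub_smul ht x)).mono_ac ?_
    rw [hκ]; exact withDensity_absolutelyContinuous _ _
  · have h1 := (hCv v hv.1 t ht le_rfl x).trans_lt (ENNReal.mul_lt_top hC.lt_top hv.2)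
    exact ENNReal.lt_top_of_mul_ne_top_right h1.ne (by simpa using ht)

/-- Continuous compactly supported functions are dense in L^p, and the estimate above makes the
convolutions converge uniformly on [0,T] × ℝ^d. -/
theorem continuousOn_waveConv_of_memLp_real (hd : d = 1 ∨ d = 2) {p : ℝ} (hp : 2 < p)
    {v : Space d → ℝ} (hv : MemLp v (ENNReal.ofReal p) volume) (T : ℝ) :
    ContinuousOn (fun q : ℝ × Space d => waveConv d v q.1 q.2) (Icc 0 T ×ˢ univ) := by
  have hd' : d = 1 ∨ d = 2 ∨ d = 3 := by omega
  obtain ⟨C, hC, hCv⟩ := exists_lintegral_waveKernel_le hd hp T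
  refine continuousOn_of_uniform_approx_of_continuousOn fun u hu => ?_
  obtain ⟨ε, hε, hεu⟩ := Metric.mem_uniformity_dist.1 hu
  obtain ⟨δ, hδ0, hδ⟩ : ∃ δ : ℝ≥0∞, δ ≠ 0 ∧ C * δ < ENNReal.ofReal ε := by
    have h1 : Tendsto (fun δ : ℝ≥0∞ => C * δ) (𝓝[>] 0) (𝓝 (C * 0)) :=
      (ENNReal.Tendsto.const_mul tendsto_id (Or.inr hC)).mono_left nhdsWithin_le_nhds
    rw [mul_zero] at h1
    obtain ⟨δ, h2, h3⟩ := ((h1.eventually (gt_mem_nhds (ENNReal.ofReal_pos.2 hε))).and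
      self_mem_nhdsWithin).exists
    exact ⟨δ, (ne_of_gt h3), h2⟩
  obtain ⟨w, -, hwδ, hwc, hwL⟩ := hv.exists_hasCompactSupport_eLpNorm_sub_le ENNReal.ofReal_ne_top hδ0
  refine ⟨fun q => waveConv d w q.1 q.2, (continuousOn_waveConv hd' hwc).mono
    (prod_mono Icc_subset_Ici_self le_rfl), fun q hq => hεu ?_⟩
  obtain ⟨t, x⟩ := q
  have ht : t ∈ Icc 0 T := hq.1
  simp only
  rw [waveConv_eq hd' _ ht.1, waveConv_eq hd' _ ht.1]
  rcases ht.1.eq_or_lt with h0 | h0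
  · simpa [← h0] using hε
  · rw [dist_eq_norm, ← mul_sub, ← integral_sub (integrable_comp_const_sub_smul hd hp hv h0 x)
      (integrable_comp_const_sub_smul hd hp hwL h0 x), ← ENNReal.ofReal_lt_ofReal_iff hε, ofReal_norm,
      enorm_mul]
    refine lt_of_le_of_lt ?_ hδ
    rw [Real.enorm_eq_ofReal_abs t, abs_of_pos h0]
    calc _ ≤ ENNReal.ofReal t * ∫⁻ z, ‖(v - w) (x - t • z)‖ₑ ∂(waveKernel d 1) := by
          gcongr; exact enorm_integral_le_lintegral_enorm _
      _ ≤ C * eLpNorm (v - w) (ENNReal.ofReal p) volume :=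
          hCv _ (hv.1.sub hwL.1) t h0 ht.2 x
      _ ≤ C * δ := by gcongr

/-- Covers p = ∞, where density fails: by finite propagation only a ball matters near a given point,
and there L^p embeds into L^{p'} for a finite p' > 2. -/
theorem continuousOn_waveConv_of_memLp (hd : d = 1 ∨ d = 2) {p : ℝ≥0∞} (hp : 2 < p)
    {v : Space d → ℝ} (hv : MemLp v p volume) (T : ℝ) :
    ContinuousOn (fun q : ℝ × Space d => waveConv d v q.1 q.2) (Icc 0 T ×ˢ univ) := by
  have hd' : d = 1 ∨ d = 2 ∨ d = 3 := by omega
  obtain ⟨p', hp', hpp'⟩ : ∃ p' : ℝ, 2 < p' ∧ ENNReal.ofReal p' ≤ p := by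
    obtain ⟨a, ha, ha'⟩ := ENNReal.lt_iff_exists_nnreal_btwn.1 hp
    refine ⟨a, by exact_mod_cast ha, ?_⟩
    rw [ENNReal.ofReal_coe_nnreal]; exact ha'.le
  rintro ⟨t₀, x₀⟩ h₀
  set R := ‖x₀‖ + 1 + |T| with hR
  have hvR : MemLp ((Metric.closedBall (0 : Space d) R).indicator v) (ENNReal.ofReal p') volume := by
    rw [memLp_indicator_iff_restrict measurableSet_closedBall]
    have : IsFiniteMeasure ((volume : Measure (Space d)).restrict (Metric.closedBall 0 R)) :=
      ⟨by simpa using measure_closedBall_lt_top⟩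
    exact (hv.restrict _).mono_exponent hpp'
  have hcont := continuousOn_waveConv_of_memLp_real hd hp' hvR T (t₀, x₀) h₀
  refine hcont.congr_of_eventuallyEq ?_ ?_
  all_goals
    have key : ∀ t ∈ Icc 0 T, ∀ x ∈ Metric.ball x₀ 1, waveConv d v t x
        = waveConv d ((Metric.closedBall (0 : Space d) R).indicator v) t x := by
      intro t ht x hx
      rw [waveConv_eq hd' _ ht.1, waveConv_eq hd' _ ht.1]
      congr 1
      refine integral_congr_ae ?_
      filter_upwards [ae_norm_le_waveKernel_one hd'] with z hz
      rw [indicator_of_mem]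
      rw [mem_closedBall_zero_iff]
      have h1 := norm_sub_le x (t • z)
      rw [norm_smul, Real.norm_of_nonneg ht.1] at h1
      have h2 : t * ‖z‖ ≤ |T| * 1 := by
        gcongr
        exact ht.2.trans (le_abs_self T)
      have h3 : ‖x‖ ≤ ‖x₀‖ + 1 := by
        have := norm_le_norm_add_norm_sub' x x₀
        have h4 := mem_ball_iff_norm.1 hx
        linarith
      linarith
  · have hn : (univ : Set ℝ) ×ˢ Metric.ball x₀ 1 ∈ 𝓝 (t₀, x₀) :=
      prod_mem_nhds univ_mem (Metric.ball_mem_nhds _ one_pos)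
    filter_upwards [self_mem_nhdsWithin, mem_nhdsWithin_of_mem_nhds hn] with q hq hq'
    exact key q.1 hq.1 q.2 hq'.2
  · exact key t₀ h₀.1 x₀ (Metric.mem_ball_self one_pos)

theorem exists_path_linearWave (hd : d = 1 ∨ d = 2 ∨ d = 3) {u₀ v₀ : Space d → ℝ}
    (h : WaveInitialData d u₀ v₀) (T : ℝ) :
    ∃ I : PathSpace d T, ∀ t x, I (t, x) = linearWave d u₀ v₀ t x := by
  obtain ⟨g, hg, hg0, hgt⟩ : ∃ g : ℝ × Space d → ℝ, Continuous g ∧ (∀ x, g (0, x) = u₀ x) ∧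
      ∀ t, 0 < t → ∀ x, g (t, x) = deriv (fun r => waveConv d u₀ r x) t := by
    rcases hd with rfl | rfl | rfl
    · exact exists_continuous_deriv_waveConv_of_continuous h.1.1
    · exact exists_continuous_deriv_waveConv_of_contDiff (by simp) h.1
    · exact exists_continuous_deriv_waveConv_of_contDiff (by simp) h.1.1
  have hv : ContinuousOn (fun q : ℝ × Space d => waveConv d v₀ q.1 q.2) (Icc 0 T ×ˢ univ) := by
    rcases hd with rfl | rfl | rfl
    · obtain ⟨-, hm, C, hC⟩ := h
      exact continuousOn_waveConv_of_memLp (by simp) (p := ⊤) (by simp)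
        (memLp_top_of_bound hm.aestronglyMeasurable C (ae_of_all _ hC)) T
    · obtain ⟨-, p, hp, -, -, hv⟩ := h
      exact continuousOn_waveConv_of_memLp (by simp) hp hv T
    · exact (continuousOn_waveConv (by simp) h.2.1).mono (prod_mono Icc_subset_Ici_self le_rfl)
  have hvc : Continuous fun q : Icc (0 : ℝ) T × Space d => waveConv d v₀ q.1 q.2 :=
    hv.comp_continuous (f := fun q : Icc (0 : ℝ) T × Space d => ((q.1 : ℝ), q.2)) (by fun_prop)
      fun q => ⟨q.1.2, mem_univ _⟩
  refine ⟨⟨fun q => waveConv d v₀ q.1 q.2 + g (q.1, q.2), by fun_prop⟩, fun t x => ?_⟩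
  show waveConv d v₀ t x + g (t, x) = _
  rw [linearWave]
  split_ifs with h0
  · rw [h0, hg0, waveConv_eq hd _ le_rfl]; simp
  · rw [hgt _ (lt_of_le_of_ne t.2.1 (Ne.symm h0))]

end LinearWave

/-! ### Random paths -/

section RandomDrift

variable {d : ℕ}

/-- The measure `ds κ(dz)` on `(0,t] × ℝ^d`, where `κ` is the wave kernel at time one. -/
def driftMeasure (d : ℕ) (t : ℝ) : Measure (ℝ × Space d) :=
  (volume.restrict (Ioc 0 t)).prod (waveKernel d 1)

theorem isFiniteMeasure_driftMeasure (hd : d = 1 ∨ d = 2 ∨ d = 3) (t : ℝ) :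
    IsFiniteMeasure (driftMeasure d t) := by
  have := isProbabilityMeasure_waveKernel_one hd
  rw [driftMeasure]
  infer_instance

theorem lintegral_driftMeasure_fst (hd : d = 1 ∨ d = 2 ∨ d = 3) (t : ℝ) {f : ℝ → ℝ≥0∞}
    (hf : Measurable f) : ∫⁻ q, f q.1 ∂(driftMeasure d t) = ∫⁻ s in Ioc 0 t, f s := by
  have := isProbabilityMeasure_waveKernel_one hd
  rw [driftMeasure, lintegral_prod _ (by fun_prop)]
  simp

theorem ae_driftMeasure_fst_mem (hd : d = 1 ∨ d = 2 ∨ d = 3) (t : ℝ) :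
    ∀ᵐ q ∂(driftMeasure d t), q.1 ∈ Ioc 0 t := by
  have := isProbabilityMeasure_waveKernel_one hd
  exact Measure.quasiMeasurePreserving_fst.ae (ae_restrict_mem measurableSet_Ioc)

theorem driftTerm_eq_integral (hd : d = 1 ∨ d = 2 ∨ d = 3) {b : ℝ → ℝ} {w : ℝ → Space d → ℝ}
    {t : ℝ} (ht : 0 ≤ t) {x : Space d}
    (hw : Integrable (fun q : ℝ × Space d => b (w q.1 (x - (t - q.1) • q.2))) (driftMeasure d t)) :
    Integrable (fun q : ℝ × Space d => (t - q.1) * b (w q.1 (x - (t - q.1) • q.2)))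
      (driftMeasure d t) ∧
    driftTerm d b w t x
      = ∫ q, (t - q.1) * b (w q.1 (x - (t - q.1) • q.2)) ∂(driftMeasure d t) := by
  have := isProbabilityMeasure_waveKernel_one hd
  have hi : Integrable (fun q : ℝ × Space d => (t - q.1) * b (w q.1 (x - (t - q.1) • q.2)))
      (driftMeasure d t) := by
    refine hw.bdd_mul (c := t) (by fun_prop) ?_
    filter_upwards [ae_driftMeasure_fst_mem hd t] with q hq
    rw [Real.norm_of_nonneg (by linarith [hq.2])]
    linarith [hq.1]
  refine ⟨hi, ?_⟩
  rw [driftTerm_eq hd b w ht, intervalIntegral.integral_of_le ht]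
  simp only [driftMeasure] at hi ⊢
  rw [integral_prod _ hi]
  simp_rw [integral_const_mul]

theorem enorm_driftTerm_le (hd : d = 1 ∨ d = 2 ∨ d = 3) {b : ℝ → ℝ} {w : ℝ → Space d → ℝ}
    {t T : ℝ} (ht : t ∈ Icc 0 T) {x : Space d}
    (hw : Integrable (fun q : ℝ × Space d => b (w q.1 (x - (t - q.1) • q.2))) (driftMeasure d t)) :
    ‖driftTerm d b w t x‖ₑ
      ≤ ENNReal.ofReal T * ∫⁻ q, ‖b (w q.1 (x - (t - q.1) • q.2))‖ₑ ∂(driftMeasure d t) := by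
  rw [(driftTerm_eq_integral hd ht.1 hw).2]
  refine (enorm_integral_le_lintegral_enorm _).trans ?_
  rw [← lintegral_const_mul' _ _ ENNReal.ofReal_ne_top]
  refine lintegral_mono_ae ?_
  filter_upwards [ae_driftMeasure_fst_mem hd t] with q hq
  rw [enorm_mul, Real.enorm_eq_ofReal (by linarith [hq.2])]
  gcongr
  linarith [hq.1, ht.2]

theorem enorm_driftTerm_sub_le (hd : d = 1 ∨ d = 2 ∨ d = 3) {b : ℝ → ℝ} {K : ℝ≥0}
    (hb : LipschitzWith K b) {w w' : ℝ → Space d → ℝ} {t T : ℝ} (ht : t ∈ Icc 0 T) {x : Space d}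
    (hw : Integrable (fun q : ℝ × Space d => b (w q.1 (x - (t - q.1) • q.2))) (driftMeasure d t))
    (hw' : Integrable (fun q : ℝ × Space d => b (w' q.1 (x - (t - q.1) • q.2)))
      (driftMeasure d t)) :
    ‖driftTerm d b w t x - driftTerm d b w' t x‖ₑ
      ≤ ENNReal.ofReal (K * T) * ∫⁻ q, ‖w q.1 (x - (t - q.1) • q.2) -
          w' q.1 (x - (t - q.1) • q.2)‖ₑ ∂(driftMeasure d t) := by
  obtain ⟨hi, he⟩ := driftTerm_eq_integral hd ht.1 hw
  obtain ⟨hi', he'⟩ := driftTerm_eq_integral hd ht.1 hw'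
  rw [he, he', ← integral_sub hi hi']
  refine (enorm_integral_le_lintegral_enorm _).trans ?_
  rw [← lintegral_const_mul' _ _ ENNReal.ofReal_ne_top]
  refine lintegral_mono_ae ?_
  filter_upwards [ae_driftMeasure_fst_mem hd t] with q hq
  rw [← mul_sub, enorm_mul, Real.enorm_eq_ofReal (by linarith [hq.2]), mul_comm (K : ℝ),
    ENNReal.ofReal_mul (ht.1.trans ht.2), mul_assoc]
  gcongr
  · linarith [hq.1, ht.2]
  · rw [ENNReal.ofReal_coe_nnreal, ← edist_eq_enorm_sub, ← edist_eq_enorm_sub]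
    exact hb _ _

theorem integrable_drift_of_continuous (hd : d = 1 ∨ d = 2 ∨ d = 3) {b : ℝ → ℝ}
    (hb : Continuous b) {w : ℝ → Space d → ℝ} (hw : Continuous (Function.uncurry w)) (t : ℝ)
    (x : Space d) :
    Integrable (fun q : ℝ × Space d => b (w q.1 (x - (t - q.1) • q.2))) (driftMeasure d t) := by
  have := isProbabilityMeasure_waveKernel_one hd
  have := isFiniteMeasure_driftMeasure hd t
  have hc : Continuous fun q : ℝ × Space d => b (w q.1 (x - (t - q.1) • q.2)) :=
    hb.comp (hw.comp (f := fun q : ℝ × Space d => (q.1, x - (t - q.1) • q.2)) (by fun_prop))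
  obtain ⟨M, hM⟩ := ((isCompact_Icc (a := (0 : ℝ)) (b := t)).prod
    (isCompact_closedBall (0 : Space d) 1)).exists_bound_of_continuousOn hc.continuousOn
  refine Integrable.of_bound hc.aestronglyMeasurable M ?_
  have h2 : ∀ᵐ q ∂(driftMeasure d t), ‖q.2‖ ≤ 1 :=
    Measure.quasiMeasurePreserving_snd.ae (ae_norm_le_waveKernel_one hd)
  filter_upwards [ae_driftMeasure_fst_mem hd t, h2] with q hq hq2
  exact hM q ⟨Ioc_subset_Icc_self hq, by simpa using hq2⟩

variable {Ω : Type*} [MeasurableSpace Ω] {P : Measure Ω} [IsProbabilityMeasure P]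

/-- The drift term of a measurable field with bounded first moments is almost surely given by an
absolutely convergent integral. -/
theorem lintegral_lintegral_drift_le (hd : d = 1 ∨ d = 2 ∨ d = 3) {b : ℝ → ℝ} {K : ℝ≥0}
    (hb : LipschitzWith K b) {v : ℝ → Space d → Ω → ℝ}
    (hv : Measurable fun q : (ℝ × Space d) × Ω => v q.1.1 q.1.2 q.2) {C : ℝ≥0}
    (hC : ∀ s y, ∫⁻ ω, ‖v s y ω‖ₑ ∂P ≤ C) {t T : ℝ} (ht : t ∈ Icc 0 T) (x : Space d) :
    ∫⁻ ω, ∫⁻ q, ‖b (v q.1 (x - (t - q.1) • q.2) ω)‖ₑ ∂(driftMeasure d t) ∂P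
      ≤ ENNReal.ofReal T * (‖b 0‖ₑ + K * C) := by
  have := isFiniteMeasure_driftMeasure hd t
  have hm : Measurable fun p : Ω × (ℝ × Space d) => v p.2.1 (x - (t - p.2.1) • p.2.2) p.1 :=
    hv.comp (g := fun q : (ℝ × Space d) × Ω => v q.1.1 q.1.2 q.2)
      (f := fun p : Ω × (ℝ × Space d) => ((p.2.1, x - (t - p.2.1) • p.2.2), p.1)) (by fun_prop)
  have hbm : Measurable b := hb.continuous.measurable
  rw [lintegral_lintegral_swap (hbm.comp hm).enorm.aemeasurable]
  calc _ ≤ ∫⁻ _q, (‖b 0‖ₑ + K * C) ∂(driftMeasure d t) := by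
        refine lintegral_mono fun q => ?_
        calc _ ≤ ∫⁻ ω, (‖b 0‖ₑ + K * ‖v q.1 (x - (t - q.1) • q.2) ω‖ₑ) ∂P := by
              refine lintegral_mono fun ω => ?_
              have h := hb (v q.1 (x - (t - q.1) • q.2) ω) 0
              rw [edist_eq_enorm_sub, edist_eq_enorm_sub, sub_zero] at h
              calc _ = ‖b 0 + (b (v q.1 (x - (t - q.1) • q.2) ω) - b 0)‖ₑ := by
                    rw [add_sub_cancel]
                _ ≤ _ := (enorm_add_le _ _).trans (by gcongr)
          _ ≤ _ := by
              rw [lintegral_add_left measurable_const, lintegral_const_mul' _ _ (by simp),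
                lintegral_const, measure_univ, mul_one]
              gcongr
              exact hC _ _
    _ ≤ _ := by
        rw [lintegral_driftMeasure_fst hd t measurable_const]
        simp only [lintegral_const, MeasurableSet.univ, Measure.restrict_apply, univ_inter,
          Real.volume_Ioc, sub_zero]
        rw [mul_comm]
        gcongr
        exact ht.2

theorem ae_integrable_drift (hd : d = 1 ∨ d = 2 ∨ d = 3) {b : ℝ → ℝ} {K : ℝ≥0}
    (hb : LipschitzWith K b) {v : ℝ → Space d → Ω → ℝ}
    (hv : Measurable fun q : (ℝ × Space d) × Ω => v q.1.1 q.1.2 q.2) {C : ℝ≥0}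
    (hC : ∀ s y, ∫⁻ ω, ‖v s y ω‖ₑ ∂P ≤ C) {t : ℝ} (ht : 0 ≤ t) (x : Space d) :
    ∀ᵐ ω ∂P, Integrable (fun q : ℝ × Space d => b (v q.1 (x - (t - q.1) • q.2) ω))
      (driftMeasure d t) := by
  have := isFiniteMeasure_driftMeasure hd t
  have hm : Measurable fun p : Ω × (ℝ × Space d) => b (v p.2.1 (x - (t - p.2.1) • p.2.2) p.1) :=
    hb.continuous.measurable.comp (hv.comp (g := fun q : (ℝ × Space d) × Ω => v q.1.1 q.1.2 q.2)
      (f := fun p : Ω × (ℝ × Space d) => ((p.2.1, x - (t - p.2.1) • p.2.2), p.1)) (by fun_prop))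
  have h := lintegral_lintegral_drift_le hd hb hv hC (t := t) ⟨ht, le_rfl⟩ x
  filter_upwards [ae_lt_top hm.enorm.lintegral_prod_right'
    (h.trans_lt (ENNReal.mul_lt_top ENNReal.ofReal_lt_top (by finiteness))).ne] with ω hω
  exact ⟨(hm.comp measurable_prodMk_left).aestronglyMeasurable, hω⟩

theorem measurable_uncurry_path {T : ℝ} {w : Ω → PathSpace d T}
    (hw : ∀ p, Measurable fun ω => w ω p) :
    Measurable fun q : (Icc (0 : ℝ) T × Space d) × Ω => w q.2 q.1 :=
  measurable_uncurry_of_continuous_of_measurable (u := fun p ω => w ω p)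
    (fun ω => (w ω).continuous) hw

theorem measurable_pathExtend {T : ℝ} (hT : 0 ≤ T) {w : Ω → PathSpace d T}
    (hw : ∀ p, Measurable fun ω => w ω p) :
    Measurable fun q : (ℝ × Space d) × Ω => pathExtend hT (w q.2) q.1.1 q.1.2 := by
  have : Measurable (projIcc 0 T hT) := continuous_projIcc.measurable
  exact (measurable_uncurry_path hw).comp
    (f := fun q : (ℝ × Space d) × Ω => ((projIcc 0 T hT q.1.1, q.1.2), q.2)) (by fun_prop)

theorem measurable_driftMap (hd : d = 1 ∨ d = 2 ∨ d = 3) {T : ℝ} (hT : 0 ≤ T) {b : ℝ → ℝ}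
    (hb : Continuous b) {w : Ω → PathSpace d T} (hw : ∀ p, Measurable fun ω => w ω p)
    (p : Icc (0 : ℝ) T × Space d) : Measurable fun ω => driftMap hd hT hb (w ω) p := by
  have := isProbabilityMeasure_waveKernel_one hd
  have h1 : Measurable fun r : (Ω × ℝ) × Space d =>
      b (pathExtend hT (w r.1.1) r.1.2 (p.2 - ((p.1 : ℝ) - r.1.2) • r.2)) :=
    hb.measurable.comp ((measurable_pathExtend hT hw).comp
      (f := fun r : (Ω × ℝ) × Space d =>
        ((r.1.2, p.2 - ((p.1 : ℝ) - r.1.2) • r.2), r.1.1)) (by fun_prop))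
  have h2 : StronglyMeasurable fun r : Ω × ℝ => ((p.1 : ℝ) - r.2) * ∫ z,
      b (pathExtend hT (w r.1) r.2 (p.2 - ((p.1 : ℝ) - r.2) • z)) ∂(waveKernel d 1) :=
    (by fun_prop : Measurable fun r : Ω × ℝ => (p.1 : ℝ) - r.2).stronglyMeasurable.mul
      h1.stronglyMeasurable.integral_prod_right'
  have h3 := (h2.integral_prod_right' (ν := volume.restrict (Ioc 0 (p.1 : ℝ)))).measurable
  convert h3 using 2 with ω
  exact intervalIntegral.integral_of_le p.1.2.1

theorem measurable_picard (hd : d = 1 ∨ d = 2 ∨ d = 3) {T : ℝ} (hT : 0 ≤ T) {b : ℝ → ℝ}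
    (hb : Continuous b) {η : Ω → PathSpace d T} (hη : ∀ p, Measurable fun ω => η ω p) (n : ℕ)
    (p : Icc (0 : ℝ) T × Space d) : Measurable fun ω => picard hd hT hb (η ω) n p := by
  induction n generalizing p with
  | zero => exact hη p
  | succ n ih => exact (hη p).add (measurable_driftMap hd hT hb ih p)

theorem lintegral_ofReal_pow_div_factorial {C L : ℝ} (hC : 0 ≤ C) (hL : 0 ≤ L) (n : ℕ) {t : ℝ}
    (ht : 0 ≤ t) :
    ENNReal.ofReal L * ∫⁻ s in Ioc 0 t, ENNReal.ofReal (C * ((L * s) ^ n / n.factorial))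
      = ENNReal.ofReal (C * ((L * t) ^ (n + 1) / (n + 1).factorial)) := by
  have hcont : Continuous fun s : ℝ => C * ((L * s) ^ n / n.factorial) := by fun_prop
  rw [← ofReal_integral_eq_lintegral_ofReal
      ((intervalIntegrable_iff_integrableOn_Ioc_of_le ht).1 (hcont.intervalIntegrable 0 t))
      ((ae_restrict_iff' measurableSet_Ioc).2 (ae_of_all _ fun s hs => by
        have := hs.1.le
        show 0 ≤ C * ((L * s) ^ n / n.factorial)
        positivity)),
    ← ENNReal.ofReal_mul hL, ← intervalIntegral.integral_of_le ht,
    ← intervalIntegral.integral_const_mul,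
    intervalIntegral.integral_eq_sub_of_hasDerivAt
      (fun s _ => hasDerivAt_pow_div_factorial C L n s)
      (by apply Continuous.intervalIntegrable; fun_prop)]
  simp

/-- A random field that satisfies the integral equation almost surely at every point has a
modification with continuous paths, if the inhomogeneity has continuous paths. -/
theorem exists_continuous_modification_of_solves (hd : d = 1 ∨ d = 2 ∨ d = 3) {T : ℝ}
    (hT : 0 ≤ T) {b : ℝ → ℝ} {K : ℝ≥0} (hb : LipschitzWith K b) {η : Ω → PathSpace d T}
    (hη : ∀ p, Measurable fun ω => η ω p) {v : ℝ → Space d → Ω → ℝ}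
    (hv : Measurable fun q : (ℝ × Space d) × Ω => v q.1.1 q.1.2 q.2) {C : ℝ≥0}
    (hC : ∀ s y, ∫⁻ ω, ‖v s y ω‖ₑ ∂P ≤ C)
    (h : ∀ (t : Icc (0 : ℝ) T) x, ∀ᵐ ω ∂P,
      v t x ω = η ω (t, x) + driftTerm d b (fun s y => v s y ω) t x) :
    ∃ U : Ω → PathSpace d T, (∀ p, Measurable fun ω => U ω p) ∧
      ∀ (t : Icc (0 : ℝ) T) x, ∀ᵐ ω ∂P, U ω (t, x) = v t x ω := by
  choose U hU using fun ω => tendsto_picard hd hT hb (η ω)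
  have hUp : ∀ p ω, Tendsto (fun n => picard hd hT hb.continuous (η ω) n p) atTop (𝓝 (U ω p)) :=
    fun p ω => ((continuous_eval_const p).tendsto (U ω)).comp (hU ω)
  have hpm := measurable_picard hd hT hb.continuous hη
  have hvm : ∀ t x, Measurable (v t x) := fun t x =>
    hv.comp (measurable_prodMk_left (x := (t, x)))
  -- B bounds the mean absolute value of the drift of v, which is the error of the zeroth iterate η.
  obtain ⟨B, hB0, hB⟩ : ∃ B : ℝ, 0 ≤ B ∧
      ENNReal.ofReal T * (ENNReal.ofReal T * (‖b 0‖ₑ + K * C)) = ENNReal.ofReal B :=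
    ⟨_, ENNReal.toReal_nonneg, (ENNReal.ofReal_toReal (by finiteness)).symm⟩
  -- Taking expectations first needs the equation only almost surely at each fixed point, which is
  -- all that is known of v; Tonelli's theorem then applies the induction hypothesis at each (s,y).
  have key : ∀ (n : ℕ) (t : Icc (0 : ℝ) T) (x : Space d),
      ∫⁻ ω, ‖picard hd hT hb.continuous (η ω) n (t, x) - v t x ω‖ₑ ∂P
        ≤ ENNReal.ofReal (B * ((K * T * t) ^ n / n.factorial)) := by
    intro n
    induction n with
    | zero =>
      intro t x
      simp only [pow_zero, Nat.factorial_zero, Nat.cast_one, div_one, mul_one]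
      rw [← hB]
      calc _ ≤ ∫⁻ ω, ENNReal.ofReal T * ∫⁻ q, ‖b (v q.1 (x - ((t : ℝ) - q.1) • q.2) ω)‖ₑ
            ∂(driftMeasure d t) ∂P := by
            refine lintegral_mono_ae ?_
            filter_upwards [h t x, ae_integrable_drift hd hb hv hC t.2.1 x] with ω hω hi
            rw [hω, picard, sub_add_cancel_left, enorm_neg]
            exact enorm_driftTerm_le hd t.2 hi
        _ ≤ _ := by
            rw [lintegral_const_mul' _ _ ENNReal.ofReal_ne_top]
            gcongr
            exact lintegral_lintegral_drift_le hd hb hv hC t.2 x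
    | succ n ih =>
      intro t x
      have := isFiniteMeasure_driftMeasure hd (t : ℝ)
      set w : Ω → PathSpace d T := fun ω => picard hd hT hb.continuous (η ω) n with hw
      have hm : Measurable fun r : Ω × (ℝ × Space d) =>
          pathExtend hT (w r.1) r.2.1 (x - ((t : ℝ) - r.2.1) • r.2.2)
            - v r.2.1 (x - ((t : ℝ) - r.2.1) • r.2.2) r.1 := by
        have hf : Measurable fun r : Ω × (ℝ × Space d) =>
            ((r.2.1, x - ((t : ℝ) - r.2.1) • r.2.2), r.1) := by fun_prop
        exact ((measurable_pathExtend hT (hpm n)).comp hf).sub (hv.comp hf)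
      calc _ ≤ ∫⁻ ω, ENNReal.ofReal (K * T) *
            ∫⁻ q, ‖pathExtend hT (w ω) q.1 (x - ((t : ℝ) - q.1) • q.2)
              - v q.1 (x - ((t : ℝ) - q.1) • q.2) ω‖ₑ ∂(driftMeasure d t) ∂P := by
            refine lintegral_mono_ae ?_
            filter_upwards [h t x, ae_integrable_drift hd hb hv hC t.2.1 x] with ω hω hi
            rw [hω, picard, ContinuousMap.add_apply, add_sub_add_left_eq_sub, driftMap_apply]
            refine enorm_driftTerm_sub_le hd hb t.2 ?_ hi
            exact integrable_drift_of_continuous hd hb.continuous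
              (continuous_pathExtend hT (w ω)) t x
        _ = ENNReal.ofReal (K * T) * ∫⁻ q, ∫⁻ ω,
              ‖pathExtend hT (w ω) q.1 (x - ((t : ℝ) - q.1) • q.2)
              - v q.1 (x - ((t : ℝ) - q.1) • q.2) ω‖ₑ ∂P ∂(driftMeasure d t) := by
            rw [lintegral_const_mul' _ _ ENNReal.ofReal_ne_top,
              lintegral_lintegral_swap hm.enorm.aemeasurable]
        _ ≤ ENNReal.ofReal (K * T) * ∫⁻ q : ℝ × Space d,
              ENNReal.ofReal (B * ((K * T * q.1) ^ n / n.factorial)) ∂(driftMeasure d t) := by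
            gcongr ENNReal.ofReal (K * T) * ?_
            refine lintegral_mono_ae ?_
            filter_upwards [ae_driftMeasure_fst_mem hd (t : ℝ)] with q hq
            have hs : q.1 ∈ Icc 0 T := ⟨hq.1.le, hq.2.trans t.2.2⟩
            simp only [pathExtend_of_mem hT _ hs]
            exact ih ⟨q.1, hs⟩ _
        _ = _ := by
            rw [lintegral_driftMeasure_fst hd (t : ℝ)
              (f := fun s => ENNReal.ofReal (B * ((K * T * s) ^ n / n.factorial))) (by fun_prop),
              lintegral_ofReal_pow_div_factorial hB0 (by positivity) n t.2.1]
  refine ⟨U, fun p => measurable_of_tendsto_metrizable (fun n => hpm n p)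
    (tendsto_pi_nhds.2 (hUp p)), fun t x => ?_⟩
  have hlim : Tendsto (fun n : ℕ => ENNReal.ofReal (B * ((K * T * t) ^ n / n.factorial)))
      atTop (𝓝 0) := by
    have h1 := ((FloorSemiring.tendsto_pow_div_factorial_atTop (K * T * t : ℝ)).const_mul B)
    simpa [Function.comp_def] using (ENNReal.continuous_ofReal.tendsto _).comp h1
  have h0 : ∫⁻ ω, ‖U ω (t, x) - v t x ω‖ₑ ∂P = 0 := by
    refine le_antisymm ?_ zero_le
    calc _ = ∫⁻ ω, liminf (fun n =>
          ‖picard hd hT hb.continuous (η ω) n (t, x) - v t x ω‖ₑ) atTop ∂P := by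
          refine lintegral_congr fun ω => (Tendsto.liminf_eq ?_).symm
          exact ((hUp (t, x) ω).sub_const _).enorm
      _ ≤ liminf (fun n => ∫⁻ ω,
          ‖picard hd hT hb.continuous (η ω) n (t, x) - v t x ω‖ₑ ∂P) atTop :=
          lintegral_liminf_le fun n => ((hpm n (t, x)).sub (hvm t x)).enorm
      _ ≤ liminf (fun n : ℕ => ENNReal.ofReal (B * ((K * T * t) ^ n / n.factorial))) atTop :=
          liminf_le_liminf (Eventually.of_forall fun n => key n t x)
      _ = 0 := hlim.liminf_eq
  have hUm : Measurable fun ω => U ω (t, x) :=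
    measurable_of_tendsto_metrizable (fun n => hpm n (t, x)) (tendsto_pi_nhds.2 (hUp (t, x)))
  filter_upwards [(lintegral_eq_zero_iff ((hUm.sub (hvm t x)).enorm)).1 h0] with ω hω
  exact sub_eq_zero.1 (enorm_eq_zero.1 hω)

end RandomDrift

/-- The linear wave plus the continuous version of the stochastic convolution is the random
inhomogeneity η of the pathwise equation. -/
theorem IsMildSolution.exists_continuous_modification {d : ℕ} (hd : d = 1 ∨ d = 2 ∨ d = 3) {T : ℝ}
    (hT : 0 ≤ T) {b : ℝ → ℝ} {K : ℝ≥0} (hb : LipschitzWith K b) {Ω : Type*} [MeasurableSpace Ω]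
    {P : Measure Ω} [IsProbabilityMeasure P] {μ : Measure (Space d)} {W : NoiseTest d → Ω → ℝ}
    (hW : IsHomogeneousNoise P μ W) {q : ℝ} (hq : 0 < q) (hq2 : q < 2)
    (hμ : ∫⁻ ξ : Space d, ENNReal.ofReal (1 / (1 + ‖ξ‖ ^ q)) ∂μ < ⊤)
    {u₀ v₀ : Space d → ℝ} (h₀ : WaveInitialData d u₀ v₀) {u : ℝ → Space d → Ω → ℝ}
    (hu : IsMildSolution P μ W T b u₀ v₀ u) :
    ∃ U : Ω → PathSpace d T, (∀ p, Measurable fun ω => U ω p) ∧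
      ∀ (t : Icc (0 : ℝ) T) (x : Space d), ∀ᵐ ω ∂P, U ω (t, x) = u t x ω := by
  choose V hV hVu using fun p : Icc (0 : ℝ) T × Space d => hu.mild p.1 p.1.2 p.2
  obtain ⟨Y, hYm, hYV⟩ := exists_continuous_stochasticConvolution hd hT hW hq hq2 hμ hV
  obtain ⟨I, hI⟩ := exists_path_linearWave hd h₀ T
  obtain ⟨C, hC⟩ := hu.moments
  have hpc : Measurable (projIcc 0 T hT) := continuous_projIcc.measurable
  -- Nothing is known of u outside [0,T]; freezing time at the endpoints gives measurability and
  -- moment bounds for all real times without changing the drift.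
  have hmeas : Measurable fun q : (ℝ × Space d) × Ω => u (projIcc 0 T hT q.1.1) q.1.2 q.2 :=
    hu.jointlyMeasurable.comp
      (f := fun q : (ℝ × Space d) × Ω => ((projIcc 0 T hT q.1.1, q.1.2), q.2)) (by fun_prop)
  have hmom : ∀ s y, ∫⁻ ω, ‖u (projIcc 0 T hT s) y ω‖ₑ ∂P ≤ ((1 + C : ℝ≥0) : ℝ≥0∞) := by
    intro s y
    calc _ ≤ ∫⁻ ω, (1 + ‖u (projIcc 0 T hT s) y ω‖ₑ ^ 2) ∂P := by
          refine lintegral_mono fun ω => ?_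
          rcases le_total (‖u (projIcc 0 T hT s) y ω‖ₑ) 1 with h | h
          · exact h.trans le_self_add
          · exact (le_self_pow h two_ne_zero).trans le_add_self
      _ ≤ _ := by
          rw [lintegral_add_left measurable_const]
          push_cast
          gcongr
          · simp
          · exact hC _ (projIcc 0 T hT s).2 y
  have heq : ∀ (t : Icc (0 : ℝ) T) x, ∀ᵐ ω ∂P, u (projIcc 0 T hT t) x ω = (I + Y ω) (t, x)
      + driftTerm d b (fun s y => u (projIcc 0 T hT s) y ω) t x := by
    intro t x
    filter_upwards [hVu (t, x), hYV (t, x)] with ω h1 h2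
    simp only [projIcc_val, ContinuousMap.add_apply, hI, h2]
    rw [h1]
    congr 1
    refine intervalIntegral.integral_congr fun s hs => ?_
    rw [uIcc_of_le t.2.1] at hs
    simp only [projIcc_of_mem hT ⟨hs.1, hs.2.trans t.2.2⟩]
  obtain ⟨U, hUm, hU⟩ := exists_continuous_modification_of_solves (P := P) hd hT hb
    (fun p => (measurable_const (a := I p)).add (hYm p)) hmeas hmom heq
  exact ⟨U, hUm, fun t x => by simpa using hU t x⟩

end

theorem theorem4p2 (d : ℕ) (hd : d = 1 ∨ d = 2 ∨ d = 3) (T : ℝ) (hT : 0 < T)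
    (b : ℝ → ℝ) (hb : ∃ K : ℝ≥0, LipschitzWith K b) :
    -- every solution of the stochastic wave equation has a modification with continuous paths
    (∀ (Ω : Type*) [MeasurableSpace Ω] (P : Measure Ω) [IsProbabilityMeasure P]
      [P.IsComplete] (μ : Measure (Space d)) (W : NoiseTest d → Ω → ℝ)
      (_ : IsHomogeneousNoise P μ W)
      (q : ℝ) (_ : 0 < q) (_ : q < 2)
      (_ : ∫⁻ ξ : Space d, ENNReal.ofReal (1 / (1 + ‖ξ‖ ^ q)) ∂μ < ⊤)
      (u₀ v₀ : Space d → ℝ) (_ : WaveInitialData d u₀ v₀)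
      (u : ℝ → Space d → Ω → ℝ) (_ : IsMildSolution P μ W T b u₀ v₀ u),
      ∃ U : Ω → PathSpace d T,
        (∀ p, Measurable fun ω => U ω p) ∧
        ∀ (t : Icc (0 : ℝ) T) (x : Space d), ∀ᵐ ω ∂P, U ω (t, x) = u t x ω) ∧
    -- the deterministic integral equation is uniquely solvable, with continuous solution map
    (∀ η : PathSpace d T, ∃! z : PathSpace d T, SolvesIntegralEq d hT.le b η z) ∧
    (∀ F : PathSpace d T → PathSpace d T,
      (∀ η, SolvesIntegralEq d hT.le b η (F η)) → Continuous F) := by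
  obtain ⟨K, hK⟩ := hb
  exact ⟨fun Ω _ P _ _ μ W hW q hq hq2 hμ u₀ v₀ h₀ u hu =>
      hu.exists_continuous_modification hd hT.le hK hW hq hq2 hμ h₀,
    existsUnique_solution hd hT.le hK, fun F hF => continuous_solutionMap hd hT.le hK hF⟩
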